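/- Let $X$ be a smooth, projective, geometrically connected curve over a finite field $\mathbb F_q$, let $\infty$ be an $\mathbb F_q$-rational point of $X$, and let $A=\mathcal O(X\setminus\{\infty\})$. For $0\neq a\in A$ put $|a|=q^{-\mathrm{ord}_\infty(a)}$. Let $\mathfrak p$ be a maximal ideal of $A$, $t\in\mathfrak p\setminus\mathfrak p^2$, and $\hat q=|A/\mathfrak p|$. Let $R$ be an $A$-algebra that is a complete discrete valuation ring with maximal ideal $\pi R$, where $\pi$ is the image of $t$, and let $\phi:R\to R$ be an $A$-algebra endomorphism with $\phi(x)\equiv x^{\hat q}\bmod \pi R$ for all $x$. For an $R$-algebra $B$ let $W_n(B)$ be the $R$-algebra of $\pi$-typical Witt vectors $(x_0,\dots,x_n)$ over $B$: the set $B^{n+1}$ with the unique $R$-algebra structure, functorial in $B$, for which the Witt polynomials $x_0^{\hat q^m}+\pi x_1^{\hat q^{m-1}}+\dots+\pi^m x_m$ $(0\le m\le n)$ are ring homomorphisms to $B$ lying over $\phi^m$ on $R$. A Drinfeld module $E$ of rank $r$ over $\mathrm{Spf}\,R$ is an $A$-module scheme over $\mathrm{Spf}\,R$ that is isomorphic to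 the additive group $\hat{\mathbb G}_a$ as a group scheme, on whose tangent space at the identity $A$ acts through $A\to R$, and such that for every nonzero $a\in A$ the kernel of $a$ on $E$ is finite (locally free) of degree $|a|^r$ over $\mathrm{Spf}\,R$. Its $n$-th jet space $J^nE$ is the $A$-module scheme over $\mathrm{Spf}\,R$ with $(J^nE)(B)=E(W_n(B))$, and $\mathbf X_n(E)$ is the $R$-module of homomorphisms $J^nE\to\hat{\mathbb G}_a$ of $A$-module schemes over $\mathrm{Spf}\,R$, where $A$ acts on $\hat{\mathbb G}_a$ through $A\to R$. An $A$-linear lift of Frobenius on $E$ is a homomorphism $E\to E^{\phi}$ of $A$-module schemes over $\mathrm{Spf}\,R$, with $E^\phi$ the base change of $E$ along $\phi$, that reduces modulo $\pi$ to the relative $\hat q$-power Frobenius; if one exists, $E$ is called a canonical lift. The splitting order of $E$ is the integer $m$ with $\mathbf X_m(E)\neq 0$ and $\mathbf X_i(E)=0$ for $0\le i<m$. **Theorem.** Let $E$ be a Drinfeld module of rank $r$ over $\mathrm{Spf}\,R$. 1. $\mathbf X_r(E)\neq 0$. 2. $\mathbf X_1(E)$ is either isomorphic to $R$ as an $R$-module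 or zero. If $E$ admits an $A$-linear lift of Frobenius, then $\mathbf X_1(E)\cong R$. If $q\geq 3$, then conversely $\mathbf X_1(E)\cong R$ implies that $E$ admits an $A$-linear lift of Frobenius; so for $q\ge 3$ we have $\mathbf X_1(E)\cong R$ if and only if $E$ is a canonical lift. 3. Consequently $E$ has a (unique) splitting order $m$, and $1\leq m\leq r$. -/

import Mathlib

universe u v w

/-! ## The curve, the place at infinity and the ring `A` -/

/-- `F` is an algebraic function field in one variable over the field `Fq`: it is a finite extension
of `Fq(x)` for some `x` transcendental over `Fq`. -/
def IsFunctionFieldOver (Fq : Type v) (F : Type w) [Field Fq] [Field F] [Algebra Fq F] : Prop :=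
  ∃ x : F, Transcendental Fq x ∧ FiniteDimensional (IntermediateField.adjoin Fq {x}) F

/-- The normalized discrete valuation `vinf` of `F` (written multiplicatively, so that `vinf a` is
`exp (- ord a)`) is a place of degree one, i.e. its residue field is `Fq`. -/
def IsDegreeOnePlace (Fq : Type v) {F : Type w} [Field Fq] [Field F] [Algebra Fq F]
    (vinf : Valuation F (WithZero (Multiplicative ℤ))) : Prop :=
  Function.Surjective vinf ∧
    ∀ x : F, vinf x ≤ 1 → ∃ c : Fq, vinf (x - algebraMap Fq F c) < 1

/-- The ring of functions that are regular away from the place `vinf`: the intersection of the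
valuation rings of all other places of `F`.  (The trivial valuation ring `⊤` of `F`, the generic
point of the curve, imposes no condition.) -/
def regularRing {F : Type w} [Field F] (vinf : Valuation F (WithZero (Multiplicative ℤ))) :
    Subring F :=
  ⨅ (V : ValuationSubring F) (_ : V ≠ vinf.valuationSubring), V.toSubring

/-- The absolute value `|a| = q ^ (- ord_∞ a)` attached to the place `vinf`, where `q = #Fq`
(used for `a ≠ 0` only). -/
noncomputable def infNorm (Fq : Type v) {F : Type w} [Field F]
    (vinf : Valuation F (WithZero (Multiplicative ℤ))) (a : regularRing vinf) : ℚ :=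
  (Nat.card Fq : ℚ) ^ (WithZero.log (vinf (a : F)))

/-! ## Bases with a lift of Frobenius, and their Witt vectors -/

/-- A ring `R` of prime characteristic `p` with a nonzerodivisor `π` and a ring endomorphism `φ`
which fixes `π` and lifts the `p ^ e`-power Frobenius modulo `π`. -/
structure FrobBase (R : Type u) [CommRing R] where
  p : ℕ
  p_prime : p.Prime
  charP : CharP R p
  e : ℕ
  e_pos : 0 < e
  π : R
  π_regular : ∀ x : R, π * x = 0 → x = 0
  φ : R →+* R
  φ_π : φ π = π
  φ_frob : ∀ x : R, ∃ y : R, φ x = x ^ p ^ e + π * y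

namespace FrobBase

variable {R : Type u} [CommRing R] (D : FrobBase R)

/-- The exponent `q̂` of the Frobenius that is lifted. -/
def qhat : ℕ := D.p ^ D.e

/-- The `π`-derivation `δ x = (φ x - x ^ q̂) / π`. -/
noncomputable def δ (x : R) : R := Classical.choose (D.φ_frob x)

theorem φ_eq (x : R) : D.φ x = x ^ D.qhat + D.π * D.δ x := Classical.choose_spec (D.φ_frob x)

/-- The coordinates of the image of `r` under the canonical map from `R` to its Witt vectors,
determined by `∑_{k ≤ m} π ^ k * (coord r k) ^ (q̂ ^ (m - k)) = φ ^ m (r)`; see `ghost_coord`. -/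
noncomputable def coord (r : R) (m : ℕ) : R :=
  if m = 0 then r
  else ∑ k : Fin m, D.π ^ ((k : ℕ) + D.qhat ^ (m - 1 - k) - m) *
    D.δ (coord r k) ^ D.qhat ^ (m - 1 - k)
termination_by m
decreasing_by exact k.2

theorem one_lt_qhat : 1 < D.qhat := Nat.one_lt_pow D.e_pos.ne' D.p_prime.one_lt

theorem qhat_pow_ne_zero (k : ℕ) : D.qhat ^ k ≠ 0 :=
  pow_ne_zero _ (Nat.zero_lt_of_lt D.one_lt_qhat).ne'

/-- In an algebra of characteristic `p`, powers of the `q̂`-power map are additive. -/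
theorem sum_pow_qhat {B : Type*} [CommRing B] [CharP B D.p] {ι : Type*} (s : Finset ι)
    (f : ι → B) (k : ℕ) : (∑ i ∈ s, f i) ^ D.qhat ^ k = ∑ i ∈ s, f i ^ D.qhat ^ k := by
  have : Fact D.p.Prime := ⟨D.p_prime⟩
  rw [qhat, ← pow_mul]
  exact sum_pow_char_pow D.p _ s f

theorem add_pow_qhat {B : Type*} [CommRing B] [CharP B D.p] (x y : B) (k : ℕ) :
    (x + y) ^ D.qhat ^ k = x ^ D.qhat ^ k + y ^ D.qhat ^ k := by
  have : Fact D.p.Prime := ⟨D.p_prime⟩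
  rw [qhat, ← pow_mul]
  exact add_pow_char_pow x y _ _

theorem ghost_coord (r : R) (m : ℕ) :
    ∑ k ∈ Finset.range (m + 1), D.π ^ k * D.coord r k ^ D.qhat ^ (m - k) = (D.φ)^[m] r := by
  have := D.charP
  induction m with
  | zero => rw [zero_add, Finset.sum_range_one, coord, if_pos rfl]; simp
  | succ m ih =>
    rw [Function.iterate_succ_apply', ← ih, map_sum, Finset.sum_range_succ]
    have h1 : D.π ^ (m + 1) * D.coord r (m + 1) ^ D.qhat ^ (m + 1 - (m + 1))
        = ∑ k ∈ Finset.range (m + 1), D.π ^ k * (D.π * D.δ (D.coord r k)) ^ D.qhat ^ (m - k) := by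
      rw [Nat.sub_self, pow_zero, pow_one]
      conv_lhs => rw [coord]
      rw [if_neg (Nat.succ_ne_zero m), Finset.mul_sum, ← Fin.sum_univ_eq_sum_range
        (fun k => D.π ^ k * (D.π * D.δ (D.coord r k)) ^ D.qhat ^ (m - k))]
      refine Finset.sum_congr rfl fun k _ => ?_
      have hk : (k : ℕ) ≤ m := Nat.lt_succ_iff.mp k.2
      have hlt : m - k < D.qhat ^ (m - k) := Nat.lt_pow_self D.one_lt_qhat
      rw [Nat.add_sub_cancel, mul_pow, ← mul_assoc, ← mul_assoc, ← pow_add, ← pow_add]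
      congr 2
      omega
    rw [h1, ← Finset.sum_add_distrib]
    refine Finset.sum_congr rfl fun k hk => ?_
    have hk' : k ≤ m := Nat.lt_succ_iff.mp (Finset.mem_range.mp hk)
    rw [map_mul, map_pow, map_pow, D.φ_π, D.φ_eq, D.add_pow_qhat, mul_add, ← pow_mul,
      Nat.succ_sub hk', pow_succ']

/-- The underlying set of the ring `W_n(B)` of truncated `π`-typical Witt vectors
`(x_0, ..., x_n)` of an `R`-algebra `B`. -/
@[ext]
structure Witt (D : FrobBase R) (n : ℕ) (B : Type u) : Type u where
  coeff : Fin (n + 1) → B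

/-- The coefficients of the multiplication law of Witt vectors: `V^i[x] * V^j[y]` is
`π ^ min i j` times `V^(max i j) [x ^ q̂ ^ (max i j - i) * y ^ q̂ ^ (max i j - j)]`. -/
noncomputable def mulCoeff (i j m : ℕ) : R :=
  if max i j ≤ m then D.coord (D.π ^ min i j) (m - max i j) else 0

namespace Witt

variable {D} {n : ℕ} {B : Type u} [CommRing B]

/-! As all Witt polynomials are additive, addition is componentwise.  The product and the scalars are
the unique functorial ones for which the ghost map is a map of `R`-algebras: see `ghost_mul`,
`ghost_one`, `ghost_algebraMap` and `ghost_injective`. -/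

instance : Zero (D.Witt n B) := ⟨⟨fun _ => 0⟩⟩
instance : One (D.Witt n B) := ⟨⟨fun m => if (m : ℕ) = 0 then 1 else 0⟩⟩
instance : Add (D.Witt n B) := ⟨fun x y => ⟨fun m => x.coeff m + y.coeff m⟩⟩
instance : Neg (D.Witt n B) := ⟨fun x => ⟨fun m => - x.coeff m⟩⟩
instance : Sub (D.Witt n B) := ⟨fun x y => ⟨fun m => x.coeff m - y.coeff m⟩⟩
instance : SMul ℕ (D.Witt n B) := ⟨fun k x => ⟨fun m => k • x.coeff m⟩⟩
instance : SMul ℤ (D.Witt n B) := ⟨fun k x => ⟨fun m => k • x.coeff m⟩⟩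

theorem zero_coeff (m) : (0 : D.Witt n B).coeff m = 0 := rfl
theorem one_coeff (m) : (1 : D.Witt n B).coeff m = if (m : ℕ) = 0 then 1 else 0 := rfl
theorem add_coeff (x y : D.Witt n B) (m) : (x + y).coeff m = x.coeff m + y.coeff m := rfl
variable [Algebra R B]

/-- The Witt polynomials `w_m = x_0 ^ q̂ ^ m + π x_1 ^ q̂ ^ (m - 1) + ... + π ^ m x_m`. -/
def ghost (x : D.Witt n B) (m : Fin (n + 1)) : B :=
  ∑ i : Fin (n + 1), if (i : ℕ) ≤ m then
    algebraMap R B (D.π ^ (i : ℕ)) * x.coeff i ^ D.qhat ^ ((m : ℕ) - i) else 0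

noncomputable instance : Mul (D.Witt n B) := ⟨fun x y => ⟨fun m =>
  ∑ i : Fin (n + 1), ∑ j : Fin (n + 1), algebraMap R B (D.mulCoeff i j m) *
    (x.coeff i ^ D.qhat ^ ((m : ℕ) - i) * y.coeff j ^ D.qhat ^ ((m : ℕ) - j))⟩⟩

theorem mul_coeff (x y : D.Witt n B) (m) : (x * y).coeff m =
    ∑ i : Fin (n + 1), ∑ j : Fin (n + 1), algebraMap R B (D.mulCoeff i j m) *
      (x.coeff i ^ D.qhat ^ ((m : ℕ) - i) * y.coeff j ^ D.qhat ^ ((m : ℕ) - j)) := rfl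

theorem sum_fin_ite {M : Type*} [AddCommMonoid M] (g : ℕ → M) (m : Fin (n + 1)) :
    (∑ i : Fin (n + 1), if (i : ℕ) ≤ m then g i else 0) = ∑ i ∈ Finset.range ((m : ℕ) + 1), g i := by
  rw [Fin.sum_univ_eq_sum_range (fun i => if i ≤ (m : ℕ) then g i else 0), ← Finset.sum_filter]
  congr 1
  ext i
  have := m.2
  simp only [Finset.mem_filter, Finset.mem_range]
  omega

theorem sum_mulCoeff (i j m : Fin (n + 1)) :
    (∑ l : Fin (n + 1), if (l : ℕ) ≤ m then
      D.π ^ (l : ℕ) * D.mulCoeff i j l ^ D.qhat ^ ((m : ℕ) - l) else 0) =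
      if max (i : ℕ) j ≤ m then D.π ^ ((i : ℕ) + j) else 0 := by
  rw [sum_fin_ite (fun l => D.π ^ l * D.mulCoeff i j l ^ D.qhat ^ ((m : ℕ) - l))]
  split_ifs with h
  · obtain ⟨k, hk⟩ := Nat.exists_eq_add_of_le h
    rw [hk, add_assoc, Finset.sum_range_add, Finset.sum_eq_zero, zero_add]
    · have h2 := D.ghost_coord (D.π ^ min (i : ℕ) j) k
      have h3 : (D.φ)^[k] (D.π ^ min (i : ℕ) j) = D.π ^ min (i : ℕ) j :=
        Function.iterate_fixed (by rw [map_pow, D.φ_π]) k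
      rw [h3] at h2
      rw [← max_add_min (i : ℕ) j, pow_add, ← h2, Finset.mul_sum]
      refine Finset.sum_congr rfl fun l _ => ?_
      rw [mulCoeff, if_pos (Nat.le_add_right _ _), Nat.add_sub_cancel_left, Nat.add_sub_add_left,
        pow_add, mul_assoc]
    · intro l hl
      rw [mulCoeff, if_neg (not_le.mpr (Finset.mem_range.mp hl)),
        zero_pow (D.qhat_pow_ne_zero _), mul_zero]
  · refine Finset.sum_eq_zero fun l hl => ?_
    have hl' := Finset.mem_range.mp hl
    rw [mulCoeff, if_neg (by omega), zero_pow (D.qhat_pow_ne_zero _), mul_zero]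

theorem ghost_add [CharP B D.p] (x y : D.Witt n B) : ghost (x + y) = ghost x + ghost y := by
  funext m
  simp only [ghost, Pi.add_apply, ← Finset.sum_add_distrib, add_coeff]
  refine Finset.sum_congr rfl fun i _ => ?_
  split_ifs
  · rw [D.add_pow_qhat, mul_add]
  · rw [add_zero]

theorem ghost_zero : ghost (0 : D.Witt n B) = 0 := by
  funext m
  refine Finset.sum_eq_zero fun i _ => ?_
  rw [zero_coeff, zero_pow (D.qhat_pow_ne_zero _), mul_zero, ite_self]

theorem ghost_one : ghost (1 : D.Witt n B) = 1 := by
  funext m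
  simp only [ghost, Pi.one_apply]
  rw [Finset.sum_eq_single 0]
  · simp [one_coeff]
  · intro i _ hi
    have : (i : ℕ) ≠ 0 := fun h => hi (Fin.ext h)
    rw [one_coeff, if_neg this, zero_pow (D.qhat_pow_ne_zero _), mul_zero, ite_self]
  · simp

/-- The ghost map is multiplicative. -/
theorem ghost_mul [CharP B D.p] (x y : D.Witt n B) : ghost (x * y) = ghost x * ghost y := by
  funext m
  have key : ∀ i j : Fin (n + 1),
      (∑ l : Fin (n + 1), if (l : ℕ) ≤ m then algebraMap R B (D.π ^ (l : ℕ)) *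
        (algebraMap R B (D.mulCoeff i j l) *
          (x.coeff i ^ D.qhat ^ ((l : ℕ) - i) * y.coeff j ^ D.qhat ^ ((l : ℕ) - j))) ^ D.qhat ^ ((m : ℕ) - l)
        else 0) =
      (if (i : ℕ) ≤ m then algebraMap R B (D.π ^ (i : ℕ)) * x.coeff i ^ D.qhat ^ ((m : ℕ) - i) else 0) *
      (if (j : ℕ) ≤ m then algebraMap R B (D.π ^ (j : ℕ)) * y.coeff j ^ D.qhat ^ ((m : ℕ) - j) else 0) := by
    intro i j
    have h1 : ∀ l : Fin (n + 1), (if (l : ℕ) ≤ m then algebraMap R B (D.π ^ (l : ℕ)) *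
        (algebraMap R B (D.mulCoeff i j l) *
          (x.coeff i ^ D.qhat ^ ((l : ℕ) - i) * y.coeff j ^ D.qhat ^ ((l : ℕ) - j))) ^ D.qhat ^ ((m : ℕ) - l)
        else 0) = algebraMap R B (if (l : ℕ) ≤ m then
          D.π ^ (l : ℕ) * D.mulCoeff i j l ^ D.qhat ^ ((m : ℕ) - l) else 0) *
          (x.coeff i ^ D.qhat ^ ((m : ℕ) - i) * y.coeff j ^ D.qhat ^ ((m : ℕ) - j)) := by
      intro l
      split_ifs with hl
      · by_cases hm : max (i : ℕ) j ≤ l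
        · have hi : (i : ℕ) ≤ l := le_trans (le_max_left _ _) hm
          have hj : (j : ℕ) ≤ l := le_trans (le_max_right _ _) hm
          rw [mul_pow, mul_pow, ← pow_mul, ← pow_mul, ← pow_add, ← pow_add, show (l : ℕ) - i + (m - l) = m - i by omega,
            show (l : ℕ) - j + (m - l) = m - j by omega, map_mul,
            map_pow (algebraMap R B) (D.mulCoeff i j l)]
          ring
        · rw [mulCoeff, if_neg hm, map_zero, zero_mul, zero_pow (D.qhat_pow_ne_zero _),
            zero_pow (D.qhat_pow_ne_zero _), mul_zero, mul_zero, map_zero, zero_mul]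
      · rw [map_zero, zero_mul]
    rw [Finset.sum_congr rfl fun l _ => h1 l, ← Finset.sum_mul, ← map_sum, sum_mulCoeff]
    by_cases hi : (i : ℕ) ≤ m <;> by_cases hj : (j : ℕ) ≤ m
    · rw [if_pos (max_le hi hj), if_pos hi, if_pos hj, pow_add, map_mul]
      ring
    · rw [if_neg (fun h => hj (le_trans (le_max_right _ _) h)), if_neg hj, map_zero, zero_mul,
        mul_zero]
    · rw [if_neg (fun h => hi (le_trans (le_max_left _ _) h)), if_neg hi, map_zero, zero_mul,
        zero_mul]
    · rw [if_neg (fun h => hj (le_trans (le_max_right _ _) h)), if_neg hj, map_zero, zero_mul,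
        mul_zero]
  rw [Pi.mul_apply, ghost, ghost, ghost, Finset.sum_mul_sum]
  simp_rw [← key]
  rw [Finset.sum_congr rfl fun i _ => Finset.sum_comm, Finset.sum_comm]
  refine Finset.sum_congr rfl fun l _ => ?_
  rw [mul_coeff]
  split_ifs with hl
  · simp_rw [D.sum_pow_qhat, Finset.mul_sum]
  · simp

theorem ghost_injective (hB : ∀ b : B, algebraMap R B D.π * b = 0 → b = 0) :
    Function.Injective (ghost : D.Witt n B → Fin (n + 1) → B) := by
  have hpow : ∀ (k : ℕ) (b c : B),
      algebraMap R B (D.π ^ k) * b = algebraMap R B (D.π ^ k) * c → b = c := by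
    intro k
    induction k with
    | zero => intro b c h; simpa using h
    | succ k ih =>
      intro b c h
      apply ih
      rw [pow_succ', map_mul, mul_assoc, mul_assoc, ← sub_eq_zero, ← mul_sub] at h
      exact sub_eq_zero.mp (hB _ h)
  intro x y h
  have main : ∀ m : ℕ, ∀ hm : m < n + 1, x.coeff ⟨m, hm⟩ = y.coeff ⟨m, hm⟩ := by
    intro m
    induction m using Nat.strong_induction_on with
    | _ m ih =>
      intro hm
      have h1 := congrFun h ⟨m, hm⟩
      simp only [ghost] at h1
      rw [← Finset.add_sum_erase _ _ (Finset.mem_univ (⟨m, hm⟩ : Fin (n + 1))),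
        ← Finset.add_sum_erase _ _ (Finset.mem_univ (⟨m, hm⟩ : Fin (n + 1)))] at h1
      have h2 : ∀ i ∈ Finset.univ.erase (⟨m, hm⟩ : Fin (n + 1)),
          (if (i : ℕ) ≤ m then algebraMap R B (D.π ^ (i : ℕ)) * x.coeff i ^ D.qhat ^ (m - i) else 0) =
          (if (i : ℕ) ≤ m then algebraMap R B (D.π ^ (i : ℕ)) * y.coeff i ^ D.qhat ^ (m - i) else 0) := by
        intro i hi
        have hne : (i : ℕ) ≠ m := fun h => (Finset.mem_erase.mp hi).1 (Fin.ext h)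
        split_ifs with hle
        · have : x.coeff i = y.coeff i := ih i (lt_of_le_of_ne hle hne) i.2
          rw [this]
        · rfl
      rw [Finset.sum_congr rfl h2] at h1
      have h3 := add_right_cancel h1
      simp only [le_refl, if_true, Nat.sub_self, pow_zero, pow_one] at h3
      exact hpow _ _ _ h3
  ext m
  exact main m m.2

/-- The map of Witt vectors induced by a map of algebras. -/
def map {C : Type u} (f : B → C) (x : D.Witt n B) : D.Witt n C := ⟨fun m => f (x.coeff m)⟩

section map
variable {C : Type u} [CommRing C] [Algebra R C] (f : B →ₐ[R] C)

theorem map_zero' : map f (0 : D.Witt n B) = 0 := Witt.ext (funext fun _ => map_zero f)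
theorem map_one' : map f (1 : D.Witt n B) = 1 := by
  ext m
  change f (if (m : ℕ) = 0 then 1 else 0) = if (m : ℕ) = 0 then 1 else 0
  split_ifs
  · exact map_one f
  · exact map_zero f
theorem map_add' (x y : D.Witt n B) : map f (x + y) = map f x + map f y :=
  Witt.ext (funext fun _ => map_add f _ _)
theorem map_mul' (x y : D.Witt n B) : map f (x * y) = map f x * map f y := by
  ext m
  simp only [map, mul_coeff, map_sum, map_mul, map_pow, AlgHom.commutes]

end map

/-- The ring axioms for `π`-torsion free algebras of characteristic `p`. -/
theorem ring_axioms_of_regular [CharP B D.p]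
    (hB : ∀ b : B, algebraMap R B D.π * b = 0 → b = 0) :
    (∀ x y : D.Witt n B, x * y = y * x) ∧ (∀ x y z : D.Witt n B, x * y * z = x * (y * z)) ∧
    (∀ x y z : D.Witt n B, x * (y + z) = x * y + x * z) ∧ (∀ x : D.Witt n B, 1 * x = x) := by
  have inj := ghost_injective (D := D) (n := n) hB
  refine ⟨fun x y => inj ?_, fun x y z => inj ?_, fun x y z => inj ?_, fun x => inj ?_⟩
  · rw [ghost_mul, ghost_mul, mul_comm]
  · rw [ghost_mul, ghost_mul, ghost_mul, ghost_mul, mul_assoc]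
  · rw [ghost_mul, ghost_add, ghost_add, ghost_mul, ghost_mul, mul_add]
  · rw [ghost_mul, ghost_one, one_mul]

theorem ring_axioms (D : FrobBase R) (n : ℕ) (B : Type u) [CommRing B] [Algebra R B] :
    (∀ x y : D.Witt n B, x * y = y * x) ∧ (∀ x y z : D.Witt n B, x * y * z = x * (y * z)) ∧
    (∀ x y z : D.Witt n B, x * (y + z) = x * y + x * z) ∧ (∀ x : D.Witt n B, 1 * x = x) := by
  have := D.charP
  let P := MvPolynomial B R
  have : CharP P D.p := inferInstance
  have hP : ∀ b : P, algebraMap R P D.π * b = 0 → b = 0 := by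
    intro b hb
    ext s
    have := congrArg (MvPolynomial.coeff s) hb
    rw [MvPolynomial.algebraMap_eq, MvPolynomial.coeff_C_mul, MvPolynomial.coeff_zero] at this
    rw [MvPolynomial.coeff_zero]
    exact D.π_regular _ this
  obtain ⟨h1, h2, h3, h4⟩ := ring_axioms_of_regular (D := D) (n := n) hP
  let f : P →ₐ[R] B := MvPolynomial.aeval id
  have hf : ∀ x : D.Witt n B, ∃ y : D.Witt n P, map f y = x := fun x =>
    ⟨⟨fun m => MvPolynomial.X (x.coeff m)⟩,
      Witt.ext (funext fun m => MvPolynomial.aeval_X id (x.coeff m))⟩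
  refine ⟨fun x y => ?_, fun x y z => ?_, fun x y z => ?_, fun x => ?_⟩
  · obtain ⟨x, rfl⟩ := hf x
    obtain ⟨y, rfl⟩ := hf y
    rw [← map_mul', h1, map_mul']
  · obtain ⟨x, rfl⟩ := hf x
    obtain ⟨y, rfl⟩ := hf y
    obtain ⟨z, rfl⟩ := hf z
    rw [← map_mul', ← map_mul', h2, map_mul', map_mul']
  · obtain ⟨x, rfl⟩ := hf x
    obtain ⟨y, rfl⟩ := hf y
    obtain ⟨z, rfl⟩ := hf z
    rw [← map_add', ← map_mul', h3, map_add', map_mul', map_mul']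
  · obtain ⟨x, rfl⟩ := hf x
    rw [← map_one' f, ← map_mul', h4]

/-- The ring structure on `W_n(B)`. -/
noncomputable instance : CommRing (D.Witt n B) where
  add_assoc x y z := Witt.ext (funext fun _ => add_assoc _ _ _)
  zero_add x := Witt.ext (funext fun _ => zero_add _)
  add_zero x := Witt.ext (funext fun _ => add_zero _)
  add_comm x y := Witt.ext (funext fun _ => add_comm _ _)
  neg_add_cancel x := Witt.ext (funext fun _ => neg_add_cancel _)
  sub_eq_add_neg x y := Witt.ext (funext fun _ => sub_eq_add_neg _ _)
  nsmul k x := k • x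
  nsmul_zero x := Witt.ext (funext fun _ => zero_nsmul _)
  nsmul_succ k x := Witt.ext (funext fun _ => succ_nsmul _ _)
  zsmul k x := k • x
  zsmul_zero' x := Witt.ext (funext fun _ => zero_zsmul _)
  zsmul_succ' k x := Witt.ext (funext fun _ => SubNegMonoid.zsmul_succ' _ _)
  zsmul_neg' k x := Witt.ext (funext fun _ => SubNegMonoid.zsmul_neg' _ _)
  mul_comm := (ring_axioms D n B).1
  mul_assoc := (ring_axioms D n B).2.1
  left_distrib := (ring_axioms D n B).2.2.1
  right_distrib x y z := by
    rw [(ring_axioms D n B).1, (ring_axioms D n B).2.2.1, (ring_axioms D n B).1 z x,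
      (ring_axioms D n B).1 z y]
  one_mul := (ring_axioms D n B).2.2.2
  mul_one x := by rw [(ring_axioms D n B).1, (ring_axioms D n B).2.2.2]
  zero_mul x := by
    ext m
    rw [mul_coeff]
    refine Finset.sum_eq_zero fun i _ => Finset.sum_eq_zero fun j _ => ?_
    rw [zero_coeff, zero_pow (D.qhat_pow_ne_zero _), zero_mul, mul_zero]
  mul_zero x := by
    ext m
    rw [mul_coeff]
    refine Finset.sum_eq_zero fun i _ => Finset.sum_eq_zero fun j _ => ?_
    rw [zero_coeff, zero_pow (D.qhat_pow_ne_zero _), mul_zero, mul_zero]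

/-- The ghost components of the Witt vector with coordinates `coord r m` are `φ ^ m (r)`. -/
theorem ghost_mk_coord (r : R) (m : Fin (n + 1)) :
    ghost (⟨fun k => D.coord r k⟩ : D.Witt n R) m = (D.φ)^[m] r := by
  rw [← D.ghost_coord, ghost, ← sum_fin_ite]
  rfl

/-- The canonical ring homomorphism `R → W_n(R)`, with ghost components `φ ^ m (r)`. -/
noncomputable def ofBase (D : FrobBase R) (n : ℕ) : R →+* D.Witt n R :=
  haveI := D.charP
  have inj := ghost_injective (D := D) (n := n) (B := R) D.π_regular
  { toFun := fun r => ⟨fun m => D.coord r m⟩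
    map_one' := inj <| funext fun m => by
      rw [ghost_mk_coord, ghost_one, ← RingHom.coe_pow, map_one, Pi.one_apply]
    map_zero' := inj <| funext fun m => by
      rw [ghost_mk_coord, ghost_zero, ← RingHom.coe_pow, map_zero, Pi.zero_apply]
    map_add' := fun x y => inj <| funext fun m => by
      rw [ghost_mk_coord, ghost_add, Pi.add_apply, ghost_mk_coord, ghost_mk_coord, ← RingHom.coe_pow,
        map_add]
    map_mul' := fun x y => inj <| funext fun m => by
      rw [ghost_mk_coord, ghost_mul, Pi.mul_apply, ghost_mk_coord, ghost_mk_coord, ← RingHom.coe_pow,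
        map_mul] }

/-- Functoriality of `W_n`, as a ring homomorphism. -/
def mapHom {C : Type u} [CommRing C] [Algebra R C] (f : B →ₐ[R] C) :
    D.Witt n B →+* D.Witt n C where
  toFun := map f
  map_one' := map_one' f
  map_zero' := map_zero' f
  map_add' := map_add' f
  map_mul' := map_mul' f

/-- The `R`-algebra structure on `W_n(B)`; the structure map is the composite
`R → W_n(R) → W_n(B)`. -/
noncomputable instance : Algebra R (D.Witt n B) :=
  ((mapHom (Algebra.ofId R B)).comp (ofBase D n)).toAlgebra

theorem algebraMap_apply (r : R) (m : Fin (n + 1)) :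
    (algebraMap R (D.Witt n B) r).coeff m = algebraMap R B (D.coord r m) := rfl

/-- The ghost map is a map of `R`-algebras, where `R` acts on the `m`-th factor through `φ ^ m`. -/
theorem ghost_algebraMap (r : R) (m : Fin (n + 1)) :
    ghost (algebraMap R (D.Witt n B) r) m = algebraMap R B ((D.φ)^[m] r) := by
  rw [← ghost_mk_coord (n := n) r m, ghost, ghost, map_sum]
  refine Finset.sum_congr rfl fun i _ => ?_
  split_ifs
  · rw [map_mul, map_pow (algebraMap R B) (D.coord r i)]
    rfl
  · rw [map_zero]

theorem isNilpotent_π (hB : IsNilpotent (algebraMap R B D.π)) :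
    IsNilpotent (algebraMap R (D.Witt n B) D.π) := by
  obtain ⟨N, hN⟩ := hB
  have step : ∀ m : ℕ, ∀ j : Fin (n + 1), (j : ℕ) < m →
      (algebraMap R (D.Witt n B) (D.π ^ (m * N))).coeff j = 0 := by
    intro m
    induction m with
    | zero => intro j hj; omega
    | succ m ih =>
      intro j hj
      rw [Nat.succ_mul, pow_add, map_mul, mul_coeff]
      refine Finset.sum_eq_zero fun i _ => ?_
      by_cases hi : (i : ℕ) < m
      · refine Finset.sum_eq_zero fun k _ => ?_
        rw [ih i hi, zero_pow (D.qhat_pow_ne_zero _), zero_mul, mul_zero]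
      by_cases hij : (i : ℕ) = j
      · have h1 : ∀ k : Fin (n + 1), algebraMap R B (D.mulCoeff i k j) *
            ((algebraMap R (D.Witt n B) (D.π ^ (m * N))).coeff i ^ D.qhat ^ ((j : ℕ) - i) *
              (algebraMap R (D.Witt n B) (D.π ^ N)).coeff k ^ D.qhat ^ ((j : ℕ) - k)) =
            (algebraMap R (D.Witt n B) (D.π ^ (m * N))).coeff i *
              (if (k : ℕ) ≤ j then algebraMap R B (D.π ^ (k : ℕ)) *
                (algebraMap R (D.Witt n B) (D.π ^ N)).coeff k ^ D.qhat ^ ((j : ℕ) - k) else 0) := by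
          intro k
          by_cases hk : (k : ℕ) ≤ j
          · rw [if_pos hk, mulCoeff, hij, max_eq_left hk, min_eq_right hk, if_pos le_rfl,
              Nat.sub_self, coord, if_pos rfl, pow_zero, pow_one]
            ring
          · rw [if_neg hk, mulCoeff, if_neg (fun h => hk (le_trans (le_max_right _ _) h)),
              map_zero, zero_mul, mul_zero]
        rw [Finset.sum_congr rfl fun k _ => h1 k, ← Finset.mul_sum]
        have h2 := ghost_algebraMap (D := D) (B := B) (D.π ^ N) j
        rw [Function.iterate_fixed (by rw [map_pow, D.φ_π]), map_pow (algebraMap R B), hN] at h2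
        rw [ghost] at h2
        rw [h2, mul_zero]
      · refine Finset.sum_eq_zero fun k _ => ?_
        rw [mulCoeff, if_neg (fun h => by omega), map_zero, zero_mul]
  refine ⟨(n + 1) * N, ?_⟩
  rw [← map_pow]
  ext j
  rw [step (n + 1) j j.2]
  rfl

end Witt

/-! ## Formal schemes over `Spf R` as functors on `R`-algebras in which `π` is nilpotent -/

/-- The test objects: `R`-algebras in which `π` is nilpotent. -/
structure NilAlg (D : FrobBase R) : Type (u + 1) where
  carrier : Type u
  [commRing : CommRing carrier]
  [algebra : Algebra R carrier]
  nil : IsNilpotent (algebraMap R carrier D.π)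

namespace NilAlg

instance : CoeSort D.NilAlg (Type u) := ⟨carrier⟩

instance (B : D.NilAlg) : CommRing B := B.commRing

instance (B : D.NilAlg) : Algebra R B := B.algebra

variable {D}

/-- The algebra `W_n(B)`. -/
noncomputable abbrev witt (n : ℕ) (B : D.NilAlg) : D.NilAlg where
  carrier := D.Witt n B
  nil := Witt.isNilpotent_π B.nil

/-- The algebra `B^φ`: the ring `B` with structure map `R → R → B`, the first map being `φ`. -/
abbrev twist (B : D.NilAlg) : D.NilAlg where
  carrier := B
  algebra := ((algebraMap R B).comp D.φ).toAlgebra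
  nil := by
    have h : @algebraMap R B _ _ ((algebraMap R B).comp D.φ).toAlgebra D.π
        = algebraMap R B D.π := congrArg (algebraMap R B) D.φ_π
    rw [h]
    exact B.nil

/-- The dual numbers `B[ε]`. -/
abbrev dual (B : D.NilAlg) : D.NilAlg where
  carrier := DualNumber B
  nil := by
    have h := B.nil.map (algebraMap B (DualNumber B))
    rwa [← IsScalarTower.algebraMap_apply] at h

end NilAlg
end FrobBase

/-! ## Drinfeld modules over `Spf R` -/

/-- A (coordinatized) admissible `A`-module scheme over `Spf R`: the additive group `B ↦ (B, +)` over
`Spf R`, equipped with a ring homomorphism from `A` to its endomorphisms (natural families of additive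
maps) such that the induced action of `A` on the tangent space `{ε b} = ker (E(B[ε]) → E(B))` at the
identity is the one coming from the structure map `A → R`. -/
structure AdmissibleModule (A : Type w) [CommRing A] {R : Type u} [CommRing R] [Algebra A R]
    (D : FrobBase R) where
  act : A → ∀ B : D.NilAlg, B →+ B
  act_natural : ∀ (a : A) (B C : D.NilAlg) (f : B →ₐ[R] C) (x : B),
    act a C (f x) = f (act a B x)
  act_one : ∀ (B : D.NilAlg) (x : B), act 1 B x = x
  act_mul : ∀ (a b : A) (B : D.NilAlg) (x : B), act (a * b) B x = act a B (act b B x)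
  act_add : ∀ (a b : A) (B : D.NilAlg) (x : B), act (a + b) B x = act a B x + act b B x
  strict : ∀ (a : A) (B : D.NilAlg) (b : B),
    act a B.dual (TrivSqZeroExt.inr b : DualNumber B) =
      (TrivSqZeroExt.inr (algebraMap R B (algebraMap A R a) * b) : DualNumber B)

namespace AdmissibleModule

variable {A : Type w} [CommRing A] {R : Type u} [CommRing R] [Algebra A R] {D : FrobBase R}
  (E : AdmissibleModule A D)

/-- `ker (E.act a)` is finite (locally free) of degree `d` over `Spf R`: it is represented by an
`R`-algebra which is a free `R`-module of rank `d`. -/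
def KernelHasDegree (a : A) (d : ℚ) : Prop :=
  ∃ (C : Type u) (_ : CommRing C) (_ : Algebra R C),
    Module.Finite R C ∧ Module.Free R C ∧ (Module.finrank R C : ℚ) = d ∧
    ∃ e : ∀ B : D.NilAlg, (C →ₐ[R] B) ≃ {x : B // E.act a B x = 0},
      ∀ (B B' : D.NilAlg) (f : B →ₐ[R] B') (g : C →ₐ[R] B),
        (e B' (f.comp g) : B') = f (e B g)

/-- `E` is a Drinfeld module of rank `r`: for each nonzero `a`, the kernel of `a` is finite of degree
`|a| ^ r`. -/
def IsDrinfeld (norm : A → ℚ) (r : ℕ) : Prop :=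
  ∀ a : A, a ≠ 0 → E.KernelHasDegree a (norm a ^ r)

/-- The `R`-module `X_n(E)` of characters of order `n`: homomorphisms of `A`-module schemes over
`Spf R` from the jet space `J^n E`, whose functor of points is `B ↦ E(W_n(B))`, to the additive group
on which `A` acts through scalars. -/
noncomputable def X (n : ℕ) : Submodule R (∀ B : D.NilAlg, D.Witt n B →+ B) where
  carrier := {Θ |
    (∀ (B C : D.NilAlg) (f : B →ₐ[R] C) (x : D.Witt n B), Θ C (x.map f) = f (Θ B x)) ∧
    ∀ (a : A) (B : D.NilAlg) (x : D.Witt n B),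
      Θ B (E.act a (B.witt n) x) = algebraMap R B (algebraMap A R a) * Θ B x}
  zero_mem' := by
    constructor
    · intro B C f x
      exact (map_zero f).symm
    · intro a B x
      exact (mul_zero _).symm
  add_mem' := by
    rintro Θ Ψ ⟨h1, h2⟩ ⟨h3, h4⟩
    constructor
    · intro B C f x
      simp only [Pi.add_apply, AddMonoidHom.add_apply, map_add, h1, h3]
    · intro a B x
      change Θ B _ + Ψ B _ = _ * (Θ B x + Ψ B x)
      rw [h2, h4, mul_add]
  smul_mem' := by
    rintro c Θ ⟨h1, h2⟩
    constructor
    · intro B C f x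
      simp only [Pi.smul_apply, AddMonoidHom.smul_apply, map_smul, h1]
    · intro a B x
      change c • Θ B _ = _ * (c • Θ B x)
      rw [h2, mul_smul_comm]

/-- `E` has an `A`-linear lift of Frobenius (`E` is a canonical lift): there is a homomorphism
`ψ : E → E^φ` of `A`-module schemes over `Spf R`, where `E^φ(B) = E(B^φ)` is the base change of `E`
along `φ`, whose reduction modulo `π` is the relative `q̂`-power Frobenius. -/
def HasFrobeniusLift : Prop :=
  ∃ ψ : ∀ B : D.NilAlg, B →+ B.twist,
    (∀ (B C : D.NilAlg) (f : B →ₐ[R] C) (x : B), ψ C (f x) = f (ψ B x)) ∧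
    (∀ (a : A) (B : D.NilAlg) (x : B), ψ B (E.act a B x) = E.act a B.twist (ψ B x)) ∧
    ∀ B : D.NilAlg, algebraMap R B D.π = 0 → ∀ x : B, ψ B x = (x ^ D.qhat : B)

/-- `E` splits at order `m`, i.e. `m` is the splitting order of `E`. -/
def SplitsAt (m : ℕ) : Prop := E.X m ≠ ⊥ ∧ ∀ i < m, E.X i = ⊥

end AdmissibleModule

/-!
The proof translates everything into twisted power series `∑ f i τ ^ i`, `τ b = b ^ p τ`, and then
compares the characters of `E` with logarithms.

As `E` is the additive group, Yoneda's lemma identifies natural additive operations on test algebras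
with series over `R` whose coefficients tend to zero (`FrobBase.exists_restricted_eq_eval`).  So the
action of `A` becomes a ring homomorphism `ρ` into such *restricted* series, and the degree of the
kernel of `a` is `p ^ n`, where `n` is the degree of the reduction of `ρ a` modulo `π`
(`KernelHasDegree.exists_top_coeff`).  Over the fraction field `K`, the series `ρ t` has a logarithm
`l`, the unique series with constant term `1` and `l ρ_t = π l`; it linearizes the whole action of `A`,
and the same applies to the twist of `E` by `φ ^ m`, with logarithm `l_m` (`twistLog`).  A combination
`∑ c m • l_m ∘ w m` of the ghost maps `w m` is `A`-linear, and it is a character of order `n` as soon as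
its `n + 1` coordinates, which are series over `K`, are restricted series over `R`
(`IsGivenBy.exists_mem_X`).

*Order zero and one.*  A character of order zero satisfies `g ρ_t = π g`; the reduction of `ρ t` is not
zero and twisted series over a field form a domain, so that `g` is divisible by all powers of `π`.
Similarly a character of order one is determined by the constant term of its second coordinate, so
that these characters form an ideal of `R`.  A lift of Frobenius `τ ^ e + π h` gives the character with
coordinates `- s h` and `s`, where `s = π⁻¹ l₁ π`.  Conversely a primitive character of order one has the
form `(g, s)` up to a unit, and `h = - s⁻¹ g` gives a lift of Frobenius.  This needs `s` to be
invertible among restricted series, i.e. `s ≡ 1` modulo `π`, which holds for `q ≥ 3`: for odd `p` by the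
size of the denominators of `l₁`, and for `p = 2` because a constant `c` with `c ^ 2 ≠ c`, which acts
linearly on the reduction of `E`, forces the linear term of `s` to be divisible by `π`
(`IsGivenBy.hasFrobeniusLift_of_X_one_ne_bot`).

*Order `r`.*  The series `l_m τ ^ (e m)`, `1 ≤ m ≤ r`, are not integral, but they are `A`-linear up to
restricted series, and thus give `r` cocycles (`IsGivenBy.exists_toFrac_eq_defect`).  A dependence of
them modulo coboundaries is the same as a nonzero character of order `r` (`IsGivenBy.X_ne_bot`), and by
successive approximation it suffices to find a dependence modulo `π`.  Over the residue field `k` of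
`R`, the claim is that the space of polynomials `m` without constant term such that
`m ρ_b ≡ b m` modulo `k{τ} ρ_t` for all `b` has dimension less than `r` modulo `k{τ} ρ_t`
(`IsDrinfeldModule.exists_sum_smul_eq`).  After averaging over the constants, the `m` lie in the
commutant `M` of the constant field, on which `k ⊗ A` acts without torsion, and in which any `r + 1`
elements are dependent over `k ⊗ A`, by comparison of degrees.  If `m₁, …, m_r` were independent, then
the module `Z` of relations over `k ⊗ A` between `1, m₁, …, m_r` would satisfy `Z = P Z`, where `P` is the
kernel of the augmentation `k ⊗ A → k`: here one uses that `t` generates `P` locally, which comes from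
`t` being a local parameter of `A` (`IsDrinfeldModule.exists_augmentation_eq_one`).  Nakayama's lemma and
the torsion freeness then give `Z = 0`, a contradiction.

The facts about `A` that are used are that it is integrally closed and that the pole order at the rational
point behaves like a degree (`isDegree_regularRing`).
-/

set_option linter.unusedSectionVars false

/-! ### Twisted power series -/

/-- The twisted power series `∑ f i τ ^ i` over a ring `B` of characteristic `p`, where
`τ b = b ^ p τ`.  A series is encoded by its sequence of coefficients. -/
def SkewSeries (_p : ℕ) (B : Type*) : Type _ := ℕ → B

namespace SkewSeries

variable {p : ℕ} {B C : Type*}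

/-- The coefficient of `τ ^ n`. -/
def coeff (n : ℕ) (f : SkewSeries p B) : B := f n

/-- The series with given coefficients. -/
def mk (f : ℕ → B) : SkewSeries p B := f

@[ext]
theorem ext {f g : SkewSeries p B} (h : ∀ n, coeff n f = coeff n g) : f = g := funext h

@[simp] theorem coeff_mk (f : ℕ → B) (n : ℕ) : coeff n (mk f : SkewSeries p B) = f n := rfl

instance [AddCommGroup B] : AddCommGroup (SkewSeries p B) := Pi.addCommGroup

instance {S : Type*} [Semiring S] [AddCommGroup B] [Module S B] : Module S (SkewSeries p B) :=
  Pi.module _ _ _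

section AddCommGroup
variable [AddCommGroup B]
@[simp] theorem coeff_zero (n : ℕ) : coeff n (0 : SkewSeries p B) = 0 := rfl
@[simp] theorem coeff_add (f g : SkewSeries p B) (n : ℕ) :
    coeff n (f + g) = coeff n f + coeff n g := rfl
@[simp] theorem coeff_sub (f g : SkewSeries p B) (n : ℕ) :
    coeff n (f - g) = coeff n f - coeff n g := rfl
@[simp] theorem coeff_smul {S : Type*} [Semiring S] [Module S B] (c : S) (f : SkewSeries p B)
    (n : ℕ) : coeff n (c • f) = c • coeff n f := rfl

/-- Taking a coefficient, as an additive map. -/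
def coeffHom (n : ℕ) : SkewSeries p B →+ B where
  toFun := coeff n
  map_zero' := rfl
  map_add' _ _ := rfl

@[simp] theorem coeff_sum {ι : Type*} (s : Finset ι) (f : ι → SkewSeries p B) (n : ℕ) :
    coeff n (∑ i ∈ s, f i) = ∑ i ∈ s, coeff n (f i) := map_sum (coeffHom n) f s
end AddCommGroup

variable [CommRing B] [CommRing C]

instance : Mul (SkewSeries p B) :=
  ⟨fun f g => mk fun n => ∑ ij ∈ Finset.HasAntidiagonal.antidiagonal n, coeff ij.1 f * coeff ij.2 g ^ p ^ ij.1⟩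

theorem coeff_mul (f g : SkewSeries p B) (n : ℕ) : coeff n (f * g) =
    ∑ ij ∈ Finset.HasAntidiagonal.antidiagonal n, coeff ij.1 f * coeff ij.2 g ^ p ^ ij.1 := rfl

instance : One (SkewSeries p B) := ⟨mk fun n => if n = 0 then 1 else 0⟩

theorem coeff_one (n : ℕ) : coeff n (1 : SkewSeries p B) = if n = 0 then 1 else 0 := rfl

variable [hp : Fact p.Prime] [CharP B p] [CharP C p]

theorem zero_pow_prime_pow (i : ℕ) : (0 : B) ^ p ^ i = 0 :=
  zero_pow (pow_ne_zero _ hp.out.ne_zero)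

instance : Ring (SkewSeries p B) where
  __ := (inferInstance : AddCommGroup (SkewSeries p B))
  mul_assoc f g h := by
    ext n
    simp only [coeff_mul, Finset.sum_mul, Finset.mul_sum, sum_pow_char_pow, Finset.sum_sigma']
    refine Finset.sum_nbij' (fun ⟨⟨_i, j⟩, ⟨k, l⟩⟩ ↦ ⟨(k, l + j), (l, j)⟩)
      (fun ⟨⟨i, _j⟩, ⟨k, l⟩⟩ ↦ ⟨(i + k, l), (i, k)⟩) ?_ ?_ ?_ ?_ ?_
    · rintro ⟨⟨i, j⟩, ⟨k, l⟩⟩ h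
      simp only [Finset.mem_sigma, Finset.HasAntidiagonal.mem_antidiagonal, and_true] at h ⊢
      omega
    · rintro ⟨⟨i, j⟩, ⟨k, l⟩⟩ h
      simp only [Finset.mem_sigma, Finset.HasAntidiagonal.mem_antidiagonal, and_true] at h ⊢
      omega
    · rintro ⟨⟨i, j⟩, ⟨k, l⟩⟩ h
      simp only [Finset.mem_sigma, Finset.HasAntidiagonal.mem_antidiagonal] at h
      obtain ⟨h1, rfl⟩ := h
      rfl
    · rintro ⟨⟨i, j⟩, ⟨k, l⟩⟩ h
      simp only [Finset.mem_sigma, Finset.HasAntidiagonal.mem_antidiagonal] at h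
      obtain ⟨h1, rfl⟩ := h
      rfl
    · rintro ⟨⟨i, j⟩, ⟨k, l⟩⟩ h
      simp only [Finset.mem_sigma, Finset.HasAntidiagonal.mem_antidiagonal] at h
      obtain ⟨h1, rfl⟩ := h
      rw [mul_pow, ← pow_mul, ← pow_add, add_comm l k, mul_assoc]
  one_mul f := by
    ext n
    rw [coeff_mul, Finset.sum_eq_single (0, n)]
    · simp [coeff_one]
    · rintro ⟨i, j⟩ h hne
      rw [Finset.HasAntidiagonal.mem_antidiagonal] at h
      have : i ≠ 0 := by rintro rfl; apply hne; simp_all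
      simp [coeff_one, this]
    · simp
  mul_one f := by
    ext n
    rw [coeff_mul, Finset.sum_eq_single (n, 0)]
    · simp [coeff_one]
    · rintro ⟨i, j⟩ h hne
      rw [Finset.HasAntidiagonal.mem_antidiagonal] at h
      have : j ≠ 0 := by rintro rfl; apply hne; simp_all
      simp [coeff_one, this, zero_pow_prime_pow]
    · simp
  left_distrib f g h := by
    ext n
    simp only [coeff_mul, coeff_add, add_pow_char_pow, mul_add, Finset.sum_add_distrib]
  right_distrib f g h := by
    ext n
    simp only [coeff_mul, coeff_add, add_mul, Finset.sum_add_distrib]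
  zero_mul f := by
    ext n
    simp [coeff_mul]
  mul_zero f := by
    ext n
    simp [coeff_mul, zero_pow_prime_pow]

/-- The constant series. -/
def const : B →+* SkewSeries p B where
  toFun b := mk fun n => if n = 0 then b else 0
  map_one' := rfl
  map_zero' := by ext n; simp
  map_add' x y := by ext n; simp only [coeff_mk, coeff_add]; split_ifs <;> simp
  map_mul' x y := by
    ext n
    rw [coeff_mul]
    simp only [coeff_mk]
    rcases n with _ | n
    · simp
    · rw [if_neg (Nat.succ_ne_zero n), Finset.sum_eq_zero]
      rintro ⟨i, j⟩ h
      rw [Finset.HasAntidiagonal.mem_antidiagonal] at h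
      by_cases hi : i = 0
      · have : j ≠ 0 := by rintro rfl; omega
        simp only [if_neg this, zero_pow_prime_pow, MulZeroClass.mul_zero]
      · simp [hi]

theorem coeff_const (b : B) (n : ℕ) :
    coeff n (const b : SkewSeries p B) = if n = 0 then b else 0 := rfl

@[simp] theorem coeff_zero_const (b : B) : coeff 0 (const b : SkewSeries p B) = b := rfl

theorem const_mul (b : B) (f : SkewSeries p B) : const b * f = b • f := by
  ext n
  rw [coeff_mul, Finset.sum_eq_single (0, n)]
  · simp
  · rintro ⟨i, j⟩ h hne
    rw [Finset.HasAntidiagonal.mem_antidiagonal] at h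
    have : i ≠ 0 := by rintro rfl; apply hne; simp_all
    simp [coeff_const, this]
  · simp

@[simp] theorem coeff_const_mul (b : B) (f : SkewSeries p B) (n : ℕ) :
    coeff n (const b * f) = b * coeff n f := by
  rw [const_mul]; rfl

@[simp] theorem coeff_mul_const (b : B) (f : SkewSeries p B) (n : ℕ) :
    coeff n (f * const b) = coeff n f * b ^ p ^ n := by
  rw [coeff_mul, Finset.sum_eq_single (n, 0)]
  · simp
  · rintro ⟨i, j⟩ h hne
    rw [Finset.HasAntidiagonal.mem_antidiagonal] at h
    have : j ≠ 0 := by rintro rfl; apply hne; simp_all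
    simp [coeff_const, this, zero_pow_prime_pow]
  · simp

instance : IsScalarTower B (SkewSeries p B) (SkewSeries p B) :=
  ⟨fun b f g => by rw [smul_eq_mul, smul_eq_mul, ← const_mul, ← const_mul, mul_assoc]⟩

theorem smul_mul (b : B) (f g : SkewSeries p B) : (b • f) * g = b • (f * g) := smul_mul_assoc b f g

/-- The power `τ ^ m` of the Frobenius. -/
def tau (m : ℕ) : SkewSeries p B := mk fun n => if n = m then 1 else 0

theorem coeff_tau (m n : ℕ) : coeff n (tau m : SkewSeries p B) = if n = m then 1 else 0 := rfl

theorem tau_zero : (tau 0 : SkewSeries p B) = 1 := rfl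

theorem coeff_mul_tau (f : SkewSeries p B) (m n : ℕ) :
    coeff n (f * tau m) = if m ≤ n then coeff (n - m) f else 0 := by
  rw [coeff_mul]
  split_ifs with h
  · rw [Finset.sum_eq_single (n - m, m)]
    · simp [coeff_tau]
    · rintro ⟨i, j⟩ h hne
      rw [Finset.HasAntidiagonal.mem_antidiagonal] at h
      have : j ≠ m := by rintro rfl; apply hne; ext <;> simp; omega
      simp [coeff_tau, this, zero_pow_prime_pow]
    · intro h'
      rw [Finset.HasAntidiagonal.mem_antidiagonal] at h'
      omega
  · refine Finset.sum_eq_zero ?_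
    rintro ⟨i, j⟩ h'
    rw [Finset.HasAntidiagonal.mem_antidiagonal] at h'
    have : j ≠ m := by rintro rfl; omega
    simp [coeff_tau, this, zero_pow_prime_pow]

theorem coeff_tau_mul (f : SkewSeries p B) (m n : ℕ) :
    coeff n (tau m * f) = if m ≤ n then coeff (n - m) f ^ p ^ m else 0 := by
  rw [coeff_mul]
  split_ifs with h
  · rw [Finset.sum_eq_single (m, n - m)]
    · simp [coeff_tau]
    · rintro ⟨i, j⟩ h hne
      rw [Finset.HasAntidiagonal.mem_antidiagonal] at h
      have : i ≠ m := by rintro rfl; apply hne; ext <;> simp; omega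
      simp [coeff_tau, this]
    · intro h'
      rw [Finset.HasAntidiagonal.mem_antidiagonal] at h'
      omega
  · refine Finset.sum_eq_zero ?_
    rintro ⟨i, j⟩ h'
    rw [Finset.HasAntidiagonal.mem_antidiagonal] at h'
    have : i ≠ m := by rintro rfl; omega
    simp [coeff_tau, this]

theorem tau_mul_tau (m n : ℕ) : (tau m * tau n : SkewSeries p B) = tau (m + n) := by
  ext i
  rw [coeff_mul_tau, coeff_tau, coeff_tau]
  split_ifs <;> first | rfl | omega

/-- The map on twisted series induced by a ring homomorphism. -/
def map (f : B →+* C) : SkewSeries p B →+* SkewSeries p C where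
  toFun g := mk fun n => f (coeff n g)
  map_one' := by ext n; simp only [coeff_mk, coeff_one]; split_ifs <;> simp
  map_zero' := by ext n; simp
  map_add' x y := by ext n; simp
  map_mul' x y := by ext n; simp [coeff_mul]

@[simp] theorem coeff_map (f : B →+* C) (g : SkewSeries p B) (n : ℕ) :
    coeff n (map f g) = f (coeff n g) := rfl

theorem map_const (f : B →+* C) (b : B) : map f (const b : SkewSeries p B) = const (f b) := by
  ext n; rw [coeff_map, coeff_const, coeff_const]; split_ifs <;> simp

theorem map_smul (f : B →+* C) (b : B) (g : SkewSeries p B) : map f (b • g) = f b • map f g := by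
  ext n; simp

theorem map_injective {f : B →+* C} (hf : Function.Injective f) :
    Function.Injective (map f : SkewSeries p B →+* SkewSeries p C) := fun g h hgh => by
  ext n
  exact hf (congrArg (coeff n) hgh)

/-- Commuting a power of `τ` past a series raises the coefficients to powers. -/
theorem tau_mul (m : ℕ) (f : SkewSeries p B) :
    tau m * f = map (iterateFrobenius B p m) f * tau m := by
  ext n
  rw [coeff_tau_mul, coeff_mul_tau, coeff_map, iterateFrobenius_def]

theorem coeff_zero_mul (f g : SkewSeries p B) : coeff 0 (f * g) = coeff 0 f * coeff 0 g := by
  simp [coeff_mul]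

theorem eq_const_of_coeff_eq_zero {f : SkewSeries p B} (h : ∀ n, n ≠ 0 → coeff n f = 0) :
    f = const (coeff 0 f) := by
  ext n
  rw [coeff_const]
  split_ifs with hn
  · rw [hn]
  · exact h n hn

/-- The lowest coefficient of a product. -/
theorem coeff_mul_of_low {f g : SkewSeries p B} {m n : ℕ} (hf : ∀ i < m, coeff i f = 0)
    (hg : ∀ i < n, coeff i g = 0) :
    coeff (m + n) (f * g) = coeff m f * coeff n g ^ p ^ m := by
  rw [coeff_mul, Finset.sum_eq_single (m, n)]
  · rintro ⟨i, j⟩ h hne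
    rw [Finset.HasAntidiagonal.mem_antidiagonal] at h
    rcases lt_trichotomy i m with h1 | h1 | h1
    · simp [hf i h1]
    · subst h1
      exact absurd (by ext <;> simp; omega) hne
    · have : coeff j g = 0 := hg j (by omega)
      simp [this, zero_pow_prime_pow]
  · intro h; simp at h

/-- The highest coefficient of a product of polynomials in `τ`. -/
theorem coeff_mul_of_high {f g : SkewSeries p B} {m n : ℕ} (hf : ∀ i, m < i → coeff i f = 0)
    (hg : ∀ i, n < i → coeff i g = 0) :
    coeff (m + n) (f * g) = coeff m f * coeff n g ^ p ^ m := by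
  rw [coeff_mul, Finset.sum_eq_single (m, n)]
  · rintro ⟨i, j⟩ h hne
    rw [Finset.HasAntidiagonal.mem_antidiagonal] at h
    rcases lt_trichotomy i m with h1 | h1 | h1
    · have : coeff j g = 0 := hg j (by omega)
      simp [this, zero_pow_prime_pow]
    · subst h1
      exact absurd (by ext <;> simp; omega) hne
    · simp [hf i h1]
  · intro h; simp at h

theorem coeff_mul_eq_zero_of_high {f g : SkewSeries p B} {m n : ℕ}
    (hf : ∀ i, m < i → coeff i f = 0) (hg : ∀ i, n < i → coeff i g = 0) {l : ℕ} (hl : m + n < l) :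
    coeff l (f * g) = 0 := by
  rw [coeff_mul]
  refine Finset.sum_eq_zero ?_
  rintro ⟨i, j⟩ h
  rw [Finset.HasAntidiagonal.mem_antidiagonal] at h
  rcases le_or_gt i m with h1 | h1
  · have : coeff j g = 0 := hg j (by omega)
    simp [this, zero_pow_prime_pow]
  · simp [hf i h1]

theorem exists_low_coeff {f : SkewSeries p B} (hf : f ≠ 0) :
    ∃ n, coeff n f ≠ 0 ∧ ∀ i < n, coeff i f = 0 := by
  classical
  have : ∃ n, coeff n f ≠ 0 := by
    by_contra! h
    exact hf (ext h)
  exact ⟨Nat.find this, Nat.find_spec this, fun i hi => not_not.mp (Nat.find_min this hi)⟩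

instance [IsDomain B] : NoZeroDivisors (SkewSeries p B) where
  eq_zero_or_eq_zero_of_mul_eq_zero {f g} h := by
    by_contra! hfg
    obtain ⟨m, hm, hm'⟩ := exists_low_coeff hfg.1
    obtain ⟨n, hn, hn'⟩ := exists_low_coeff hfg.2
    have := coeff_mul_of_low hm' hn'
    rw [h, coeff_zero] at this
    exact mul_ne_zero hm (pow_ne_zero _ hn) this.symm

instance [Nontrivial B] : Nontrivial (SkewSeries p B) :=
  ⟨⟨0, 1, fun h => zero_ne_one (congrArg (coeff 0) h)⟩⟩

instance [IsDomain B] : IsDomain (SkewSeries p B) := NoZeroDivisors.to_isDomain _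

/-- A series with constant term `1` is a left divisor of every series. -/
theorem exists_mul_eq {f : SkewSeries p B} (hf : coeff 0 f = 1) (g : SkewSeries p B) :
    ∃ x, f * x = g := by
  let x : ℕ → B := fun n => Nat.strongRec (motive := fun _ => B)
    (fun n x => coeff n g - ∑ i : Fin n, coeff (n - i) f * x i i.2 ^ p ^ (n - i)) n
  refine ⟨mk x, ext fun n => ?_⟩
  have hx : x n = coeff n g - ∑ i : Fin n, coeff (n - i) f * x i ^ p ^ (n - i) := by
    simp only [x]
    rw [Nat.strongRec_eq]
  rw [coeff_mul, ← Finset.Nat.sum_antidiagonal_swap,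
    Finset.Nat.sum_antidiagonal_eq_sum_range_succ_mk, Finset.sum_range_succ]
  simp only [Prod.swap, Nat.sub_self, coeff_mk]
  rw [hf, pow_zero, pow_one, one_mul, hx,
    Fin.sum_univ_eq_sum_range (fun i => coeff (n - i) f * x i ^ p ^ (n - i)) n, add_sub_cancel]

end SkewSeries

/-! ### Restricted series and logarithms -/

namespace SkewSeries

variable {p : ℕ} [hp : Fact p.Prime] {R : Type*} [CommRing R] [CharP R p]

/-- The series whose coefficients tend to `0` in the `π`-adic topology. -/
def restricted (p : ℕ) [hp : Fact p.Prime] [CharP R p] (π : R) : Subring (SkewSeries p R) where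
  carrier := {f | ∀ N : ℕ, ∃ I : ℕ, ∀ i, I ≤ i → π ^ N ∣ coeff i f}
  mul_mem' := by
    intro f g hf hg N
    obtain ⟨I, hI⟩ := hf N
    obtain ⟨J, hJ⟩ := hg N
    refine ⟨I + J, fun n hn => ?_⟩
    rw [coeff_mul]
    refine Finset.dvd_sum ?_
    rintro ⟨i, j⟩ h
    rw [Finset.HasAntidiagonal.mem_antidiagonal] at h
    rcases le_or_gt I i with hi | hi
    · exact (hI i hi).mul_right _
    · exact ((hJ j (by simp at h; omega)).trans (dvd_pow_self _ (pow_ne_zero _ hp.out.ne_zero))).mul_left _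
  one_mem' N := ⟨1, fun i hi => by rw [coeff_one, if_neg (by omega)]; exact dvd_zero _⟩
  add_mem' := by
    intro f g hf hg N
    obtain ⟨I, hI⟩ := hf N
    obtain ⟨J, hJ⟩ := hg N
    exact ⟨max I J, fun n hn => dvd_add (hI n (le_of_max_le_left hn)) (hJ n (le_of_max_le_right hn))⟩
  zero_mem' N := ⟨0, fun i _ => dvd_zero _⟩
  neg_mem' := by
    intro f hf N
    obtain ⟨I, hI⟩ := hf N
    exact ⟨I, fun n hn => (dvd_neg).mpr (hI n hn)⟩

variable {π : R}

theorem smul_mem_restricted (c : R) {f : SkewSeries p R} (hf : f ∈ restricted p π) :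
    c • f ∈ restricted p π := fun N =>
  let ⟨I, hI⟩ := hf N
  ⟨I, fun i hi => (hI i hi).mul_left c⟩

theorem mem_restricted_of_eq_zero {f : SkewSeries p R} (I : ℕ) (h : ∀ i, I ≤ i → coeff i f = 0) :
    f ∈ restricted p π := fun _ => ⟨I, fun i hi => by rw [h i hi]; exact dvd_zero _⟩

theorem const_mem_restricted (b : R) : (const b : SkewSeries p R) ∈ restricted p π :=
  mem_restricted_of_eq_zero 1 fun i hi => by rw [coeff_const, if_neg (by omega)]

theorem tau_mem_restricted (m : ℕ) : (tau m : SkewSeries p R) ∈ restricted p π :=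
  mem_restricted_of_eq_zero (m + 1) fun i hi => by rw [coeff_tau, if_neg (by omega)]

theorem map_mem_restricted {φ : R →+* R} (hφ : φ π = π) {f : SkewSeries p R}
    (hf : f ∈ restricted p π) : map φ f ∈ restricted p π := fun N =>
  let ⟨I, hI⟩ := hf N
  ⟨I, fun i hi => by simpa [hφ] using map_dvd φ (hI i hi)⟩

/-- A series is restricted if it is so modulo each power of `π`. -/
theorem mem_restricted_of_approx {f : SkewSeries p R}
    (h : ∀ N : ℕ, ∃ g ∈ restricted p π, ∃ y : SkewSeries p R, f = g + π ^ N • y) :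
    f ∈ restricted p π := fun N => by
  obtain ⟨g, hg, y, rfl⟩ := h N
  obtain ⟨I, hI⟩ := hg N
  exact ⟨I, fun i hi => dvd_add (hI i hi) (dvd_mul_right _ _)⟩

theorem exists_eq_smul_of_dvd {c : R} {f : SkewSeries p R} (h : ∀ i, c ∣ coeff i f) :
    ∃ y : SkewSeries p R, f = c • y := by
  choose y hy using h
  exact ⟨mk y, ext hy⟩

theorem smul_left_injective [IsDomain R] {c : R} (hc : c ≠ 0) {f g : SkewSeries p R}
    (h : c • f = c • g) : f = g := by
  ext n
  exact mul_left_cancel₀ hc (congrArg (coeff n) h)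

theorem mem_restricted_of_smul [IsDomain R] {c : R} (hπ : π ≠ 0) (m : ℕ) (hc : c ∣ π ^ m)
    {f : SkewSeries p R} (h : c • f ∈ restricted p π) : f ∈ restricted p π := fun N => by
  obtain ⟨I, hI⟩ := h (m + N)
  refine ⟨I, fun i hi => ?_⟩
  obtain ⟨d, hd⟩ := hc
  have h1 := hI i hi
  rw [pow_add, hd, mul_assoc] at h1
  have hc0 : c ≠ 0 := by rintro rfl; exact pow_ne_zero m hπ (by rw [hd, zero_mul])
  exact (dvd_mul_left _ _).trans ((mul_dvd_mul_iff_left hc0).mp h1)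

/-- If `x` intertwines `f` with its own constant term `c` and `x` has no constant term, then
`x = 0`, provided no `c - c ^ p ^ n` with `n ≥ 1` vanishes. -/
theorem eq_zero_of_mul_eq_smul [IsDomain R] {f x : SkewSeries p R}
    (hf : ∀ n, n ≠ 0 → coeff 0 f ^ p ^ n ≠ coeff 0 f) (hx : x * f = coeff 0 f • x)
    (h0 : coeff 0 x = 0) : x = 0 := by
  by_contra hne
  obtain ⟨m, hm, hm'⟩ := exists_low_coeff hne
  have h1 := coeff_mul_of_low (g := f) (n := 0) hm' (fun i hi => absurd hi (Nat.not_lt_zero i))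
  rw [hx, add_zero, coeff_smul, smul_eq_mul, mul_comm] at h1
  have hm0 : m ≠ 0 := by rintro rfl; exact hm h0
  exact hf m hm0 (mul_left_cancel₀ hm h1).symm

end SkewSeries

section DVR

open SkewSeries

variable {R : Type u} [CommRing R] [IsDomain R] [IsDiscreteValuationRing R]

theorem Irreducible.not_isUnit_pow {π : R} (hπ : Irreducible π) {n : ℕ} (hn : n ≠ 0) :
    ¬ IsUnit (π ^ n) := fun h => hπ.not_isUnit ((isUnit_pow_iff hn).mp h)

theorem Irreducible.isUnit_one_sub_pow {π : R} (hπ : Irreducible π) {n : ℕ} (hn : n ≠ 0) :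
    IsUnit (1 - π ^ n) := by
  rcases IsLocalRing.isUnit_or_isUnit_one_sub_self (π ^ n) with h | h
  · exact absurd h (hπ.not_isUnit_pow hn)
  · exact h

theorem Irreducible.pow_ne_self {π : R} (hπ : Irreducible π) {n : ℕ} (hn : 1 < n) :
    π ^ n ≠ π := fun h => by
  obtain ⟨m, rfl⟩ := Nat.exists_eq_add_of_le' hn
  rw [pow_succ] at h
  exact hπ.not_isUnit_pow (Nat.succ_ne_zero m)
    (IsUnit.of_mul_eq_one 1 (by rw [mul_one]; exact mul_right_cancel₀ hπ.ne_zero (by rw [h, one_mul])))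

theorem Irreducible.isUnit_or_dvd {π : R} (hπ : Irreducible π) (x : R) : IsUnit x ∨ π ∣ x := by
  by_cases h : IsUnit x
  · exact Or.inl h
  · right
    have : x ∈ IsLocalRing.maximalIdeal R := h
    rwa [hπ.maximalIdeal_eq, Ideal.mem_span_singleton] at this

theorem Irreducible.eq_zero_of_forall_pow_dvd {π : R} (hπ : Irreducible π)
    [IsAdicComplete (IsLocalRing.maximalIdeal R) R] {x : R} (h : ∀ n, π ^ n ∣ x) : x = 0 := by
  refine IsHausdorff.haus (I := IsLocalRing.maximalIdeal R) inferInstance x fun n => ?_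
  rw [SModEq.zero, smul_eq_mul, Ideal.mul_top, hπ.maximalIdeal_eq, Ideal.span_singleton_pow,
    Ideal.mem_span_singleton]
  exact h n

theorem Irreducible.exists_limit {π : R} (hπ : Irreducible π)
    [IsAdicComplete (IsLocalRing.maximalIdeal R) R] (x : ℕ → R)
    (h : ∀ n, π ^ n ∣ x (n + 1) - x n) : ∃ y, ∀ n, π ^ n ∣ y - x n := by
  have h' : ∀ m n, m ≤ n → π ^ m ∣ x n - x m := by
    intro m n hmn
    induction n, hmn using Nat.le_induction with
    | base => simp
    | succ n hmn ih =>
      have := dvd_add ((pow_dvd_pow π hmn).trans (h n)) ih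
      simpa using this
  obtain ⟨y, hy⟩ := IsPrecomplete.prec (I := IsLocalRing.maximalIdeal R) inferInstance
    (f := x) (fun {m n} hmn => by
      rw [SModEq.sub_mem, smul_eq_mul, Ideal.mul_top, hπ.maximalIdeal_eq, Ideal.span_singleton_pow,
        Ideal.mem_span_singleton, ← neg_sub, dvd_neg]
      exact h' m n hmn)
  refine ⟨y, fun n => ?_⟩
  have := hy n
  rwa [SModEq.sub_mem, smul_eq_mul, Ideal.mul_top, hπ.maximalIdeal_eq, Ideal.span_singleton_pow,
        Ideal.mem_span_singleton, ← neg_sub, dvd_neg] at this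

variable {p : ℕ} [hp : Fact p.Prime] [CharP R p]
variable {K : Type u} [Field K] [Algebra R K] [IsFractionRing R K] [CharP K p]

variable (K) in
/-- Extension of scalars from `R` to its fraction field. -/
noncomputable abbrev toFrac : SkewSeries p R →+* SkewSeries p K := SkewSeries.map (algebraMap R K)

theorem toFrac_injective : Function.Injective (toFrac K : SkewSeries p R →+* SkewSeries p K) :=
  SkewSeries.map_injective (IsFractionRing.injective R K)

variable (K) in
/-- The logarithm of the endomorphism `f`: the series `l` over `K` with constant term `1` that
satisfies `l f = f₀ l`, where `f₀` is the constant term of `f`. -/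
noncomputable def logSeries (f : SkewSeries p R) : SkewSeries p K :=
  SkewSeries.mk fun n => Nat.strongRec (motive := fun _ => K) (fun n x => if n = 0 then 1 else
    (∑ k : Fin n, x k k.2 * algebraMap R K (coeff (n - k) f) ^ p ^ (k : ℕ)) /
      algebraMap R K (coeff 0 f - coeff 0 f ^ p ^ n)) n

theorem coeff_logSeries (f : SkewSeries p R) (n : ℕ) : coeff n (logSeries K f) =
    if n = 0 then 1 else
    (∑ k ∈ Finset.range n, coeff k (logSeries K f) * algebraMap R K (coeff (n - k) f) ^ p ^ k) /
      algebraMap R K (coeff 0 f - coeff 0 f ^ p ^ n) := by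
  rw [logSeries, coeff_mk, Nat.strongRec_eq]
  simp only [coeff_mk]
  rw [Fin.sum_univ_eq_sum_range (fun k => Nat.strongRec (motive := fun _ => K) (fun n x => if n = 0 then 1 else
    (∑ k : Fin n, x k k.2 * algebraMap R K (coeff (n - k) f) ^ p ^ (k : ℕ)) /
      algebraMap R K (coeff 0 f - coeff 0 f ^ p ^ n)) k * algebraMap R K (coeff (n - k) f) ^ p ^ k)]

@[simp] theorem coeff_zero_logSeries (f : SkewSeries p R) : coeff 0 (logSeries K f) = 1 := by
  rw [coeff_logSeries, if_pos rfl]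

theorem sub_pow_ne_zero {π : R} (hπ : Irreducible π) {n : ℕ} (hn : n ≠ 0) :
    algebraMap R K (π - π ^ p ^ n) ≠ 0 := by
  rw [Ne, map_eq_zero_iff _ (IsFractionRing.injective R K), sub_eq_zero]
  exact (hπ.pow_ne_self (Nat.one_lt_pow hn hp.out.one_lt)).symm

theorem logSeries_mul {π : R} (hπ : Irreducible π) (f : SkewSeries p R) (hf : coeff 0 f = π) :
    logSeries K f * toFrac K f = algebraMap R K π • logSeries K f := by
  ext n
  rw [coeff_mul, Finset.Nat.sum_antidiagonal_eq_sum_range_succ_mk, Finset.sum_range_succ]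
  simp only [coeff_map, coeff_smul, smul_eq_mul, Nat.sub_self, hf]
  rcases eq_or_ne n 0 with rfl | hn
  · simp
  have h := coeff_logSeries (K := K) f n
  rw [if_neg hn, hf, eq_div_iff (sub_pow_ne_zero hπ hn)] at h
  rw [← h, map_sub, map_pow]
  ring

/-- The coefficients of the logarithm have denominators at most `π ^ n`. -/
theorem exists_coeff_logSeries {π : R} (hπ : Irreducible π) (f : SkewSeries p R)
    (hf : coeff 0 f = π) (n : ℕ) :
    ∃ r : R, algebraMap R K r = algebraMap R K π ^ n * coeff n (logSeries K f) := by
  induction n using Nat.strong_induction_on with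
  | _ n ih =>
    rcases eq_or_ne n 0 with rfl | hn
    · exact ⟨1, by simp⟩
    choose! r hr using ih
    have h1 : 1 < p ^ n := Nat.one_lt_pow hn hp.out.one_lt
    obtain ⟨v, hv⟩ := (hπ.isUnit_one_sub_pow (n := p ^ n - 1) (by omega)).exists_left_inv
    have hv' : v * (π - π ^ p ^ n) = π := by
      have : π ^ p ^ n = π * π ^ (p ^ n - 1) := by rw [← pow_succ']; congr 1; omega
      rw [this]
      linear_combination π * hv
    refine ⟨v * ∑ k ∈ Finset.range n, π ^ (n - 1 - k) * r k * coeff (n - k) f ^ p ^ k, ?_⟩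
    have h := coeff_logSeries (K := K) f n
    rw [if_neg hn, hf, eq_div_iff (sub_pow_ne_zero hπ hn)] at h
    have hπ0 : algebraMap R K π ≠ 0 := by
      rw [Ne, map_eq_zero_iff _ (IsFractionRing.injective R K)]; exact hπ.ne_zero
    have h2 : algebraMap R K (∑ k ∈ Finset.range n, π ^ (n - 1 - k) * r k * coeff (n - k) f ^ p ^ k)
        = algebraMap R K π ^ (n - 1) *
          (coeff n (logSeries K f) * algebraMap R K (π - π ^ p ^ n)) := by
      rw [h, map_sum, Finset.mul_sum]
      refine Finset.sum_congr rfl fun k hk => ?_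
      have hk' := Finset.mem_range.mp hk
      rw [map_mul, map_mul, hr k hk', map_pow, map_pow, ← mul_assoc, ← mul_assoc, ← pow_add,
        show n - 1 - k + k = n - 1 by omega]
    rw [map_mul, h2]
    have h3 := congrArg (algebraMap R K) hv'
    rw [map_mul] at h3
    calc _ = algebraMap R K π ^ (n - 1) * coeff n (logSeries K f) *
          (algebraMap R K v * algebraMap R K (π - π ^ p ^ n)) := by ring
      _ = _ := by
        rw [h3, mul_right_comm, ← pow_succ, Nat.sub_add_cancel (Nat.one_le_iff_ne_zero.mpr hn)]

/-- Every solution of `y f = π y` is a multiple of the logarithm. -/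
theorem eq_smul_logSeries {π : R} (hπ : Irreducible π) (f : SkewSeries p R)
    (hf : coeff 0 f = π) {y : SkewSeries p K} (hy : y * toFrac K f = algebraMap R K π • y) :
    y = coeff 0 y • logSeries K f := by
  rw [← sub_eq_zero]
  have h0 : coeff 0 (toFrac K f) = algebraMap R K π := by rw [coeff_map, hf]
  refine eq_zero_of_mul_eq_smul (f := toFrac K f) ?_ ?_ ?_
  · intro n hn h
    rw [h0, ← map_pow] at h
    exact hπ.pow_ne_self (Nat.one_lt_pow hn hp.out.one_lt) (IsFractionRing.injective R K h)
  · rw [sub_mul, hy, smul_mul, logSeries_mul hπ f hf, h0, smul_sub, smul_comm]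
  · simp

/-- An endomorphism that commutes with `f` acts on the logarithm of `f` through its constant
term. -/
theorem logSeries_mul_of_commute {π : R} (hπ : Irreducible π) (f : SkewSeries p R)
    (hf : coeff 0 f = π) {g : SkewSeries p R} (hg : g * f = f * g) :
    logSeries K f * toFrac K g = algebraMap R K (coeff 0 g) • logSeries K f := by
  have h : (logSeries K f * toFrac K g) * toFrac K f =
      algebraMap R K π • (logSeries K f * toFrac K g) := by
    rw [mul_assoc, ← map_mul, hg, map_mul, ← mul_assoc, logSeries_mul hπ f hf, smul_mul]
  rw [eq_smul_logSeries hπ f hf h, coeff_zero_mul, coeff_zero_logSeries, one_mul, coeff_map]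

theorem two_mul_le_prime_pow (i : ℕ) : 2 * i ≤ p ^ i := by
  rcases i with _ | i
  · simp
  · have h1 : i < 2 ^ i := Nat.lt_two_pow_self
    have h2 : 2 ^ (i + 1) ≤ p ^ (i + 1) := Nat.pow_le_pow_left hp.out.two_le _
    rw [pow_succ 2] at h2
    omega

/-- The conjugate `s = π⁻¹ l π` of the logarithm `l` is a restricted series with coefficients in `R`:
its coefficients are `π ^ (p ^ i - 1) l i`, and `l i` has denominator at most `π ^ i`. -/
theorem exists_conj_logSeries {π : R} (hπ : Irreducible π) (f : SkewSeries p R)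
    (hf : coeff 0 f = π) : ∃ s ∈ restricted p π,
      algebraMap R K π • toFrac K s = logSeries K f * toFrac K (const π) ∧
      coeff 0 s = 1 ∧ ∀ i, ∃ r : R, algebraMap R K r = algebraMap R K π ^ i * coeff i (logSeries K f) ∧
        coeff i s = π ^ (p ^ i - 1 - i) * r := by
  choose r hr using exists_coeff_logSeries (K := K) hπ f hf
  have hpos : ∀ i, i < p ^ i := fun i => Nat.lt_pow_self hp.out.one_lt
  refine ⟨SkewSeries.mk fun i => π ^ (p ^ i - 1 - i) * r i, ?_, ?_, ?_, fun i => ⟨r i, hr i, rfl⟩⟩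
  · -- the exponents `p ^ i - 1 - i` tend to infinity, as `p ^ i ≥ 2 i`
    intro N
    refine ⟨N + 1, fun i hi => Dvd.dvd.mul_right (pow_dvd_pow π ?_) _⟩
    have := two_mul_le_prime_pow (p := p) i
    omega
  · ext i
    rw [coeff_smul, smul_eq_mul, coeff_map, coeff_mk, map_mul, hr, SkewSeries.map_const, coeff_mul_const,
      ← mul_assoc, ← mul_assoc, map_pow, ← pow_succ', ← pow_add, mul_comm]
    congr 2
    have := hpos i
    omega
  · rw [coeff_mk]
    have := hr 0
    simp only [pow_zero, coeff_zero_logSeries, one_mul] at this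
    rw [IsFractionRing.injective R K (this.trans (map_one _).symm)]
    simp

end DVR

section

open SkewSeries

/-! ### Restricted series as natural additive operations -/

section eval

variable {p : ℕ} [hp : Fact p.Prime] {R : Type*} [CommRing R] [CharP R p]
variable {B : Type*} [CommRing B] [Algebra R B]

theorem charP_of_algebra (R : Type*) [CommRing R] [CharP R p] [Algebra R B] [Nontrivial B] :
    CharP B p := by
  obtain ⟨c, hc⟩ := CharP.exists B
  have h : (p : B) = 0 := by
    rw [← map_natCast (algebraMap R B), CharP.cast_eq_zero, map_zero]
  have h1 := (CharP.cast_eq_zero_iff B c p).mp h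
  rcases (Nat.dvd_prime hp.out).mp h1 with rfl | rfl
  · exact (one_ne_zero (α := B) (by rw [← Nat.cast_one, CharP.cast_eq_zero])).elim
  · exact hc

theorem add_pow_prime_pow_of_algebra (R : Type*) [CommRing R] [CharP R p] [Algebra R B]
    (x y : B) (n : ℕ) : (x + y) ^ p ^ n = x ^ p ^ n + y ^ p ^ n := by
  rcases subsingleton_or_nontrivial B with h | h
  · exact Subsingleton.elim _ _
  · have := charP_of_algebra (p := p) (B := B) R
    exact add_pow_char_pow x y p n

theorem sum_pow_prime_pow_of_algebra (R : Type*) [CommRing R] [CharP R p] [Algebra R B]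
    {ι : Type*} (s : Finset ι) (f : ι → B) (n : ℕ) :
    (∑ i ∈ s, f i) ^ p ^ n = ∑ i ∈ s, f i ^ p ^ n := by
  rcases subsingleton_or_nontrivial B with h | h
  · exact Subsingleton.elim _ _
  · have := charP_of_algebra (p := p) (B := B) R
    exact sum_pow_char_pow p n s f

/-- The value of a series at an element of an `R`-algebra in which almost all of its coefficients
vanish. -/
noncomputable def SkewSeries.eval (f : SkewSeries p R) (x : B) : B :=
  ∑ᶠ i, algebraMap R B (coeff i f) * x ^ p ^ i

theorem SkewSeries.eval_eq_sum {f : SkewSeries p R} {I : ℕ}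
    (hI : ∀ i, I ≤ i → algebraMap R B (coeff i f) = 0) (x : B) :
    f.eval x = ∑ i ∈ Finset.range I, algebraMap R B (coeff i f) * x ^ p ^ i := by
  refine finsum_eq_sum_of_support_subset _ fun i hi => ?_
  rw [Finset.coe_range, Set.mem_Iio]
  by_contra h
  exact hi (by simp only [hI i (not_lt.mp h), zero_mul])

variable {π : R}

theorem SkewSeries.exists_vanish (hB : IsNilpotent (algebraMap R B π)) {f : SkewSeries p R}
    (hf : f ∈ restricted p π) : ∃ I : ℕ, ∀ i, I ≤ i → algebraMap R B (coeff i f) = 0 := by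
  obtain ⟨N, hN⟩ := hB
  obtain ⟨I, hI⟩ := hf N
  refine ⟨I, fun i hi => ?_⟩
  have := map_dvd (algebraMap R B) (hI i hi)
  rw [map_pow, hN] at this
  exact zero_dvd_iff.mp this

variable {f g : SkewSeries p R}

theorem SkewSeries.eval_add_right (hB : IsNilpotent (algebraMap R B π)) (hf : f ∈ restricted p π)
    (x y : B) : f.eval (x + y) = f.eval x + f.eval y := by
  obtain ⟨I, hI⟩ := exists_vanish hB hf
  rw [eval_eq_sum hI, eval_eq_sum hI, eval_eq_sum hI, ← Finset.sum_add_distrib]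
  refine Finset.sum_congr rfl fun i _ => ?_
  rw [add_pow_prime_pow_of_algebra R, mul_add]

theorem SkewSeries.eval_zero_right (f : SkewSeries p R) : f.eval (0 : B) = 0 := by
  rw [eval]
  refine finsum_eq_zero_of_forall_eq_zero fun i => ?_
  rw [zero_pow (pow_ne_zero _ hp.out.ne_zero), mul_zero]

/-- Evaluation of a restricted series, as an additive map. -/
noncomputable def SkewSeries.evalHom (hB : IsNilpotent (algebraMap R B π))
    (hf : f ∈ restricted p π) : B →+ B where
  toFun := f.eval
  map_zero' := eval_zero_right f
  map_add' := eval_add_right hB hf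

theorem SkewSeries.eval_add (hB : IsNilpotent (algebraMap R B π)) (hf : f ∈ restricted p π)
    (hg : g ∈ restricted p π) (x : B) : (f + g).eval x = f.eval x + g.eval x := by
  obtain ⟨I, hI⟩ := exists_vanish hB hf
  obtain ⟨J, hJ⟩ := exists_vanish hB hg
  have hI' : ∀ i, max I J ≤ i → algebraMap R B (coeff i f) = 0 :=
    fun i hi => hI i (le_of_max_le_left hi)
  have hJ' : ∀ i, max I J ≤ i → algebraMap R B (coeff i g) = 0 :=
    fun i hi => hJ i (le_of_max_le_right hi)
  rw [eval_eq_sum hI', eval_eq_sum hJ', eval_eq_sum (I := max I J), ← Finset.sum_add_distrib]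
  · refine Finset.sum_congr rfl fun i _ => ?_
    rw [coeff_add, map_add, add_mul]
  · intro i hi
    rw [coeff_add, map_add, hI' i hi, hJ' i hi, add_zero]

theorem SkewSeries.eval_zero (x : B) : (0 : SkewSeries p R).eval x = 0 := by
  rw [eval]
  refine finsum_eq_zero_of_forall_eq_zero fun i => ?_
  rw [coeff_zero, map_zero, zero_mul]

theorem SkewSeries.eval_smul (c : R) (f : SkewSeries p R) (hB : IsNilpotent (algebraMap R B π))
    (hf : f ∈ restricted p π) (x : B) : (c • f).eval x = algebraMap R B c * f.eval x := by
  obtain ⟨I, hI⟩ := exists_vanish hB hf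
  rw [eval_eq_sum hI, eval_eq_sum (I := I), Finset.mul_sum]
  · refine Finset.sum_congr rfl fun i _ => ?_
    rw [coeff_smul, smul_eq_mul, map_mul, mul_assoc]
  · intro i hi
    rw [coeff_smul, smul_eq_mul, map_mul, hI i hi, mul_zero]

theorem SkewSeries.eval_sum (hB : IsNilpotent (algebraMap R B π)) {ι : Type*} (s : Finset ι)
    (f : ι → SkewSeries p R) (hf : ∀ i ∈ s, f i ∈ restricted p π) (x : B) :
    (∑ i ∈ s, f i).eval x = ∑ i ∈ s, (f i).eval x := by
  classical
  induction s using Finset.induction_on with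
  | empty => rw [Finset.sum_empty, Finset.sum_empty, eval_zero]
  | insert a s ha ih =>
    have h1 : ∀ i ∈ s, f i ∈ restricted p π := fun i hi => hf i (Finset.mem_insert_of_mem hi)
    rw [Finset.sum_insert ha, Finset.sum_insert ha,
      eval_add hB (hf a (Finset.mem_insert_self a s)) ((restricted p π).sum_mem h1), ih h1]

theorem SkewSeries.eval_const (c : R) (x : B) :
    (const c : SkewSeries p R).eval x = algebraMap R B c * x := by
  rw [eval_eq_sum (I := 1), Finset.sum_range_one, coeff_zero_const, pow_zero, pow_one]
  intro i hi
  rw [coeff_const, if_neg (by omega), map_zero]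

theorem SkewSeries.eval_one (x : B) : (1 : SkewSeries p R).eval x = x := by
  rw [← map_one const, eval_const, map_one, one_mul]

theorem SkewSeries.eval_tau (m : ℕ) (x : B) :
    (tau m : SkewSeries p R).eval x = x ^ p ^ m := by
  rw [eval, finsum_eq_single _ m]
  · rw [coeff_tau, if_pos rfl, map_one, one_mul]
  · intro i hi
    rw [coeff_tau, if_neg hi, map_zero, zero_mul]

/-- Multiplication of series corresponds to composition. -/
theorem SkewSeries.eval_mul (hB : IsNilpotent (algebraMap R B π)) (hf : f ∈ restricted p π)
    (hg : g ∈ restricted p π) (x : B) : (f * g).eval x = f.eval (g.eval x) := by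
  obtain ⟨I, hI⟩ := exists_vanish hB hf
  obtain ⟨J, hJ⟩ := exists_vanish hB hg
  have h0 : ∀ i j, I ≤ i ∨ J ≤ j →
      algebraMap R B (coeff i f) * algebraMap R B (coeff j g) ^ p ^ i = 0 := by
    rintro i j (h | h)
    · rw [hI i h, zero_mul]
    · rw [hJ j h, zero_pow (pow_ne_zero _ hp.out.ne_zero), mul_zero]
  have hn : ∀ n, algebraMap R B (coeff n (f * g)) =
      ∑ ij ∈ Finset.HasAntidiagonal.antidiagonal n,
        algebraMap R B (coeff ij.1 f) * algebraMap R B (coeff ij.2 g) ^ p ^ ij.1 := by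
    intro n
    rw [coeff_mul, map_sum]
    exact Finset.sum_congr rfl fun ij _ => by rw [map_mul, map_pow]
  rw [eval_eq_sum hI, eval_eq_sum hJ, eval_eq_sum (I := I + J)]
  · have h1 : ∀ i ∈ Finset.range I, algebraMap R B (coeff i f) *
        (∑ j ∈ Finset.range J, algebraMap R B (coeff j g) * x ^ p ^ j) ^ p ^ i =
        ∑ j ∈ Finset.range J, algebraMap R B (coeff i f) * algebraMap R B (coeff j g) ^ p ^ i *
          x ^ p ^ (i + j) := by
      intro i _
      rw [sum_pow_prime_pow_of_algebra R, Finset.mul_sum]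
      refine Finset.sum_congr rfl fun j _ => ?_
      rw [mul_pow, ← pow_mul, ← pow_add, add_comm j i, mul_assoc]
    rw [Finset.sum_congr rfl h1, ← Finset.sum_product' (Finset.range I) (Finset.range J)
      (fun i j => algebraMap R B (coeff i f) * algebraMap R B (coeff j g) ^ p ^ i *
          x ^ p ^ (i + j)),
      ← Finset.sum_fiberwise_of_maps_to (t := Finset.range (I + J)) (g := fun ij : ℕ × ℕ => ij.1 + ij.2)]
    · refine Finset.sum_congr rfl fun n _ => ?_
      rw [hn, Finset.sum_mul]
      symm
      refine Finset.sum_subset_zero_on_sdiff (fun ij h => ?_) (fun ij h => ?_) (fun ij h => ?_)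
      · simpa using (Finset.mem_filter.mp h).2
      · rw [h0, zero_mul]
        simp only [Finset.mem_sdiff, Finset.HasAntidiagonal.mem_antidiagonal, Finset.mem_filter,
          Finset.mem_product, Finset.mem_range, not_and] at h
        by_contra! hlt
        exact h.2 hlt h.1
      · rw [(Finset.mem_filter.mp h).2]
    · rintro ⟨i, j⟩ h
      simp only [Finset.mem_product, Finset.mem_range] at h ⊢
      omega
  · intro n h
    rw [hn]
    refine Finset.sum_eq_zero ?_
    rintro ⟨i, j⟩ hij
    rw [Finset.HasAntidiagonal.mem_antidiagonal] at hij
    exact h0 i j (by simp only at hij; omega)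

theorem SkewSeries.map_eval {C : Type*} [CommRing C] [Algebra R C]
    (hB : IsNilpotent (algebraMap R B π)) (hf : f ∈ restricted p π) (h : B →ₐ[R] C) (x : B) :
    h (f.eval x) = f.eval (h x) := by
  obtain ⟨I, hI⟩ := exists_vanish hB hf
  rw [eval_eq_sum hI, eval_eq_sum (I := I), map_sum]
  · simp
  · intro i hi
    rw [← h.commutes, hI i hi, map_zero]

end eval

namespace FrobBase

variable {R : Type u} [CommRing R] (D : FrobBase R)

instance : Fact D.p.Prime := ⟨D.p_prime⟩

/-- The reduction modulo `π ^ N` of an `R`-algebra, as a test object. -/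
noncomputable abbrev modAlg (S : Type u) [CommRing S] [Algebra R S] (N : ℕ) : D.NilAlg where
  carrier := S ⧸ Ideal.span {algebraMap R S D.π ^ N}
  nil := ⟨N, by
    refine (map_pow (algebraMap R _) D.π N).symm.trans ?_
    change Ideal.Quotient.mk (Ideal.span {algebraMap R S D.π ^ N}) (algebraMap R S (D.π ^ N)) = 0
    rw [Ideal.Quotient.eq_zero_iff_mem, map_pow]
    exact Ideal.mem_span_singleton_self _⟩

variable {D} in
theorem modAlg_mk_eq {S : Type u} [CommRing S] [Algebra R S] {N : ℕ} {a b : S} :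
    (Ideal.Quotient.mk _ a : D.modAlg S N) = Ideal.Quotient.mk _ b ↔
      algebraMap R S D.π ^ N ∣ a - b := by
  rw [Ideal.Quotient.mk_eq_mk_iff_sub_mem, Ideal.mem_span_singleton]

theorem modAlg_π_pow (S : Type u) [CommRing S] [Algebra R S] (N : ℕ) :
    algebraMap R (D.modAlg S N) D.π ^ N = 0 := by
  rw [← map_pow (algebraMap R (D.modAlg S N))]
  change Ideal.Quotient.mk (Ideal.span {algebraMap R S D.π ^ N}) (algebraMap R S (D.π ^ N)) = 0
  rw [Ideal.Quotient.eq_zero_iff_mem, map_pow]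
  exact Ideal.mem_span_singleton_self _

variable {D} [CharP R D.p]

open Polynomial in
/-- Restricted series are determined modulo `π ^ N` by their values at the universal point of the test
algebras killed by `π ^ N`. -/
theorem dvd_coeff_of_eval_eq {f g : SkewSeries D.p R} (hf : f ∈ restricted D.p D.π)
    (hg : g ∈ restricted D.p D.π) (N : ℕ)
    (h : f.eval (Ideal.Quotient.mk _ X : D.modAlg R[X] N) = g.eval (Ideal.Quotient.mk _ X))
    (i : ℕ) : D.π ^ N ∣ coeff i f - coeff i g := by
  have key : ∀ f ∈ restricted D.p D.π, ∃ I, i < I ∧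
      f.eval (Ideal.Quotient.mk _ X : D.modAlg R[X] N) =
      Ideal.Quotient.mk _ (∑ i ∈ Finset.range I, C (coeff i f) * X ^ D.p ^ i) := by
    intro f hf
    obtain ⟨I, hI⟩ := exists_vanish (D.modAlg R[X] N).nil hf
    refine ⟨max I (i + 1), by omega, ?_⟩
    rw [eval_eq_sum (I := max I (i + 1)) (fun j hj => hI j (le_of_max_le_left hj)), map_sum]
    refine Finset.sum_congr rfl fun j _ => ?_
    rw [map_mul, map_pow]
    rfl
  have hcoeff : ∀ (f : SkewSeries D.p R) (I : ℕ), i < I →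
      (∑ i ∈ Finset.range I, C (coeff i f) * X ^ D.p ^ i : R[X]).coeff (D.p ^ i) = coeff i f := by
    intro f I hI
    rw [finsetSum_coeff, Finset.sum_eq_single i]
    · simp
    · intro j _ hj
      rw [coeff_C_mul, coeff_X_pow, if_neg, mul_zero]
      exact fun h => hj (Nat.pow_right_injective D.p_prime.two_le h).symm
    · intro h; exact absurd (Finset.mem_range.mpr hI) h
  obtain ⟨I, hI, h1⟩ := key f hf
  obtain ⟨J, hJ, h2⟩ := key g hg
  rw [h1, h2, modAlg_mk_eq, algebraMap_eq, ← C_pow, C_dvd_iff_dvd_coeff] at h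
  have := h (D.p ^ i)
  rwa [Polynomial.coeff_sub, hcoeff f I hI, hcoeff g J hJ] at this

/-- If `n` is not a power of `p`, then by Lucas' theorem `(X + Y) ^ n` has a mixed term modulo `p`. -/
theorem exists_not_dvd_choose (p : ℕ) [hp : Fact p.Prime] (n : ℕ) (hn : n ≠ 0)
    (h : ∀ i, n ≠ p ^ i) : ∃ i, 0 < i ∧ i < n ∧ ¬ p ∣ n.choose i := by
  induction n using Nat.strong_induction_on with
  | _ n ih =>
    by_cases hd : p ∣ n
    · obtain ⟨m, rfl⟩ := hd
      have hm : m ≠ 0 := by rintro rfl; exact hn (mul_zero _)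
      have hpm : m < p * m := by
        have := hp.out.two_le
        have := Nat.pos_of_ne_zero hm
        nlinarith
      obtain ⟨i, hi0, him, hi⟩ := ih m hpm hm (fun i hi => h (i + 1) (by rw [hi, pow_succ']))
      refine ⟨p * i, Nat.mul_pos hp.out.pos hi0, (Nat.mul_lt_mul_left hp.out.pos).mpr him, ?_⟩
      have h1 := Choose.choose_modEq_choose_mod_mul_choose_div_nat (n := p * m) (k := p * i) (p := p)
      rw [Nat.mul_mod_right, Nat.mul_mod_right, Nat.choose_self, one_mul,
        Nat.mul_div_cancel_left _ hp.out.pos, Nat.mul_div_cancel_left _ hp.out.pos] at h1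
      rwa [h1.dvd_iff dvd_rfl]
    · refine ⟨1, one_pos, ?_, by rwa [Nat.choose_one_right]⟩
      have := h 0
      rw [pow_zero] at this
      omega

theorem isUnit_natCast_of_not_dvd {m : ℕ} (hm : ¬ D.p ∣ m) : IsUnit (m : R) := by
  have h : IsCoprime (m : ℤ) D.p :=
    Nat.isCoprime_iff_coprime.mpr ((Nat.Prime.coprime_iff_not_dvd D.p_prime).mpr hm).symm
  obtain ⟨a, b, hab⟩ := h
  have := congrArg (Int.cast : ℤ → R) hab
  push_cast at this
  rw [CharP.cast_eq_zero R D.p, mul_zero, add_zero] at this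
  exact IsUnit.of_mul_eq_one_right _ this

/-- Restricted series are determined by the operations that they define. -/
theorem eq_of_forall_eval_eq [IsDomain R] [IsDiscreteValuationRing R] (hπ : Irreducible D.π)
    [IsAdicComplete (IsLocalRing.maximalIdeal R) R] {f g : SkewSeries D.p R}
    (hf : f ∈ restricted D.p D.π) (hg : g ∈ restricted D.p D.π)
    (h : ∀ (B : D.NilAlg) (x : B), f.eval x = g.eval x) : f = g := by
  ext i
  rw [← sub_eq_zero]
  exact hπ.eq_zero_of_forall_pow_dvd fun N => dvd_coeff_of_eval_eq hf hg N (h (D.modAlg _ N) _) i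

/-- The evaluation map `S / π ^ N → B` extending an evaluation `S → B`. -/
noncomputable def modAlgLift {S : Type u} [CommRing S] [Algebra R S] {N : ℕ} (B : D.NilAlg)
    (hB : algebraMap R B D.π ^ N = 0) (f : S →ₐ[R] B) : D.modAlg S N →ₐ[R] B :=
  Ideal.Quotient.liftₐ _ f fun a ha => by
    obtain ⟨b, rfl⟩ := Ideal.mem_span_singleton.mp ha
    rw [map_mul, map_pow, f.commutes, hB, zero_mul]

open Polynomial in
/-- The additivity modulo `π ^ N` of an operation given by a polynomial forces the coefficients of the polynomial
to vanish modulo `π ^ N` outside the powers of `p`: the coefficient of `X ^ i` in the Taylor expansion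
of `F (X + Y)` is the Hasse derivative of `F` of order `i`. -/
theorem dvd_coeff_of_additive {F : R[X]} {N : ℕ}
    (h : algebraMap R R[X][X] D.π ^ N ∣ aeval (C X + X : R[X][X]) F - (aeval (C X : R[X][X]) F +
      aeval (X : R[X][X]) F)) {n : ℕ} (hn : ∀ i, n ≠ D.p ^ i) : D.π ^ N ∣ F.coeff n := by
  have hk : ∀ i j, D.π ^ N ∣ ((aeval (C X + X : R[X][X]) F - (aeval (C X : R[X][X]) F +
      aeval (X : R[X][X]) F)).coeff i).coeff j := by
    intro i j
    rw [← map_pow, IsScalarTower.algebraMap_apply R R[X] R[X][X], algebraMap_eq, algebraMap_eq,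
      C_dvd_iff_dvd_coeff] at h
    exact (C_dvd_iff_dvd_coeff _ _).mp (h i) j
  have h1 : (aeval (C X + X : R[X][X]) F) = taylor X (F.map C) := by
    rw [taylor_apply, add_comm, comp, eval₂_map, aeval_def]
    rfl
  have h2 : aeval (C X : R[X][X]) F = C F := by
    rw [aeval_def, eval₂_eq_sum_range]
    conv_rhs => rw [F.as_sum_range_C_mul_X_pow, map_sum]
    refine Finset.sum_congr rfl fun i _ => ?_
    rw [map_mul, map_pow]
    rfl
  have h3 : aeval (X : R[X][X]) F = F.map C := by
    rw [aeval_def, eval₂_eq_sum_range, ← eval₂_eq_sum_range]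
    rfl
  rw [h1, h2, h3] at hk
  have hc : ∀ i, (taylor X (F.map C)).coeff i = hasseDeriv i F := by
    intro i
    have h4 : hasseDeriv i (F.map C) = (hasseDeriv i F).map (C : R →+* R[X]) := by
      ext1 n
      rw [hasseDeriv_coeff, Polynomial.coeff_map, Polynomial.coeff_map, hasseDeriv_coeff, map_mul,
        map_natCast]
    rw [taylor_coeff, h4, eval_map, eval₂_C_X]
  simp only [Polynomial.coeff_sub, Polynomial.coeff_add, hc, Polynomial.coeff_map] at hk
  rcases eq_or_ne n 0 with rfl | h0
  · simpa using hk 0 0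
  · obtain ⟨i, hi0, hin, hi⟩ := exists_not_dvd_choose D.p n h0 hn
    obtain ⟨m, rfl⟩ := Nat.exists_eq_add_of_lt hin
    have := hk i (m + 1)
    rw [hasseDeriv_coeff, coeff_C, if_neg hi0.ne', Polynomial.coeff_zero, coeff_C,
      if_neg (Nat.succ_ne_zero m), add_zero, sub_zero, show m + 1 + i = i + m + 1 by ring] at this
    exact (isUnit_natCast_of_not_dvd hi).dvd_mul_left.mp this

open Polynomial in
/-- A natural family of additive maps on the test algebras is the evaluation of a restricted
series. -/
theorem exists_restricted_eq_eval [IsDomain R] [IsDiscreteValuationRing R] (hπ : Irreducible D.π)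
    [IsAdicComplete (IsLocalRing.maximalIdeal R) R] (α : ∀ B : D.NilAlg, B → B)
    (hadd : ∀ (B : D.NilAlg) (x y : B), α B (x + y) = α B x + α B y)
    (hnat : ∀ (B C : D.NilAlg) (f : B →ₐ[R] C) (x : B), α C (f x) = f (α B x)) :
    ∃ f ∈ restricted D.p D.π, ∀ (B : D.NilAlg) (x : B), α B x = f.eval x := by
  -- the polynomial `F N` describes the operation on all algebras killed by `π ^ N`
  have h1 : ∀ N, ∃ F : R[X], Ideal.Quotient.mk _ F = α (D.modAlg R[X] N) (Ideal.Quotient.mk _ X) :=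
    fun N => Ideal.Quotient.mk_surjective _
  choose F hF using h1
  have hα : ∀ (B : D.NilAlg) (N : ℕ), algebraMap R B D.π ^ N = 0 → ∀ x : B,
      α B x = aeval x (F N) := by
    intro B N hB x
    have h2 := hnat _ B (modAlgLift B hB (aeval x)) (Ideal.Quotient.mk _ X)
    rw [← hF N] at h2
    have h3 : ∀ G : R[X], modAlgLift B hB (aeval x) (Ideal.Quotient.mk _ G) = aeval x G :=
      fun G => rfl
    rw [h3, h3, aeval_X] at h2
    exact h2
  -- the polynomials `F N` converge coefficientwise
  have hcompat : ∀ n N, D.π ^ N ∣ (F (N + 1)).coeff n - (F N).coeff n := by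
    intro n N
    have h2 := hα (D.modAlg R[X] N) (N + 1)
      (by rw [pow_succ, modAlg_π_pow, zero_mul]) (Ideal.Quotient.mk _ X)
    have h3 : ∀ G : R[X], aeval (Ideal.Quotient.mk _ X : D.modAlg R[X] N) G =
        (Ideal.Quotient.mk _ G : D.modAlg R[X] N) := fun G => by
      have := (aeval_algHom_apply (Ideal.Quotient.mkₐ R (Ideal.span {algebraMap R R[X] D.π ^ N}))
        X G)
      rw [aeval_X_left_apply] at this
      exact this
    rw [h3, ← hF N, eq_comm, modAlg_mk_eq, algebraMap_eq, ← C_pow, C_dvd_iff_dvd_coeff] at h2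
    simpa using h2 n
  have hlim : ∀ n, ∃ y, ∀ N, D.π ^ N ∣ y - (F N).coeff n :=
    fun n => hπ.exists_limit (fun N => (F N).coeff n) (hcompat n)
  choose c hc using hlim
  -- only the powers of `p` occur as exponents
  have hvan : ∀ N n, (∀ i, n ≠ D.p ^ i) → D.π ^ N ∣ (F N).coeff n := by
    intro N n hn
    refine dvd_coeff_of_additive ?_ hn
    have h2 := hadd (D.modAlg R[X][X] N) (Ideal.Quotient.mk _ (C X)) (Ideal.Quotient.mk _ X)
    have h3 : ∀ G : R[X][X], α (D.modAlg R[X][X] N) (Ideal.Quotient.mk _ G) =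
        Ideal.Quotient.mk _ (aeval G (F N)) := fun G => by
      rw [hα _ N (modAlg_π_pow D R[X][X] N)]
      exact aeval_algHom_apply (Ideal.Quotient.mkₐ R (Ideal.span {algebraMap R R[X][X] D.π ^ N}))
        G (F N)
    rw [← map_add, h3, h3, h3, ← map_add, modAlg_mk_eq] at h2
    exact h2
  refine ⟨SkewSeries.mk fun i => c (D.p ^ i), ?_, ?_⟩
  · intro N
    refine ⟨(F N).natDegree + 1, fun i hi => ?_⟩
    have h2 := hc (D.p ^ i) N
    have h3 : i < D.p ^ i := Nat.lt_pow_self D.p_prime.one_lt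
    rwa [coeff_eq_zero_of_natDegree_lt (by omega), sub_zero] at h2
  · intro B x
    obtain ⟨N, hN⟩ := B.nil
    have hz : ∀ a, D.π ^ N ∣ a → algebraMap R B a = 0 := by
      intro a ha
      have := map_dvd (algebraMap R B) ha
      rw [map_pow, hN] at this
      exact zero_dvd_iff.mp this
    have hI : ∀ i, (F N).natDegree + 1 ≤ i → algebraMap R B (c (D.p ^ i)) = 0 := by
      intro i hi
      refine hz _ ?_
      have h2 := hc (D.p ^ i) N
      have h3 : i < D.p ^ i := Nat.lt_pow_self D.p_prime.one_lt
      rwa [coeff_eq_zero_of_natDegree_lt (by omega), sub_zero] at h2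
    have hI' : (F N).natDegree < D.p ^ ((F N).natDegree + 1) :=
      lt_trans (Nat.lt_succ_self _) (Nat.lt_pow_self D.p_prime.one_lt)
    rw [hα B N hN, eval_eq_sum (f := SkewSeries.mk fun i => c (D.p ^ i)) hI, aeval_eq_sum_range' hI']
    rw [← Finset.sum_subset (s₁ := (Finset.range ((F N).natDegree + 1)).image (D.p ^ ·)),
      Finset.sum_image]
    · refine Finset.sum_congr rfl fun i _ => ?_
      rw [coeff_mk, Algebra.smul_def]
      congr 1
      rw [← sub_eq_zero, ← map_sub]
      refine hz _ ?_
      rw [← neg_sub, dvd_neg]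
      exact hc _ N
    · exact fun i _ j _ h => Nat.pow_right_injective D.p_prime.two_le h
    · intro n hn
      obtain ⟨i, hi, rfl⟩ := Finset.mem_image.mp hn
      rw [Finset.mem_range] at hi ⊢
      exact Nat.pow_lt_pow_right D.p_prime.one_lt hi
    · intro n hn hn'
      rw [Algebra.smul_def, hz _ (hvan N n ?_), zero_mul]
      rintro i rfl
      rw [Finset.mem_range] at hn
      refine hn' (Finset.mem_image.mpr ⟨i, Finset.mem_range.mpr ?_, rfl⟩)
      exact (Nat.pow_lt_pow_iff_right D.p_prime.one_lt).mp hn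

end FrobBase

/-! ### The twisted series of an admissible module -/

namespace AdmissibleModule

variable {A : Type w} [CommRing A] {R : Type u} [CommRing R] [Algebra A R] {D : FrobBase R}
  (E : AdmissibleModule A D) [CharP R D.p]

/-- The ring homomorphism `ρ` describes the action of `A` on `E` by restricted twisted series. -/
structure IsGivenBy (ρ : A →+* SkewSeries D.p R) : Prop where
  mem : ∀ a, ρ a ∈ restricted D.p D.π
  act_eq : ∀ a (B : D.NilAlg) (x : B), E.act a B x = (ρ a).eval x
  coeff_zero : ∀ a, coeff 0 (ρ a) = algebraMap A R a

theorem exists_isGivenBy [IsDomain R] [IsDiscreteValuationRing R] (hπ : Irreducible D.π)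
    [IsAdicComplete (IsLocalRing.maximalIdeal R) R] :
    ∃ ρ : A →+* SkewSeries D.p R, E.IsGivenBy ρ := by
  have h := fun a => FrobBase.exists_restricted_eq_eval hπ (fun B x => E.act a B x)
    (fun B x y => map_add _ x y) (E.act_natural a)
  choose ρ hρ hact using h
  have ext := fun {f g : SkewSeries D.p R} => FrobBase.eq_of_forall_eval_eq hπ (f := f) (g := g)
  have hadd : ∀ a b, ρ (a + b) = ρ a + ρ b := fun a b =>
    ext (hρ _) ((restricted D.p D.π).add_mem (hρ a) (hρ b)) fun B x => by
      rw [eval_add B.nil (hρ a) (hρ b), ← hact, ← hact, ← hact, E.act_add]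
  refine ⟨⟨⟨⟨ρ, ?_⟩, ?_⟩, ?_, hadd⟩, ⟨hρ, hact, ?_⟩⟩
  · refine ext (hρ _) (restricted D.p D.π).one_mem fun B x => ?_
    rw [← hact, E.act_one, eval_one]
  · refine fun a b => ext (hρ _) ((restricted D.p D.π).mul_mem (hρ a) (hρ b)) fun B x => ?_
    rw [eval_mul B.nil (hρ a) (hρ b), ← hact, ← hact, ← hact, E.act_mul]
  · have := hadd 0 0
    rw [add_zero, left_eq_add] at this
    exact this
  · -- the constant term is read off from the action on the tangent space
    intro a
    rw [← sub_eq_zero]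
    refine hπ.eq_zero_of_forall_pow_dvd fun N => ?_
    have h1 := E.strict a (D.modAlg R N) 1
    rw [hact] at h1
    have h2 : (ρ a).eval (TrivSqZeroExt.inr 1 : DualNumber (D.modAlg R N)) =
        TrivSqZeroExt.inr (algebraMap R (D.modAlg R N) (coeff 0 (ρ a))) := by
      rw [eval, finsum_eq_single _ 0]
      · rw [pow_zero, pow_one, ← Algebra.smul_def, ← TrivSqZeroExt.inr_smul, Algebra.smul_def,
          mul_one]
      · intro i hi
        have : (TrivSqZeroExt.inr 1 : DualNumber (D.modAlg R N)) ^ D.p ^ i = 0 := by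
          have h3 := Nat.one_lt_pow hi D.p_prime.one_lt
          obtain ⟨m, hm⟩ := Nat.exists_eq_add_of_le' h3
          rw [hm, pow_add, pow_two, TrivSqZeroExt.inr_mul_inr, mul_zero]
        rw [this, mul_zero]
    have h4 := TrivSqZeroExt.inr_injective (h2.symm.trans h1)
    rw [mul_one] at h4
    have h5 := FrobBase.modAlg_mk_eq.mp h4
    simpa using h5

end AdmissibleModule

namespace SkewSeries

variable {p : ℕ} [hp : Fact p.Prime] {R : Type u} [CommRing R] [IsDomain R]
  [IsDiscreteValuationRing R] [CharP R p] [CharP (IsLocalRing.ResidueField R) p] {π : R}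

/-- The reduction of a series modulo the maximal ideal of `R`. -/
noncomputable abbrev reduce : SkewSeries p R →+* SkewSeries p (IsLocalRing.ResidueField R) :=
  SkewSeries.map (IsLocalRing.residue R)

theorem residue_eq_zero_iff_dvd (hπ : Irreducible π) {x : R} :
    IsLocalRing.residue R x = 0 ↔ π ∣ x := by
  rw [IsLocalRing.residue_eq_zero_iff, hπ.maximalIdeal_eq, Ideal.mem_span_singleton]

theorem reduce_eq_zero_iff (hπ : Irreducible π) {f : SkewSeries p R} :
    reduce f = 0 ↔ ∃ y, f = π • y := by
  constructor
  · intro h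
    exact exists_eq_smul_of_dvd fun i => (residue_eq_zero_iff_dvd hπ).mp (congrArg (coeff i) h)
  · rintro ⟨y, rfl⟩
    rw [map_smul, (residue_eq_zero_iff_dvd hπ).mpr dvd_rfl, zero_smul]

theorem exists_reduce_eq_zero (hπ : Irreducible π) {f : SkewSeries p R}
    (hf : f ∈ restricted p π) : ∃ I, ∀ i, I ≤ i → coeff i (reduce f) = 0 := by
  obtain ⟨I, hI⟩ := hf 1
  refine ⟨I, fun i hi => ?_⟩
  rw [coeff_map, residue_eq_zero_iff_dvd hπ, ← pow_one π]
  exact hI i hi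

theorem exists_reduce_eq {g : SkewSeries p (IsLocalRing.ResidueField R)}
    {I : ℕ} (hg : ∀ i, I ≤ i → coeff i g = 0) : ∃ f ∈ restricted p π, reduce f = g := by
  have h1 : ∀ i, ∃ r : R, IsLocalRing.residue R r = coeff i g := fun i =>
    IsLocalRing.residue_surjective _
  choose r hr using h1
  refine ⟨mk fun i => if i < I then r i else 0, mem_restricted_of_eq_zero I fun i hi => ?_,
    ext fun i => ?_⟩
  · rw [coeff_mk, if_neg (not_lt.mpr hi)]
  · rw [coeff_map, coeff_mk]
    split_ifs with h
    · exact hr i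
    · rw [_root_.map_zero, hg i (not_lt.mp h)]

open Polynomial in
/-- The additive polynomial attached to the first `I` coefficients of a series. -/
noncomputable def toPoly {k : Type*} [CommRing k] (f : SkewSeries p k) (I : ℕ) : k[X] :=
  ∑ i ∈ Finset.range I, C (coeff i f) * X ^ p ^ i

open Polynomial in
theorem natDegree_toPoly {k : Type*} [CommRing k] {f : SkewSeries p k} {n : ℕ}
    (hn : coeff n f ≠ 0) (I : ℕ) (hI : n < I) (hf : ∀ i, n < i → coeff i f = 0) :
    (toPoly f I).natDegree = p ^ n := by
  have h1 : toPoly f I = toPoly f (n + 1) := by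
    rw [toPoly, toPoly]
    symm
    refine Finset.sum_subset (fun i hi => ?_) (fun i hi hi' => ?_)
    · rw [Finset.mem_range] at hi ⊢
      omega
    · rw [Finset.mem_range] at hi'
      rw [hf i (by omega), C_0, zero_mul]
  rw [h1, toPoly, Finset.sum_range_succ]
  have h2 : (C (coeff n f) * X ^ p ^ n).natDegree = p ^ n := natDegree_C_mul_X_pow _ _ hn
  rw [natDegree_add_eq_right_of_degree_lt, h2]
  rw [degree_C_mul_X_pow _ hn]
  refine (degree_sum_le _ _).trans_lt ?_
  rw [Finset.sup_lt_iff (by exact_mod_cast WithBot.bot_lt_coe _)]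
  intro i hi
  refine (degree_C_mul_X_pow_le _ _).trans_lt ?_
  exact_mod_cast Nat.pow_lt_pow_right hp.out.one_lt (Finset.mem_range.mp hi)

end SkewSeries

namespace AdmissibleModule

variable {A : Type w} [CommRing A] {R : Type u} [CommRing R] [Algebra A R] {D : FrobBase R}
  (E : AdmissibleModule A D) [CharP R D.p] [IsDomain R] [IsDiscreteValuationRing R]
  [CharP (IsLocalRing.ResidueField R) D.p]

open Polynomial TensorProduct in
/-- The degree of the kernel of `a` is the degree of the additive polynomial by which `a` acts on the
reduction of `E`: over the residue field `k`, the kernel is the spectrum of `k[X]` modulo that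
polynomial. -/
theorem KernelHasDegree.exists_top_coeff (hπ : Irreducible D.π) {ρ : A →+* SkewSeries D.p R}
    (hρ : E.IsGivenBy ρ) {a : A} {d : ℚ} (h : E.KernelHasDegree a d) :
    ∃ n, coeff n (reduce (ρ a)) ≠ 0 ∧ (∀ i, n < i → coeff i (reduce (ρ a)) = 0) ∧
      (D.p : ℚ) ^ n = d := by
  obtain ⟨S, _, _, hfin, hfree, hd, e, he⟩ := h
  let k := IsLocalRing.ResidueField R
  have hπk : algebraMap R k D.π = 0 := (residue_eq_zero_iff_dvd hπ).mpr dvd_rfl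
  obtain ⟨I, hI⟩ := exists_reduce_eq_zero hπ (hρ.mem a)
  let P : k[X] := toPoly (reduce (ρ a)) I
  -- both `Q` and `T` represent the kernel of `a` on algebras over the residue field
  let Q : D.NilAlg :=
    { carrier := AdjoinRoot P
      nil := ⟨1, by rw [pow_one, IsScalarTower.algebraMap_apply R k, hπk, map_zero]⟩ }
  let T : D.NilAlg :=
    { carrier := k ⊗[R] S
      nil := ⟨1, by rw [pow_one, IsScalarTower.algebraMap_apply R k, hπk, map_zero]⟩ }
  have hact : ∀ (B : D.NilAlg) [Algebra k B] [IsScalarTower R k B] (x : B),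
      E.act a B x = aeval x P := by
    intro B _ _ x
    rw [hρ.act_eq, eval_eq_sum (I := I)]
    · simp only [P, toPoly, map_sum, map_mul, aeval_C, map_pow, aeval_X]
      exact Finset.sum_congr rfl fun i _ => by
        rw [IsScalarTower.algebraMap_apply R k]
        rfl
    · intro i hi
      rw [IsScalarTower.algebraMap_apply R k]
      have := hI i hi
      rw [SkewSeries.coeff_map] at this
      change algebraMap k B (IsLocalRing.residue R _) = 0
      rw [this, map_zero]
  let xT : T := e T (Algebra.TensorProduct.includeRight)
  have hxT : aeval (xT : k ⊗[R] S) P = 0 := by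
    let _ : Algebra k T := inferInstanceAs (Algebra k (k ⊗[R] S))
    have : IsScalarTower R k T := inferInstanceAs (IsScalarTower R k (k ⊗[R] S))
    exact (hact T xT).symm.trans (e T (Algebra.TensorProduct.includeRight)).2
  let fwd : AdjoinRoot P →ₐ[k] k ⊗[R] S := AdjoinRoot.liftAlgHom P (Algebra.ofId k _) xT hxT
  have hroot : E.act a Q (AdjoinRoot.root P : AdjoinRoot P) = 0 := by
    let _ : Algebra k Q := inferInstanceAs (Algebra k (AdjoinRoot P))
    have : IsScalarTower R k Q := inferInstanceAs (IsScalarTower R k (AdjoinRoot P))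
    refine (hact Q _).trans ?_
    change aeval (AdjoinRoot.root P) P = 0
    rw [AdjoinRoot.aeval_eq, AdjoinRoot.mk_self]
  let g : S →ₐ[R] AdjoinRoot P := (e Q).symm ⟨AdjoinRoot.root P, hroot⟩
  have hg : (e Q g : AdjoinRoot P) = AdjoinRoot.root P := by
    have := (e Q).apply_symm_apply ⟨AdjoinRoot.root P, hroot⟩
    exact congrArg Subtype.val this
  let bwd : k ⊗[R] S →ₐ[k] AdjoinRoot P :=
    Algebra.TensorProduct.lift (Algebra.ofId k _) g (fun _ _ => Commute.all _ _)
  have h1 : (fwd.restrictScalars R).comp g = Algebra.TensorProduct.includeRight := by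
    apply (e T).injective
    apply Subtype.ext
    have h2 := he Q T (fwd.restrictScalars R) g
    rw [h2]
    change fwd (e Q g : AdjoinRoot P) = _
    rw [hg]
    exact AdjoinRoot.liftAlgHom_root _ _ _ _
  have h2 : bwd xT = AdjoinRoot.root P := by
    have h3 := he T Q (bwd.restrictScalars R) Algebra.TensorProduct.includeRight
    have h4 : (bwd.restrictScalars R).comp Algebra.TensorProduct.includeRight = g := by
      ext s
      simp [bwd]
    rw [h4] at h3
    exact h3.symm.trans hg
  let eqv : AdjoinRoot P ≃ₐ[k] k ⊗[R] S := AlgEquiv.ofAlgHom fwd bwd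
    (by
      ext s
      have := DFunLike.congr_fun h1 s
      simpa [bwd] using this)
    (by
      ext
      have h3 : fwd (AdjoinRoot.root P) = xT := AdjoinRoot.liftAlgHom_root _ _ _ _
      rw [AlgHom.comp_apply, h3]
      exact h2)
  have hrank : Module.finrank k (AdjoinRoot P) = Module.finrank R S := by
    rw [eqv.toLinearEquiv.finrank_eq, Module.finrank_baseChange]
  have hfinQ : Module.Finite k (AdjoinRoot P) := Module.Finite.equiv eqv.symm.toLinearEquiv
  have hP : P ≠ 0 := by
    intro h0
    have h5 : Function.Injective (AdjoinRoot.mkₐ P) := by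
      intro x y hxy
      have h6 : AdjoinRoot.mk P x = AdjoinRoot.mk P y := hxy
      rw [AdjoinRoot.mk_eq_mk, h0, zero_dvd_iff, sub_eq_zero] at h6
      exact h6
    have h7 : Module.Finite k k[X] := Module.Finite.of_injective (AdjoinRoot.mkₐ P).toLinearMap h5
    exact Polynomial.not_finite h7
  have hdeg : P.natDegree = Module.finrank R S := by
    rw [← hrank, ← AdjoinRoot.powerBasis_dim hP, PowerBasis.finrank]
  have hex : ∃ n, n < I ∧ coeff n (reduce (ρ a)) ≠ 0 := by
    by_contra! hcon
    exact hP (Finset.sum_eq_zero fun i hi => by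
      rw [hcon i (Finset.mem_range.mp hi), C_0, zero_mul])
  classical
  let n := Nat.findGreatest (fun n => coeff n (reduce (ρ a)) ≠ 0) I
  obtain ⟨m, hm, hm'⟩ := hex
  have hn : coeff n (reduce (ρ a)) ≠ 0 :=
    Nat.findGreatest_spec (P := fun n => coeff n (reduce (ρ a)) ≠ 0) hm.le hm'
  have hnI : n < I := by
    by_contra hcon
    exact hn (hI n (not_lt.mp hcon))
  have htop : ∀ i, n < i → coeff i (reduce (ρ a)) = 0 := by
    intro i hi
    rcases le_or_gt i I with h | h
    · by_contra hcon
      exact Nat.findGreatest_is_greatest hi h hcon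
    · exact hI i h.le
  refine ⟨n, hn, htop, ?_⟩
  rw [← hd, ← hdeg, natDegree_toPoly hn I hnI htop]
  push_cast
  rfl

end AdmissibleModule

/-! ### The action of `A` on Witt vectors -/

namespace FrobBase

variable {R : Type u} [CommRing R] {D : FrobBase R}

theorem qhat_pow (l : ℕ) : D.qhat ^ l = D.p ^ (D.e * l) := by rw [qhat, pow_mul]

theorem iterate_φ_mul_π_pow (s : ℕ) (r : R) (k : ℕ) :
    (D.φ)^[s] (r * D.π ^ k) = (D.φ)^[s] r * D.π ^ k := by
  rw [← RingHom.coe_pow, map_mul, map_pow, RingHom.coe_pow, Function.iterate_fixed D.φ_π]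

namespace Witt

variable {n : ℕ} {B : Type u} [CommRing B] [Algebra R B]

/-- A coordinate of Witt vectors, as an additive map. -/
def coeffHom (m : Fin (n + 1)) : D.Witt n B →+ B where
  toFun x := x.coeff m
  map_zero' := rfl
  map_add' _ _ := rfl

/-- The Witt vector `V ^ j [y]`, whose only coordinate is `y` in position `j`. -/
def single (j : Fin (n + 1)) (y : B) : D.Witt n B := ⟨fun m => if m = j then y else 0⟩

theorem single_add (j : Fin (n + 1)) (x y : B) :
    (single j (x + y) : D.Witt n B) = single j x + single j y := by
  ext m
  simp only [single, add_coeff]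
  split_ifs <;> simp

theorem eq_sum_single (x : D.Witt n B) : x = ∑ j, single j (x.coeff j) := by
  ext m
  have : (∑ j, single j (x.coeff j) : D.Witt n B).coeff m =
      ∑ j, (single j (x.coeff j) : D.Witt n B).coeff m := map_sum (coeffHom m) _ _
  rw [this]
  simp [single]

theorem map_single {C : Type u} [CommRing C] [Algebra R C] (f : B →ₐ[R] C) (j : Fin (n + 1))
    (y : B) : map f (single j y : D.Witt n B) = single j (f y) := by
  ext m
  simp only [map, single]
  split_ifs <;> simp

theorem ghost_single (j m : Fin (n + 1)) (y : B) : ghost (single j y : D.Witt n B) m =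
    if (j : ℕ) ≤ m then algebraMap R B (D.π ^ (j : ℕ)) * y ^ D.qhat ^ ((m : ℕ) - j) else 0 := by
  rw [ghost, Finset.sum_eq_single j]
  · simp [single]
  · intro i _ hi
    simp only [single, if_neg hi, zero_pow (D.qhat_pow_ne_zero _), mul_zero, ite_self]
  · simp

open Polynomial in
/-- The coordinates of `r (V ^ j [y]) ^ N`. -/
theorem algebraMap_mul_single_pow [CharP R D.p] [IsDomain R] (hπ : D.π ≠ 0) (r : R)
    (j m : Fin (n + 1)) (y : B) {N : ℕ} (hN : N ≠ 0) :
    (algebraMap R (D.Witt n B) r * single j y ^ N).coeff m = if (j : ℕ) ≤ m then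
      algebraMap R B (D.coord ((D.φ)^[j] r * D.π ^ ((j : ℕ) * (N - 1))) ((m : ℕ) - j)) *
        y ^ (D.qhat ^ ((m : ℕ) - j) * N) else 0 := by
  -- it suffices to treat the universal case, in which the ghost map is injective
  let T : ∀ (B : Type u) [CommRing B] [Algebra R B] (y : B), D.Witt n B := fun B _ _ y =>
    ⟨fun m => if (j : ℕ) ≤ m then
      algebraMap R B (D.coord ((D.φ)^[j] r * D.π ^ ((j : ℕ) * (N - 1))) ((m : ℕ) - j)) *
        y ^ (D.qhat ^ ((m : ℕ) - j) * N) else 0⟩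
  suffices h : ∀ (B : Type u) [CommRing B] [Algebra R B] (y : B),
      algebraMap R (D.Witt n B) r * single j y ^ N = T B y by rw [h]
  have huniv : algebraMap R (D.Witt n R[X]) r * single j X ^ N = T R[X] X := by
    have : CharP R[X] D.p := inferInstance
    refine ghost_injective (fun b hb => ?_) (funext fun m => ?_)
    · rw [algebraMap_eq] at hb
      exact (mul_eq_zero.mp hb).resolve_left (C_ne_zero.mpr hπ)
    · let G : D.Witt n R[X] →* (Fin (n + 1) → R[X]) := ⟨⟨ghost, ghost_one⟩, ghost_mul⟩
      have h1 : ghost (algebraMap R (D.Witt n R[X]) r * single j X ^ N) =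
          ghost (algebraMap R (D.Witt n R[X]) r) * ghost (single j X : D.Witt n R[X]) ^ N := by
        rw [ghost_mul]
        congr 1
        exact map_pow G _ _
      rw [h1, Pi.mul_apply, Pi.pow_apply, ghost_algebraMap, ghost_single, ghost]
      refine Eq.trans ?_ (sum_fin_ite (fun i : ℕ => algebraMap R R[X] (D.π ^ i) *
        (if (j : ℕ) ≤ i then
          algebraMap R R[X] (D.coord ((D.φ)^[j] r * D.π ^ ((j : ℕ) * (N - 1))) (i - j)) *
          X ^ (D.qhat ^ (i - j) * N) else 0) ^ D.qhat ^ ((m : ℕ) - i)) m).symm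
      split_ifs with hjm
      · obtain ⟨s, hs⟩ := Nat.exists_eq_add_of_le hjm
        rw [hs, add_assoc, Finset.sum_range_add, Finset.sum_eq_zero, zero_add]
        · have h2 : ∀ l ∈ Finset.range (s + 1), algebraMap R R[X] (D.π ^ ((j : ℕ) + l)) *
              (if (j : ℕ) ≤ j + l then
                algebraMap R R[X] (D.coord ((D.φ)^[j] r * D.π ^ ((j : ℕ) * (N - 1))) (j + l - j)) *
                X ^ (D.qhat ^ (j + l - j : ℕ) * N) else 0) ^ D.qhat ^ ((j : ℕ) + s - (j + l)) =
              algebraMap R R[X] (D.π ^ (j : ℕ)) * X ^ (D.qhat ^ s * N) *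
              algebraMap R R[X] (D.π ^ l *
                D.coord ((D.φ)^[j] r * D.π ^ ((j : ℕ) * (N - 1))) l ^ D.qhat ^ (s - l)) := by
            intro l hl
            have hl' := Nat.lt_succ_iff.mp (Finset.mem_range.mp hl)
            rw [if_pos (Nat.le_add_right _ _), Nat.add_sub_cancel_left, Nat.add_sub_add_left,
              mul_pow, ← pow_mul, pow_add, map_mul, map_mul, map_pow (algebraMap R R[X]) (D.coord _ _),
              show D.qhat ^ l * N * D.qhat ^ (s - l) = D.qhat ^ l * D.qhat ^ (s - l) * N by ring,
              ← pow_add, Nat.add_sub_cancel' hl']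
            ring
          rw [Finset.sum_congr rfl h2, ← Finset.mul_sum, ← map_sum, D.ghost_coord,
            iterate_φ_mul_π_pow, ← Function.iterate_add_apply, Nat.add_sub_cancel_left, add_comm s, mul_pow, ← map_pow,
            ← pow_mul, ← pow_mul]
          have h3 : D.π ^ ((j : ℕ) * N) = D.π ^ (j : ℕ) * D.π ^ ((j : ℕ) * (N - 1)) := by
            rw [← pow_add]
            congr 1
            obtain ⟨M, rfl⟩ := Nat.exists_eq_succ_of_ne_zero hN
            rw [Nat.succ_sub_one, Nat.mul_succ, add_comm]
          rw [h3, map_mul, map_mul]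
          ring
        · intro i hi
          rw [if_neg (not_le.mpr (Finset.mem_range.mp hi)), zero_pow (D.qhat_pow_ne_zero _),
            mul_zero]
      · rw [zero_pow hN, mul_zero]
        symm
        refine Finset.sum_eq_zero fun i hi => ?_
        have := Finset.mem_range.mp hi
        rw [if_neg (by omega), zero_pow (D.qhat_pow_ne_zero _), mul_zero]
  intro B _ _ y
  have h := congrArg (map (aeval y : R[X] →ₐ[R] B)) huniv
  have hT : map (aeval y : R[X] →ₐ[R] B) (T R[X] X) = T B y := by
    ext m
    simp only [T, map]
    split_ifs
    · rw [map_mul, map_pow, aeval_X, AlgHom.commutes]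
    · rw [map_zero]
  rw [hT, map_mul'] at h
  rw [← h]
  congr 1
  · ext m
    rw [algebraMap_apply]
    exact ((aeval y : R[X] →ₐ[R] B).commutes _).symm
  · have h2 := map_pow (mapHom (D := D) (n := n) (aeval y : R[X] →ₐ[R] B)) (single j X) N
    refine Eq.trans ?_ h2.symm
    congr 1
    exact ((map_single (aeval y : R[X] →ₐ[R] B) j X).trans (by rw [aeval_X])).symm

end Witt

/-- The coordinates of the multiples of a high power of `π` are divisible by a given power
of `π`. -/
theorem exists_dvd_coord (l N : ℕ) : ∃ M, ∀ x, D.π ^ M ∣ x → D.π ^ N ∣ D.coord x l := by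
  have h := Witt.isNilpotent_π (n := l) (D.modAlg R N).nil
  obtain ⟨M, hM⟩ := h
  refine ⟨M, ?_⟩
  rintro x ⟨y, rfl⟩
  have h1 : algebraMap R (D.Witt l (D.modAlg R N)) (D.π ^ M * y) = 0 := by
    rw [map_mul, map_pow, hM, zero_mul]
  have h2 := congrArg (fun w => Witt.coeff w ⟨l, Nat.lt_succ_self l⟩) h1
  simp only [Witt.algebraMap_apply, Witt.zero_coeff] at h2
  have h3 : (Ideal.Quotient.mk _ (D.coord (D.π ^ M * y) l) : D.modAlg R N) =
      Ideal.Quotient.mk _ 0 := by rw [map_zero]; exact h2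
  simpa using modAlg_mk_eq.mp h3

variable [CharP R D.p]

/-- The series by which the endomorphism `f` of the additive group acts from the coordinate `j` to
the coordinate `j + l` of Witt vectors, up to a power of the Frobenius. -/
noncomputable def wittSeries (D : FrobBase R) (f : SkewSeries D.p R) (j l : ℕ) : SkewSeries D.p R :=
  SkewSeries.mk fun i => D.coord ((D.φ)^[j] (coeff i f) * D.π ^ (j * (D.p ^ i - 1))) l

theorem wittSeries_mem {f : SkewSeries D.p R} (hf : f ∈ restricted D.p D.π) (j l : ℕ) :
    D.wittSeries f j l ∈ restricted D.p D.π := fun N => by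
  obtain ⟨M, hM⟩ := D.exists_dvd_coord l N
  obtain ⟨I, hI⟩ := hf M
  refine ⟨I, fun i hi => hM _ (Dvd.dvd.mul_right ?_ _)⟩
  have := map_dvd (D.φ ^ j) (hI i hi)
  rwa [map_pow, RingHom.coe_pow, Function.iterate_fixed D.φ_π] at this

/-- The ghost components of the action of `f` on `V ^ j [y]`. -/
theorem sum_wittSeries (f : SkewSeries D.p R) (j s : ℕ) :
    ∑ l ∈ Finset.range (s + 1), const (D.π ^ (j + l)) *
      (tau (D.e * (s - l)) * (D.wittSeries f j l * tau (D.e * l))) =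
      SkewSeries.map (D.φ ^ (j + s)) f * const (D.π ^ j) * tau (D.e * s) := by
  have h1 : ∀ l ∈ Finset.range (s + 1), const (D.π ^ (j + l)) *
      (tau (D.e * (s - l)) * (D.wittSeries f j l * tau (D.e * l))) =
      (const (D.π ^ (j + l)) * SkewSeries.map (iterateFrobenius R D.p (D.e * (s - l)))
        (D.wittSeries f j l)) * tau (D.e * s) := by
    intro l hl
    have hl' := Nat.lt_succ_iff.mp (Finset.mem_range.mp hl)
    rw [← mul_assoc (tau _), tau_mul, mul_assoc _ (tau _), tau_mul_tau, ← mul_add,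
      Nat.sub_add_cancel hl', mul_assoc]
  rw [Finset.sum_congr rfl h1, ← Finset.sum_mul]
  congr 1
  ext i
  rw [coeff_sum, coeff_mul_const, coeff_map]
  have h2 : ∀ l ∈ Finset.range (s + 1), coeff i (const (D.π ^ (j + l)) *
      SkewSeries.map (iterateFrobenius R D.p (D.e * (s - l))) (D.wittSeries f j l)) =
      D.π ^ j * (D.π ^ l * D.coord ((D.φ)^[j] (coeff i f) * D.π ^ (j * (D.p ^ i - 1))) l ^
        D.qhat ^ (s - l)) := by
    intro l _
    rw [coeff_const_mul, coeff_map, iterateFrobenius_def, wittSeries, coeff_mk, qhat_pow, pow_add,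
      mul_assoc]
  rw [Finset.sum_congr rfl h2, ← Finset.mul_sum, D.ghost_coord, iterate_φ_mul_π_pow,
    RingHom.coe_pow, ← Function.iterate_add_apply, add_comm s, mul_left_comm, ← pow_add]
  congr 1
  rw [← pow_mul]
  congr 1
  have : 0 < D.p ^ i := pow_pos D.p_prime.pos _
  obtain ⟨M, hM⟩ := Nat.exists_eq_succ_of_ne_zero this.ne'
  rw [hM, Nat.succ_sub_one, Nat.mul_succ, add_comm]

end FrobBase

namespace AdmissibleModule

variable {A : Type w} [CommRing A] {R : Type u} [CommRing R] [Algebra A R] {D : FrobBase R}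
  {E : AdmissibleModule A D} [CharP R D.p] [IsDomain R]
  [IsDiscreteValuationRing R] {ρ : A →+* SkewSeries D.p R}

open FrobBase

/-- The coordinates of the action of `a` on `V ^ j [y]`. -/
theorem IsGivenBy.coeff_act_single (hρ : E.IsGivenBy ρ) (hπ : D.π ≠ 0) {n : ℕ} (a : A)
    (B : D.NilAlg) (j m : Fin (n + 1)) (y : B) :
    (E.act a (B.witt n) (Witt.single j y)).coeff m = if (j : ℕ) ≤ m then
      (D.wittSeries (ρ a) j (m - j) * tau (D.e * (m - j))).eval y else 0 := by
  obtain ⟨I, hI⟩ := exists_vanish (B.witt n).nil (hρ.mem a)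
  obtain ⟨J, hJ⟩ := exists_vanish B.nil (wittSeries_mem (hρ.mem a) j (m - j))
  rw [hρ.act_eq, eval_eq_sum (I := max I J) (fun i hi => hI i (le_of_max_le_left hi))]
  refine (map_sum (Witt.coeffHom m) _ _).trans ?_
  have h1 : ∀ i ∈ Finset.range (max I J), Witt.coeffHom m
      (algebraMap R (D.Witt n B) (coeff i (ρ a)) * (Witt.single j y) ^ D.p ^ i) = _ := fun i _ =>
    Witt.algebraMap_mul_single_pow hπ (coeff i (ρ a)) j m y (pow_ne_zero _ D.p_prime.ne_zero)
  refine (Finset.sum_congr rfl h1).trans ?_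
  split_ifs with h
  · rw [eval_mul B.nil (wittSeries_mem (hρ.mem a) j (m - j)) (tau_mem_restricted _), eval_tau,
      eval_eq_sum (I := max I J) (fun i hi => hJ i (le_of_max_le_right hi))]
    refine Finset.sum_congr rfl fun i _ => ?_
    rw [pow_mul y, qhat_pow]
    rfl
  · exact Finset.sum_const_zero

theorem sum_fin_ge {M : Type*} [AddCommMonoid M] {n : ℕ} (j : Fin (n + 1)) (h : ℕ → M) :
    (∑ m : Fin (n + 1), if (j : ℕ) ≤ m then h m else 0) =
      ∑ l ∈ Finset.range (n + 1 - j), h (j + l) := by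
  have aux : ∀ j N : ℕ, (∑ m ∈ Finset.range (j + N), if j ≤ m then h m else 0) =
      ∑ l ∈ Finset.range N, h (j + l) := by
    intro j N
    rw [Finset.sum_range_add, Finset.sum_eq_zero, zero_add]
    · exact Finset.sum_congr rfl fun l _ => if_pos (Nat.le_add_right _ _)
    · exact fun i hi => if_neg (not_le.mpr (Finset.mem_range.mp hi))
  rw [Fin.sum_univ_eq_sum_range (fun m => if (j : ℕ) ≤ m then h m else 0), ← aux,
    Nat.add_sub_cancel' j.2.le]

variable {K : Type u} [Field K] [Algebra R K] [IsFractionRing R K] [CharP K D.p]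

/-- A combination `∑ c m • L m ∘ w m` of the compositions of the ghost maps `w m` with logarithms
`L m` of the twists of `E` is a character as soon as its coordinates are restricted series `g j` over
`R`. -/
theorem IsGivenBy.exists_mem_X (hρ : E.IsGivenBy ρ) (hπ : D.π ≠ 0) {L : ℕ → SkewSeries D.p K}
    (hL : ∀ m b, L m * toFrac K (SkewSeries.map (D.φ ^ m) (ρ b)) =
      algebraMap R K (algebraMap A R b) • L m) (n : ℕ) (c : ℕ → K) (g : ℕ → SkewSeries D.p R)
    (hg : ∀ j ≤ n, g j ∈ restricted D.p D.π)
    (hgc : ∀ j ≤ n, toFrac K (g j) = ∑ s ∈ Finset.range (n + 1 - j),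
      c (j + s) • (L (j + s) * toFrac K (const (D.π ^ j) * tau (D.e * s)))) :
    ∃ Θ ∈ E.X n, ∀ (B : D.NilAlg) (x : D.Witt n B),
      Θ B x = ∑ j : Fin (n + 1), (g j).eval (x.coeff j) := by
  have hj : ∀ j : Fin (n + 1), g j ∈ restricted D.p D.π :=
    fun j => hg j (Nat.lt_succ_iff.mp j.2)
  let Θ : ∀ B : D.NilAlg, D.Witt n B →+ B := fun B =>
    ∑ j : Fin (n + 1), (evalHom B.nil (hj j)).comp (Witt.coeffHom j)
  have hΘ : ∀ (B : D.NilAlg) (x : D.Witt n B), Θ B x = ∑ j : Fin (n + 1), (g j).eval (x.coeff j) := by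
    intro B x
    simp only [Θ, AddMonoidHom.finsetSum_apply]
    rfl
  -- the `A`-linearity, on the coordinate `j`, of a combination of ghost maps and logarithms
  have key : ∀ b : A, ∀ j ≤ n, ∑ l ∈ Finset.range (n + 1 - j),
      g (j + l) * (D.wittSeries (ρ b) j l * tau (D.e * l)) = algebraMap A R b • g j := by
    intro b j hjn
    apply toFrac_injective (K := K)
    rw [SkewSeries.map_smul, map_sum]
    have h1 : ∀ l ∈ Finset.range (n + 1 - j),
        toFrac K (g (j + l) * (D.wittSeries (ρ b) j l * tau (D.e * l))) =
        ∑ s ∈ Finset.range (n + 1 - j - l), c (j + (l + s)) • (L (j + (l + s)) *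
          toFrac K (const (D.π ^ (j + l)) *
            (tau (D.e * s) * (D.wittSeries (ρ b) j l * tau (D.e * l))))) := by
      intro l hl
      have hl' := Finset.mem_range.mp hl
      rw [_root_.map_mul, hgc (j + l) (by omega), Finset.sum_mul, Nat.sub_sub]
      refine Finset.sum_congr rfl fun s _ => ?_
      rw [smul_mul, mul_assoc, ← _root_.map_mul, mul_assoc, add_assoc]
    rw [Finset.sum_congr rfl h1, ← Finset.sum_range_diag_flip (n + 1 - j) (fun l s =>
      c (j + (l + s)) • (L (j + (l + s)) * toFrac K (const (D.π ^ (j + l)) *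
            (tau (D.e * s) * (D.wittSeries (ρ b) j l * tau (D.e * l))))))]
    rw [hgc j hjn, Finset.smul_sum]
    refine Finset.sum_congr rfl fun s _ => ?_
    have h2 : ∀ l ∈ Finset.range (s + 1), c (j + (l + (s - l))) • (L (j + (l + (s - l))) *
        toFrac K (const (D.π ^ (j + l)) *
          (tau (D.e * (s - l)) * (D.wittSeries (ρ b) j l * tau (D.e * l))))) =
        c (j + s) • (L (j + s) * toFrac K (const (D.π ^ (j + l)) *
          (tau (D.e * (s - l)) * (D.wittSeries (ρ b) j l * tau (D.e * l))))) := by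
      intro l hl
      rw [Nat.add_sub_cancel' (Nat.lt_succ_iff.mp (Finset.mem_range.mp hl))]
    rw [Finset.sum_congr rfl h2, ← Finset.smul_sum, ← Finset.mul_sum, ← map_sum, sum_wittSeries,
      mul_assoc, _root_.map_mul, ← mul_assoc, hL, smul_mul, smul_comm]
  refine ⟨Θ, ⟨fun B C f x => ?_, fun a B x => ?_⟩, hΘ⟩
  · rw [hΘ, hΘ, map_sum]
    exact Finset.sum_congr rfl fun j _ => (map_eval B.nil (hj j) f _).symm
  · have hsingle : ∀ (j : Fin (n + 1)) (y : B), Θ B (E.act a (B.witt n) (Witt.single j y)) =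
        algebraMap R B (algebraMap A R a) * (g j).eval y := by
      intro j y
      have hw : ∀ l, D.wittSeries (ρ a) j l * tau (D.e * l) ∈ restricted D.p D.π := fun l =>
        (restricted D.p D.π).mul_mem (wittSeries_mem (hρ.mem a) j l) (tau_mem_restricted _)
      rw [hΘ]
      obtain ⟨h, hh⟩ : ∃ h : ℕ → B, h = fun m => (g m).eval
        ((D.wittSeries (ρ a) j (m - j) * tau (D.e * (m - j))).eval y) := ⟨_, rfl⟩
      have h1 : ∀ m : Fin (n + 1), (g m).eval ((E.act a (B.witt n) (Witt.single j y)).coeff m) =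
          if (j : ℕ) ≤ m then h m else 0 := by
        intro m
        rw [hh]
        rw [hρ.coeff_act_single hπ]
        split_ifs
        · rfl
        · exact eval_zero_right _
      rw [Finset.sum_congr rfl fun m _ => h1 m, sum_fin_ge, hh,
        ← eval_smul _ _ B.nil (hj j), ← key a j (Nat.lt_succ_iff.mp j.2), eval_sum B.nil]
      · refine Finset.sum_congr rfl fun l hl => ?_
        have hl' := Finset.mem_range.mp hl
        simp only [Nat.add_sub_cancel_left]
        rw [eval_mul B.nil (hg _ (by omega)) (hw l)]
      · intro l hl
        have hl' := Finset.mem_range.mp hl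
        exact (restricted D.p D.π).mul_mem (hg _ (by omega)) (hw l)
    rw [hΘ B x, Finset.mul_sum]
    conv_lhs => rw [Witt.eq_sum_single x, map_sum, map_sum]
    exact Finset.sum_congr rfl fun j _ => hsingle j _

end AdmissibleModule

end

section

open SkewSeries FrobBase

/-! ### Characters of order at most one and lifts of Frobenius -/

namespace SkewSeries

variable {p : ℕ} [hp : Fact p.Prime] {R : Type u} [CommRing R] [IsDomain R]
  [IsDiscreteValuationRing R] [CharP R p] [CharP (IsLocalRing.ResidueField R) p] {π : R}

/-- As twisted series over the residue field form a domain, divisibility by `π` can be cancelled. -/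
theorem exists_eq_smul_of_mul (hπ : Irreducible π) {f x z : SkewSeries p R} (hf : reduce f ≠ 0)
    (h : x * f = π • z) : ∃ y, x = π • y := by
  rw [← reduce_eq_zero_iff hπ]
  have h1 := congrArg reduce h
  rw [_root_.map_mul, map_smul, (residue_eq_zero_iff_dvd hπ).mpr dvd_rfl, zero_smul] at h1
  exact (mul_eq_zero.mp h1).resolve_right hf

/-- A nonzero reduction rules out integral solutions of `x f = π x`. -/
theorem eq_zero_of_mul_eq_uniformizer_smul (hπ : Irreducible π)
    [IsAdicComplete (IsLocalRing.maximalIdeal R) R] {f x : SkewSeries p R} (hf : reduce f ≠ 0)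
    (h : x * f = π • x) : x = 0 := by
  have h1 : ∀ N : ℕ, ∃ y, x = π ^ N • y := by
    intro N
    induction N with
    | zero => exact ⟨x, by rw [pow_zero, one_smul]⟩
    | succ N ih =>
      obtain ⟨y, rfl⟩ := ih
      rw [smul_mul, smul_comm π] at h
      obtain ⟨z, rfl⟩ := exists_eq_smul_of_mul hπ hf
        (smul_left_injective (pow_ne_zero N hπ.ne_zero) h)
      exact ⟨z, by rw [smul_smul, pow_succ]⟩
  ext i
  refine hπ.eq_zero_of_forall_pow_dvd fun N => ?_
  obtain ⟨y, hy⟩ := h1 N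
  exact ⟨coeff i y, by rw [hy]; rfl⟩

theorem exists_mul_smul_eq (f : SkewSeries p R) (a : R) (y : SkewSeries p R) :
    ∃ z, f * (a • y) = a • z := by
  refine exists_eq_smul_of_dvd fun i => ?_
  rw [coeff_mul]
  refine Finset.dvd_sum fun ij _ => Dvd.dvd.mul_left ?_ _
  exact (Dvd.intro _ rfl : a ∣ a * coeff ij.2 y).trans
    (dvd_pow_self _ (pow_ne_zero _ hp.out.ne_zero))

/-- A series that is congruent to `1` modulo `π` is invertible among restricted series. -/
theorem exists_restricted_mul_eq (hπ : Irreducible π) {s g : SkewSeries p R}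
    (hs : s ∈ restricted p π) (hs0 : coeff 0 s = 1) (hs1 : reduce s = 1)
    (hg : g ∈ restricted p π) : ∃ x ∈ restricted p π, s * x = g := by
  obtain ⟨x, hx⟩ := exists_mul_eq hs0 g
  have h1 : reduce (s - 1) = 0 := by rw [map_sub, hs1, _root_.map_one, sub_self]
  obtain ⟨s', hs'⟩ := (reduce_eq_zero_iff hπ).mp h1
  have hs'r : s' ∈ restricted p π := mem_restricted_of_smul hπ.ne_zero 1 (by rw [pow_one])
    (by rw [← hs']; exact (restricted p π).sub_mem hs (restricted p π).one_mem)
  have hx' : x = g - π • (s' * x) := by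
    rw [← smul_mul, ← hs', ← hx]
    noncomm_ring
  -- iterating `x = g - π s' x` approximates `x` by restricted series
  refine ⟨x, mem_restricted_of_approx fun N => ?_, hx⟩
  induction N with
  | zero => exact ⟨0, (restricted p π).zero_mem, x, by rw [pow_zero, one_smul, zero_add]⟩
  | succ N ih =>
    obtain ⟨a, ha, y, hy⟩ := ih
    obtain ⟨z, hz⟩ := exists_mul_smul_eq s' (π ^ N) y
    refine ⟨g - π • (s' * a), (restricted p π).sub_mem hg (smul_mem_restricted _
      ((restricted p π).mul_mem hs'r ha)), -z, ?_⟩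
    have h2 : π ^ (N + 1) • (-z) = -(π • (π ^ N • z)) := by rw [smul_neg, smul_smul, pow_succ']
    rw [hx', hy, mul_add, hz, h2, smul_add]
    abel

end SkewSeries

namespace AdmissibleModule

variable {A : Type w} [CommRing A] {R : Type u} [CommRing R] [Algebra A R] {D : FrobBase R}
  {E : AdmissibleModule A D} [CharP R D.p] [IsDomain R] [IsDiscreteValuationRing R]
  {ρ : A →+* SkewSeries D.p R}

theorem sum_eval_single {n : ℕ} (g : ℕ → SkewSeries D.p R) (B : D.NilAlg) (j : Fin (n + 1)) (y : B) :
    ∑ m : Fin (n + 1), (g m).eval ((Witt.single j y : D.Witt n B).coeff m) = (g j).eval y := by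
  rw [Finset.sum_eq_single j]
  · simp [Witt.single]
  · intro m _ hm
    simp only [Witt.single, if_neg hm, eval_zero_right]
  · simp

/-- The coordinates of a character and the equations that express its `A`-linearity. -/
theorem IsGivenBy.exists_of_mem_X (hρ : E.IsGivenBy ρ) (hπ : Irreducible D.π)
    [IsAdicComplete (IsLocalRing.maximalIdeal R) R] {n : ℕ}
    {Θ : ∀ B : D.NilAlg, D.Witt n B →+ B} (hΘ : Θ ∈ E.X n) :
    ∃ g : ℕ → SkewSeries D.p R, (∀ j, g j ∈ restricted D.p D.π) ∧
      (∀ (B : D.NilAlg) (x : D.Witt n B), Θ B x = ∑ j : Fin (n + 1), (g j).eval (x.coeff j)) ∧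
      ∀ b : A, ∀ j ≤ n, ∑ l ∈ Finset.range (n + 1 - j),
        g (j + l) * (D.wittSeries (ρ b) j l * tau (D.e * l)) = algebraMap A R b • g j := by
  have h1 : ∀ j : Fin (n + 1), ∃ f ∈ restricted D.p D.π, ∀ (B : D.NilAlg) (x : B),
      Θ B (Witt.single j x) = f.eval x := fun j => by
    refine exists_restricted_eq_eval hπ (fun B x => Θ B (Witt.single j x)) (fun B x y => ?_)
      (fun B C f x => ?_)
    · simp only [Witt.single_add, map_add]
    · rw [← hΘ.1, Witt.map_single]
  choose f hf hfe using h1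
  let g : ℕ → SkewSeries D.p R := fun j => if h : j < n + 1 then f ⟨j, h⟩ else 0
  have hgf : ∀ j : Fin (n + 1), g j = f j := fun j => dif_pos j.2
  have hg : ∀ j, g j ∈ restricted D.p D.π := by
    intro j
    by_cases h : j < n + 1
    · simp only [g, dif_pos h]; exact hf _
    · simp only [g, dif_neg h]; exact (restricted D.p D.π).zero_mem
  have hsum : ∀ (B : D.NilAlg) (x : D.Witt n B),
      Θ B x = ∑ j : Fin (n + 1), (g j).eval (x.coeff j) := by
    intro B x
    conv_lhs => rw [Witt.eq_sum_single x, map_sum]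
    exact Finset.sum_congr rfl fun j _ => by rw [hfe, hgf]
  refine ⟨g, hg, hsum, fun b j hj => ?_⟩
  have hw : ∀ l, D.wittSeries (ρ b) j l * tau (D.e * l) ∈ restricted D.p D.π := fun l =>
    (restricted D.p D.π).mul_mem (wittSeries_mem (hρ.mem b) j l) (tau_mem_restricted _)
  have hgw : ∀ l ∈ Finset.range (n + 1 - j),
      g (j + l) * (D.wittSeries (ρ b) j l * tau (D.e * l)) ∈ restricted D.p D.π := fun l _ =>
    (restricted D.p D.π).mul_mem (hg _) (hw l)
  refine eq_of_forall_eval_eq hπ ((restricted D.p D.π).sum_mem hgw)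
    (smul_mem_restricted _ (hg j)) fun B y => ?_
  let j' : Fin (n + 1) := ⟨j, Nat.lt_succ_of_le hj⟩
  have h2 := hΘ.2 b B (Witt.single j' y)
  rw [hsum, hsum, sum_eval_single, ← eval_smul _ _ B.nil (hg _)] at h2
  rw [← h2, eval_sum B.nil _ _ hgw]
  obtain ⟨h, hh⟩ : ∃ h : ℕ → B, h = fun m => (g m).eval
    ((D.wittSeries (ρ b) j (m - j) * tau (D.e * (m - j))).eval y) := ⟨_, rfl⟩
  have h3 : ∀ m : Fin (n + 1), (g m).eval ((E.act b (B.witt n) (Witt.single j' y)).coeff m) =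
      if (j' : ℕ) ≤ m then h m else 0 := by
    intro m
    rw [hh, hρ.coeff_act_single hπ.ne_zero]
    split_ifs
    · rfl
    · exact eval_zero_right _
  rw [Finset.sum_congr rfl fun m _ => h3 m, sum_fin_ge, hh]
  refine Finset.sum_congr rfl fun l _ => ?_
  simp only [j', Nat.add_sub_cancel_left]
  rw [eval_mul B.nil (hg _) (hw l)]

theorem eq_zero_of_sum_eval_eq_zero (hπ : Irreducible D.π)
    [IsAdicComplete (IsLocalRing.maximalIdeal R) R] {n : ℕ} {g : ℕ → SkewSeries D.p R}
    (h : ∀ (B : D.NilAlg) (x : D.Witt n B), ∑ j : Fin (n + 1), (g j).eval (x.coeff j) = 0)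
    {j : ℕ} (hj : j ≤ n) (hg : g j ∈ restricted D.p D.π) : g j = 0 := by
  refine eq_of_forall_eval_eq hπ hg (restricted D.p D.π).zero_mem fun B y => ?_
  have := h B (Witt.single ⟨j, Nat.lt_succ_of_le hj⟩ y)
  rw [sum_eval_single] at this
  rw [this, eval_zero]

theorem wittSeries_zero_zero (f : SkewSeries D.p R) : D.wittSeries f 0 0 = f := by
  ext i
  rw [wittSeries, coeff_mk, coord, if_pos rfl, zero_mul, pow_zero, mul_one]
  rfl

theorem coeff_zero_wittSeries_one_zero (f : SkewSeries D.p R) :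
    coeff 0 (D.wittSeries f 1 0) = D.φ (coeff 0 f) := by
  rw [wittSeries, coeff_mk, coord, if_pos rfl, pow_zero, Nat.sub_self, mul_zero, pow_zero, mul_one,
    Function.iterate_one]

/-- The action on the first ghost component, seen on the coordinate `x₁`. -/
theorem const_mul_wittSeries_one (f : SkewSeries D.p R) :
    const D.π * D.wittSeries f 1 0 = SkewSeries.map D.φ f * const D.π := by
  have h := sum_wittSeries (D := D) f 1 0
  rw [zero_add, Finset.sum_range_one] at h
  simpa [tau_zero] using h

/-- The action on the first ghost component, seen on the coordinate `x₀`. -/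
theorem tau_mul_add_wittSeries (f : SkewSeries D.p R) :
    tau D.e * f + const D.π * (D.wittSeries f 0 1 * tau D.e) = SkewSeries.map D.φ f * tau D.e := by
  have h := sum_wittSeries (D := D) f 0 1
  rw [Finset.sum_range_succ, Finset.sum_range_one] at h
  simpa [tau_zero, wittSeries_zero_zero] using h

variable [CharP (IsLocalRing.ResidueField R) D.p]

theorem IsGivenBy.X_zero_eq_bot (hρ : E.IsGivenBy ρ) (hπ : Irreducible D.π)
    [IsAdicComplete (IsLocalRing.maximalIdeal R) R] {t : A} (ht : algebraMap A R t = D.π)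
    (ht0 : reduce (ρ t) ≠ 0) : E.X 0 = ⊥ := by
  rw [Submodule.eq_bot_iff]
  intro Θ hΘ
  obtain ⟨g, hg, hsum, heq⟩ := hρ.exists_of_mem_X hπ hΘ
  have h := heq t 0 le_rfl
  rw [ht, Nat.sub_zero, zero_add, Finset.sum_range_one, mul_zero, tau_zero, mul_one,
    wittSeries_zero_zero] at h
  have h0 := eq_zero_of_mul_eq_uniformizer_smul hπ ht0 h
  funext B
  ext x
  rw [hsum]
  exact Finset.sum_eq_zero fun j _ => by
    obtain rfl : j = 0 := Fin.ext (by have := j.2; change (j : ℕ) = 0; omega)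
    have h1 : g ((0 : Fin (0 + 1)) : ℕ) = 0 := h0
    rw [h1, eval_zero]

/-- The equations of a character of order one at a uniformizer `t`. -/
theorem IsGivenBy.exists_of_mem_X_one (hρ : E.IsGivenBy ρ) (hπ : Irreducible D.π)
    [IsAdicComplete (IsLocalRing.maximalIdeal R) R] {t : A} (ht : algebraMap A R t = D.π)
    {Θ : ∀ B : D.NilAlg, D.Witt 1 B →+ B} (hΘ : Θ ∈ E.X 1) :
    ∃ g₀ ∈ restricted D.p D.π, ∃ g₁ ∈ restricted D.p D.π,
      (∀ (B : D.NilAlg) (x : D.Witt 1 B), Θ B x = g₀.eval (x.coeff 0) + g₁.eval (x.coeff 1)) ∧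
      g₁ * D.wittSeries (ρ t) 1 0 = D.π • g₁ ∧
      g₀ * ρ t + g₁ * (D.wittSeries (ρ t) 0 1 * tau D.e) = D.π • g₀ := by
  obtain ⟨g, hg, hsum, heq⟩ := hρ.exists_of_mem_X hπ hΘ
  refine ⟨g 0, hg 0, g 1, hg 1, fun B x => ?_, ?_, ?_⟩
  · rw [hsum, Fin.sum_univ_two]
    rfl
  · have h := heq t 1 le_rfl
    rw [ht, Nat.add_sub_cancel, Finset.sum_range_one] at h
    simpa [tau_zero] using h
  · have h := heq t 0 (Nat.zero_le _)
    rw [ht, Nat.sub_zero, Finset.sum_range_succ, Finset.sum_range_one] at h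
    simpa [tau_zero, wittSeries_zero_zero] using h

theorem eq_zero_of_mul_eq_of_coeff_zero (hπ : Irreducible D.π) {f x : SkewSeries D.p R}
    (hf : coeff 0 f = D.π) (hx : x * f = D.π • x) (h0 : coeff 0 x = 0) : x = 0 := by
  refine eq_zero_of_mul_eq_smul (f := f) (fun n hn => ?_) (by rw [hf, hx]) h0
  rw [hf]
  exact hπ.pow_ne_self (Nat.one_lt_pow hn D.p_prime.one_lt)

theorem IsGivenBy.coeff_zero_wittSeries (hρ : E.IsGivenBy ρ) {t : A}
    (ht : algebraMap A R t = D.π) : coeff 0 (D.wittSeries (ρ t) 1 0) = D.π := by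
  rw [coeff_zero_wittSeries_one_zero, hρ.coeff_zero, ht, D.φ_π]

/-- A character of order one is determined by the constant term of its second coordinate, so that
the characters of order one form an ideal of `R`. -/
theorem IsGivenBy.nonempty_equiv_or_X_one_eq_bot (hρ : E.IsGivenBy ρ) (hπ : Irreducible D.π)
    [IsAdicComplete (IsLocalRing.maximalIdeal R) R] {t : A} (ht : algebraMap A R t = D.π)
    (ht0 : reduce (ρ t) ≠ 0) : Nonempty (E.X 1 ≃ₗ[R] R) ∨ E.X 1 = ⊥ := by
  have h1 : ∀ Θ : E.X 1, ∃ g₀ ∈ restricted D.p D.π, ∃ g₁ ∈ restricted D.p D.π,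
      (∀ (B : D.NilAlg) (x : D.Witt 1 B), Θ.1 B x = g₀.eval (x.coeff 0) + g₁.eval (x.coeff 1)) ∧
      g₁ * D.wittSeries (ρ t) 1 0 = D.π • g₁ ∧
      g₀ * ρ t + g₁ * (D.wittSeries (ρ t) 0 1 * tau D.e) = D.π • g₀ :=
    fun Θ => hρ.exists_of_mem_X_one hπ ht Θ.2
  choose g₀ hg₀ g₁ hg₁ hsum heq₁ heq₀ using h1
  have hs : ∀ (Θ : E.X 1) (B : D.NilAlg) (y : B),
      (g₁ Θ).eval y = Θ.1 B (Witt.single 1 y) := by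
    intro Θ B y
    rw [hsum]
    simp [Witt.single, eval_zero_right]
  let F : E.X 1 →ₗ[R] R :=
    { toFun := fun Θ => coeff 0 (g₁ Θ)
      map_add' := fun Θ Ψ => by
        have : g₁ (Θ + Ψ) = g₁ Θ + g₁ Ψ := by
          refine eq_of_forall_eval_eq hπ (hg₁ _)
            ((restricted D.p D.π).add_mem (hg₁ _) (hg₁ _)) fun B y => ?_
          rw [eval_add B.nil (hg₁ _) (hg₁ _), hs, hs, hs]
          rfl
        rw [this, coeff_add]
      map_smul' := fun c Θ => by
        have : g₁ (c • Θ) = c • g₁ Θ := by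
          refine eq_of_forall_eval_eq hπ (hg₁ _) (smul_mem_restricted _ (hg₁ _)) fun B y => ?_
          rw [eval_smul c _ B.nil (hg₁ _), hs, hs, ← Algebra.smul_def]
          rfl
        rw [this, coeff_smul]
        rfl }
  have hF : Function.Injective F := by
    intro Θ Ψ hΘ
    have h0 : g₁ Θ = g₁ Ψ := by
      refine sub_eq_zero.mp (eq_zero_of_mul_eq_of_coeff_zero hπ (hρ.coeff_zero_wittSeries ht) ?_ ?_)
      · rw [sub_mul, heq₁, heq₁, smul_sub]
      · rw [SkewSeries.coeff_sub]
        exact sub_eq_zero.mpr hΘ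
    have h2 : (g₀ Θ - g₀ Ψ) * ρ t = D.π • (g₀ Θ - g₀ Ψ) := by
      rw [smul_sub, ← heq₀, ← heq₀, h0, sub_mul]
      abel
    have h3 := sub_eq_zero.mp (eq_zero_of_mul_eq_uniformizer_smul hπ ht0 h2)
    apply Subtype.ext
    funext B
    ext x
    rw [hsum, hsum, h0, h3]
  by_cases hbot : E.X 1 = ⊥
  · exact Or.inr hbot
  left
  obtain ⟨Θ, hΘ, hne⟩ := Submodule.exists_mem_ne_zero_of_ne_bot hbot
  have e1 := LinearEquiv.ofInjective F hF
  obtain ⟨a, ha⟩ := (IsPrincipalIdealRing.principal (LinearMap.range F)).principal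
  have ha0 : a ≠ 0 := by
    rintro rfl
    have h3 : F ⟨Θ, hΘ⟩ ∈ LinearMap.range F := ⟨_, rfl⟩
    rw [ha, Ideal.submodule_span_eq, Ideal.span_singleton_zero, Ideal.mem_bot] at h3
    have := hF (h3.trans (map_zero F).symm)
    exact hne (congrArg Subtype.val this)
  rw [ha] at e1
  exact ⟨e1.trans (LinearEquiv.toSpanNonzeroSingleton R R a ha0).symm⟩

end AdmissibleModule

namespace AdmissibleModule

variable {A : Type w} [CommRing A] {R : Type u} [CommRing R] [Algebra A R] {D : FrobBase R}
  {E : AdmissibleModule A D} [CharP R D.p] [IsDomain R] [IsDiscreteValuationRing R]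
  {ρ : A →+* SkewSeries D.p R}

/-- A lift of Frobenius on `E` is given by a series `τ ^ e + π h` which intertwines the action on `E`
with the action on its twist by `φ`. -/
theorem IsGivenBy.hasFrobeniusLift_iff (hρ : E.IsGivenBy ρ) (hπ : Irreducible D.π)
    [IsAdicComplete (IsLocalRing.maximalIdeal R) R] :
    E.HasFrobeniusLift ↔ ∃ h ∈ restricted D.p D.π, ∀ b : A,
      (tau D.e + D.π • h) * ρ b = SkewSeries.map D.φ (ρ b) * (tau D.e + D.π • h) := by
  have hφρ : ∀ b, SkewSeries.map D.φ (ρ b) ∈ restricted D.p D.π :=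
    fun b => map_mem_restricted D.φ_π (hρ.mem b)
  have htwist : ∀ (B : D.NilAlg) (b : A) (y : B),
      E.act b B.twist y = (SkewSeries.map D.φ (ρ b)).eval y := fun B b y => hρ.act_eq b B.twist y
  constructor
  · rintro ⟨ψ, hnat, hlin, hfrob⟩
    obtain ⟨P, hP, hPe⟩ := exists_restricted_eq_eval hπ (fun B x => (ψ B x : B))
      (fun B x y => (ψ B).map_add x y) hnat
    have h1 : ∀ i, D.π ∣ coeff i (P - tau D.e) := by
      intro i
      have h2 := dvd_coeff_of_eval_eq hP (tau_mem_restricted D.e) 1 ((hPe _ _).symm.trans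
        ((hfrob _ ((pow_one _).symm.trans (modAlg_π_pow (D := D) (Polynomial R) 1)) _).trans
          (eval_tau _ _).symm)) i
      rwa [pow_one] at h2
    obtain ⟨h, hh⟩ := exists_eq_smul_of_dvd h1
    have hPh : P = tau D.e + D.π • h := by rw [← hh, add_sub_cancel]
    refine ⟨h, mem_restricted_of_smul hπ.ne_zero 1 (by rw [pow_one])
      (by rw [← hh]; exact (restricted D.p D.π).sub_mem hP (tau_mem_restricted _)), fun b => ?_⟩
    rw [← hPh]
    refine eq_of_forall_eval_eq hπ ((restricted D.p D.π).mul_mem hP (hρ.mem b))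
      ((restricted D.p D.π).mul_mem (hφρ b) hP) fun B x => ?_
    rw [eval_mul B.nil hP (hρ.mem b), eval_mul B.nil (hφρ b) hP, ← hPe, ← hPe, ← hρ.act_eq]
    exact (hlin b B x).trans (htwist B b _)
  · rintro ⟨h, hh, hcomm⟩
    have hπh : D.π • h ∈ restricted D.p D.π := smul_mem_restricted _ hh
    have hP : tau D.e + D.π • h ∈ restricted D.p D.π :=
      (restricted D.p D.π).add_mem (tau_mem_restricted _) hπh
    refine ⟨fun B => evalHom B.nil hP, fun B C f x => (map_eval B.nil hP f x).symm,
      fun b B x => ?_, fun B hB x => ?_⟩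
    · rw [htwist]
      change (tau D.e + D.π • h).eval (E.act b B x) =
        (SkewSeries.map D.φ (ρ b)).eval ((tau D.e + D.π • h).eval x)
      rw [hρ.act_eq, ← eval_mul B.nil hP (hρ.mem b), ← eval_mul B.nil (hφρ b) hP, hcomm]
    · change (tau D.e + D.π • h).eval x = _
      rw [eval_add B.nil (tau_mem_restricted _) hπh, eval_smul _ _ B.nil hh, hB, zero_mul,
        add_zero, eval_tau]
      rfl

variable {K : Type u} [Field K] [Algebra R K] [IsFractionRing R K] [CharP K D.p]

variable (K D ρ) in
/-- The logarithm, with respect to a uniformizer `t`, of the twist of `E` by `φ ^ m`. -/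
noncomputable def twistLog (t : A) (m : ℕ) : SkewSeries D.p K :=
  logSeries K (SkewSeries.map (D.φ ^ m) (ρ t))

theorem pow_φ_algebraMap (hφ : ∀ a : A, D.φ (algebraMap A R a) = algebraMap A R a) (m : ℕ) (a : A) :
    (D.φ ^ m) (algebraMap A R a) = algebraMap A R a := by
  induction m with
  | zero => rfl
  | succ m ih => rw [pow_succ', RingHom.mul_def, RingHom.comp_apply, ih, hφ]

theorem IsGivenBy.coeff_zero_map (hρ : E.IsGivenBy ρ)
    (hφ : ∀ a : A, D.φ (algebraMap A R a) = algebraMap A R a) (m : ℕ) (a : A) :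
    coeff 0 (SkewSeries.map (D.φ ^ m) (ρ a)) = algebraMap A R a := by
  rw [SkewSeries.coeff_map, hρ.coeff_zero, pow_φ_algebraMap hφ]

theorem IsGivenBy.twistLog_mul (hρ : E.IsGivenBy ρ) (hπ : Irreducible D.π) {t : A}
    (ht : algebraMap A R t = D.π) (hφ : ∀ a : A, D.φ (algebraMap A R a) = algebraMap A R a)
    (m : ℕ) (b : A) : twistLog D ρ K t m * toFrac K (SkewSeries.map (D.φ ^ m) (ρ b)) =
      algebraMap R K (algebraMap A R b) • twistLog D ρ K t m := by
  rw [twistLog, logSeries_mul_of_commute hπ _ (by rw [hρ.coeff_zero_map hφ, ht]),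
    hρ.coeff_zero_map hφ]
  rw [← _root_.map_mul, ← _root_.map_mul, ← _root_.map_mul, ← _root_.map_mul, mul_comm]

theorem twistLog_ne_zero (t : A) (m : ℕ) : twistLog D ρ K t m ≠ 0 := by
  intro h
  have := coeff_zero_logSeries (K := K) (SkewSeries.map (D.φ ^ m) (ρ t))
  rw [twistLog] at h
  rw [h, SkewSeries.coeff_zero] at this
  exact zero_ne_one this

theorem algebraMap_π_ne_zero (hπ : Irreducible D.π) : algebraMap R K D.π ≠ 0 := by
  rw [Ne, map_eq_zero_iff _ (IsFractionRing.injective R K)]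
  exact hπ.ne_zero

/-- A lift of Frobenius `τ ^ e + π h` yields a character of order one, whose second coordinate is the
logarithm of the twist, conjugated by `π`. -/
theorem IsGivenBy.X_one_ne_bot (hρ : E.IsGivenBy ρ) (hπ : Irreducible D.π)
    [IsAdicComplete (IsLocalRing.maximalIdeal R) R] {t : A} (ht : algebraMap A R t = D.π)
    (hφ : ∀ a : A, D.φ (algebraMap A R a) = algebraMap A R a) (h : E.HasFrobeniusLift) :
    E.X 1 ≠ ⊥ := by
  let K := FractionRing R
  have : CharP K D.p := charP_of_algebra R
  obtain ⟨h, hh, hcomm⟩ := (hρ.hasFrobeniusLift_iff hπ).mp h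
  obtain ⟨s, hs, hs1, hs0, -⟩ := exists_conj_logSeries (K := K) hπ (SkewSeries.map (D.φ ^ 1) (ρ t))
    (by rw [hρ.coeff_zero_map hφ, ht])
  rw [← twistLog] at hs1
  have hπK := algebraMap_π_ne_zero (K := K) hπ
  have hL := hρ.twistLog_mul (K := K) hπ ht hφ
  set L := twistLog D ρ K t with hLdef
  -- the logarithm of the twist pulled back along the lift is a multiple of the logarithm
  have h1 : L 1 * toFrac K (tau D.e + D.π • h) =
      coeff 0 (L 1 * toFrac K (tau D.e + D.π • h)) • L 0 := by
    refine eq_smul_logSeries hπ (SkewSeries.map (D.φ ^ 0) (ρ t))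
      (by rw [hρ.coeff_zero_map hφ, ht]) ?_
    have h2 : SkewSeries.map (D.φ ^ 0) (ρ t) = ρ t := SkewSeries.ext fun i => rfl
    have h3 := hL 1 t
    rw [pow_one] at h3
    rw [h2, mul_assoc, ← _root_.map_mul, hcomm, _root_.map_mul, ← mul_assoc, h3, smul_mul, ht]
  set y := coeff 0 (L 1 * toFrac K (tau D.e + D.π • h))
  have h4 : L 1 * toFrac K (D.π • h) = algebraMap R K D.π • toFrac K (s * h) := by
    rw [← const_mul, _root_.map_mul, ← mul_assoc, ← hs1, smul_mul, ← _root_.map_mul]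
  rw [map_add, mul_add, h4] at h1
  obtain ⟨Θ, hΘ, hΘe⟩ := hρ.exists_mem_X hπ.ne_zero hL 1
    (fun m => if m = 0 then -(algebraMap R K D.π)⁻¹ * y else (algebraMap R K D.π)⁻¹)
    (fun j => if j = 0 then -(s * h) else s) (fun j _ => by
      split_ifs
      · exact (restricted D.p D.π).neg_mem ((restricted D.p D.π).mul_mem hs hh)
      · exact hs) (fun j hj => by
      interval_cases j
      · simp only [Nat.sub_zero, Finset.sum_range_succ, Finset.sum_range_zero, pow_zero,
          _root_.map_one, one_mul, mul_zero, tau_zero, mul_one, zero_add,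
          if_true, one_ne_zero, if_false]
        rw [eq_comm, ← sub_eq_iff_eq_add] at h1
        rw [← h1, map_neg, neg_mul, neg_smul, smul_sub, smul_smul, smul_smul, inv_mul_cancel₀ hπK,
          one_smul]
        abel
      · simp only [Nat.add_sub_cancel, Finset.sum_range_succ, Finset.sum_range_zero, pow_one,
          mul_zero, tau_zero, mul_one, zero_add, one_ne_zero, if_false, add_zero]
        rw [← hs1, smul_smul, inv_mul_cancel₀ hπK, one_smul])
  rw [Submodule.ne_bot_iff]
  refine ⟨Θ, hΘ, fun h0 => ?_⟩
  have h5 := eq_zero_of_sum_eval_eq_zero hπ (n := 1) (g := fun j => if j = 0 then -(s * h) else s)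
    (fun B x => by rw [← hΘe, h0]; rfl) (j := 1) le_rfl hs
  simp only [one_ne_zero, if_false] at h5
  rw [h5, SkewSeries.coeff_zero] at hs0
  exact zero_ne_one hs0

variable [CharP (IsLocalRing.ResidueField R) D.p]

/-- If the logarithm of the twist, conjugated by `π`, is a series `s` that is congruent to `1` modulo `π`,
then a nonzero character of order one gives back a lift of Frobenius. -/
theorem IsGivenBy.hasFrobeniusLift (hρ : E.IsGivenBy ρ) (hπ : Irreducible D.π)
    [IsAdicComplete (IsLocalRing.maximalIdeal R) R] {t : A} (ht : algebraMap A R t = D.π)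
    (hφ : ∀ a : A, D.φ (algebraMap A R a) = algebraMap A R a) (ht0 : reduce (ρ t) ≠ 0)
    {s : SkewSeries D.p R} (hs : s ∈ restricted D.p D.π)
    (hs1 : algebraMap R K D.π • toFrac K s = twistLog D ρ K t 1 * toFrac K (const D.π))
    (hs0 : coeff 0 s = 1) (hsr : reduce s = 1) (h : E.X 1 ≠ ⊥) : E.HasFrobeniusLift := by
  have hπK := algebraMap_π_ne_zero (K := K) hπ
  have hL := hρ.twistLog_mul (K := K) hπ ht hφ
  set L := twistLog D ρ K t with hLdef
  have hL1 := fun b => pow_one D.φ ▸ hL 1 b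
  set V := D.wittSeries (ρ t) 0 1 * tau D.e with hV
  have hsW : s * D.wittSeries (ρ t) 1 0 = D.π • s := by
    apply toFrac_injective (K := K)
    refine smul_left_injective hπK ?_
    rw [_root_.map_mul, ← smul_mul, hs1, mul_assoc, ← _root_.map_mul, const_mul_wittSeries_one,
      _root_.map_mul, ← mul_assoc, hL1, smul_mul, ← hs1, SkewSeries.map_smul, ht]
  -- the second coordinate is a multiple of `s`; dividing by powers of `π` makes it equal to `s`
  have key : ∃ g ∈ restricted D.p D.π, g * ρ t + s * V = D.π • g := by
    obtain ⟨Θ, hΘ, hne⟩ := (Submodule.ne_bot_iff _).mp h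
    obtain ⟨g₀, hg₀, g₁, hg₁, hsum, h1, h0⟩ := hρ.exists_of_mem_X_one hπ ht hΘ
    have hc : g₁ = coeff 0 g₁ • s := by
      refine sub_eq_zero.mp (eq_zero_of_mul_eq_of_coeff_zero hπ (hρ.coeff_zero_wittSeries ht) ?_ ?_)
      · rw [sub_mul, smul_mul, hsW, h1, smul_sub, smul_comm]
      · rw [SkewSeries.coeff_sub, SkewSeries.coeff_smul, hs0, smul_eq_mul, mul_one, sub_self]
    have hc0 : coeff 0 g₁ ≠ 0 := by
      intro hc0
      rw [hc0, zero_smul] at hc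
      rw [hc, zero_mul, add_zero] at h0
      have := eq_zero_of_mul_eq_uniformizer_smul hπ ht0 h0
      apply hne
      funext B
      ext x
      rw [hsum, this, hc, eval_zero, eval_zero, add_zero]
      rfl
    rw [hc, smul_mul, ← hV] at h0
    obtain ⟨n, u, hu⟩ := IsDiscreteValuationRing.eq_unit_mul_pow_irreducible hc0 hπ
    rw [hu] at h0
    clear hu hc hc0 hsum hne h1
    induction n generalizing g₀ with
    | zero =>
      rw [pow_zero, mul_one] at h0
      refine ⟨(↑u⁻¹ : R) • g₀, smul_mem_restricted _ hg₀, ?_⟩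
      rw [smul_comm D.π, ← h0, smul_add, smul_smul, Units.inv_mul, one_smul, smul_mul]
    | succ n ih =>
      have h2 : g₀ * ρ t = D.π • (g₀ - (u * D.π ^ n) • (s * V)) := by
        rw [smul_sub, smul_smul, ← h0, pow_succ]
        rw [show (u : R) * (D.π ^ n * D.π) = D.π * (u * D.π ^ n) by ring]
        abel
      obtain ⟨y, rfl⟩ := exists_eq_smul_of_mul hπ ht0 h2
      refine ih y (mem_restricted_of_smul hπ.ne_zero 1 (by rw [pow_one]) hg₀) ?_
      refine smul_left_injective hπ.ne_zero ?_
      rw [← h0, smul_add, smul_smul, smul_mul]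
      congr 2
      ring
  obtain ⟨g, hg, hgeq⟩ := key
  -- then `τ ^ e + π x` with `s x = - g` is the lift
  obtain ⟨x, hx, hsx⟩ := exists_restricted_mul_eq hπ hs hs0 hsr ((restricted D.p D.π).neg_mem hg)
  refine (hρ.hasFrobeniusLift_iff hπ).mpr ⟨x, hx, fun b => ?_⟩
  have h1 : L 1 * toFrac K (tau D.e + D.π • x) =
      L 1 * toFrac K (tau D.e : SkewSeries D.p R) - algebraMap R K D.π • toFrac K g := by
    rw [map_add, mul_add, ← const_mul, _root_.map_mul, ← mul_assoc, ← hs1, smul_mul,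
      ← _root_.map_mul, hsx, map_neg, smul_neg, sub_eq_add_neg]
  have h2 : L 1 * toFrac K (tau D.e : SkewSeries D.p R) * toFrac K (ρ t) + algebraMap R K D.π • toFrac K (s * V) =
      algebraMap R K D.π • (L 1 * toFrac K (tau D.e : SkewSeries D.p R)) := by
    have h3 := congrArg (fun z => L 1 * toFrac K z) (tau_mul_add_wittSeries (D := D) (ρ t))
    simp only [map_add, _root_.map_mul, mul_add] at h3
    rw [← mul_assoc (L 1) (toFrac K (SkewSeries.map D.φ (ρ t))), hL1, smul_mul, ht] at h3
    rw [← h3, hV, _root_.map_mul, ← smul_mul, hs1, _root_.map_mul]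
    simp only [mul_assoc]
  have h4 : L 1 * toFrac K (tau D.e + D.π • x) * toFrac K (ρ t) =
      algebraMap R K D.π • (L 1 * toFrac K (tau D.e + D.π • x)) := by
    have h5 := congrArg (fun z => algebraMap R K D.π • toFrac K z) hgeq
    simp only [map_add, _root_.map_mul, SkewSeries.map_smul, smul_add] at h5
    rw [h1, sub_mul, smul_mul, smul_sub, ← h2, ← h5, _root_.map_mul]
    abel
  have h6 := eq_smul_logSeries hπ (ρ t) (by rw [hρ.coeff_zero, ht]) h4
  have h7 : logSeries K (ρ t) * toFrac K (ρ b) =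
      algebraMap R K (algebraMap A R b) • logSeries K (ρ t) := hL 0 b
  apply toFrac_injective (K := K)
  refine mul_left_cancel₀ (twistLog_ne_zero (K := K) (D := D) (ρ := ρ) t 1) ?_
  rw [← hLdef, _root_.map_mul, _root_.map_mul, ← mul_assoc, ← mul_assoc, hL1, smul_mul, h6,
    smul_mul, h7, smul_comm]

/-- A logarithm, conjugated by `π`, is congruent to `1` modulo `π` if its linear term is divisible by `π`:
the exponents `p ^ i - 1 - i` are positive for `i ≥ 2`. -/
theorem reduce_eq_one {f : SkewSeries D.p R} {s : SkewSeries D.p R} (hs0 : coeff 0 s = 1)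
    (hs : ∀ i, ∃ r : R, algebraMap R K r = algebraMap R K D.π ^ i * coeff i (logSeries K f) ∧
        coeff i s = D.π ^ (D.p ^ i - 1 - i) * r) (hπ : Irreducible D.π)
    (h1 : D.π ∣ coeff 1 s) : reduce s = 1 := by
  ext i
  rw [SkewSeries.coeff_map, SkewSeries.coeff_one]
  split_ifs with hi
  · rw [hi, hs0, _root_.map_one]
  · rw [residue_eq_zero_iff_dvd hπ]
    rcases eq_or_ne i 1 with rfl | hi1
    · exact h1
    obtain ⟨r, -, hr⟩ := hs i
    rw [hr]
    refine Dvd.dvd.mul_right (dvd_pow_self _ ?_) _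
    have h2 : 2 ^ i ≤ D.p ^ i := Nat.pow_le_pow_left D.p_prime.two_le _
    have h3 : i + 2 ≤ 2 ^ i := by
      obtain ⟨j, rfl⟩ : ∃ j, i = j + 2 := ⟨i - 2, by omega⟩
      have : j < 2 ^ j := Nat.lt_two_pow_self
      rw [pow_add]
      omega
    omega

/-- For characters of order one to come from lifts of Frobenius, it suffices that `p` is odd or that
the constant field, whose elements act linearly on the reduction of `E`, is larger than `𝔽_p`. -/
theorem IsGivenBy.hasFrobeniusLift_of_X_one_ne_bot (hρ : E.IsGivenBy ρ) (hπ : Irreducible D.π)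
    [IsAdicComplete (IsLocalRing.maximalIdeal R) R] {t : A} (ht : algebraMap A R t = D.π)
    (hφ : ∀ a : A, D.φ (algebraMap A R a) = algebraMap A R a) (ht0 : reduce (ρ t) ≠ 0)
    (hp : 3 ≤ D.p ∨ ∃ c : A, IsUnit (algebraMap A R (c - c ^ D.p)) ∧ D.π ∣ coeff 1 (ρ c))
    (h : E.X 1 ≠ ⊥) : E.HasFrobeniusLift := by
  let K := FractionRing R
  have : CharP K D.p := charP_of_algebra R
  obtain ⟨s, hs, hs1, hs0, hsr⟩ := exists_conj_logSeries (K := K) hπ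
    (SkewSeries.map (D.φ ^ 1) (ρ t)) (by rw [hρ.coeff_zero_map hφ, ht])
  refine hρ.hasFrobeniusLift (K := K) hπ ht hφ ht0 hs hs1 hs0 (reduce_eq_one hs0 hsr hπ ?_) h
  obtain ⟨r, hr, hr'⟩ := hsr 1
  rw [hr']
  rcases hp with hp | ⟨c, hc, hc1⟩
  · exact Dvd.dvd.mul_right (dvd_pow_self _ (by rw [pow_one]; omega)) _
  · refine Dvd.dvd.mul_left ?_ _
    -- the linear term of `log ∘ c = c log`
    have h1 := congrArg (coeff 1) (hρ.twistLog_mul (K := K) hπ ht hφ 1 c)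
    rw [SkewSeries.coeff_mul, Finset.Nat.sum_antidiagonal_eq_sum_range_succ_mk,
      Finset.sum_range_succ, Finset.sum_range_one, SkewSeries.coeff_smul] at h1
    simp only [SkewSeries.coeff_map, Nat.sub_zero, Nat.sub_self, pow_zero, pow_one, twistLog,
      coeff_zero_logSeries, one_mul, hρ.coeff_zero, hφ, smul_eq_mul] at h1
    have h2 : D.φ (coeff 1 (ρ c)) * D.π = r * algebraMap A R (c - c ^ D.p) := by
      apply IsFractionRing.injective R K
      rw [_root_.map_mul, _root_.map_mul, hr, pow_one, map_sub, map_sub, map_pow, map_pow, mul_comm,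
        pow_one]
      linear_combination algebraMap R K D.π * h1
    rw [← hc.dvd_mul_right, ← h2]
    exact dvd_mul_left _ _

end AdmissibleModule

end

/-! ### Algebras with a degree function -/

/-- `d` behaves like the pole order at a rational point on the ring of functions which are regular
away from that point: it is additive on products, the elements of given degree are proportional up to
lower terms, and every large integer is a degree.  (The value of `d` at `0` is irrelevant.) -/
structure IsDegree (k : Type*) {A : Type*} [Field k] [CommRing A] [Algebra k A] (d : A → ℕ) : Prop where
  map_mul : ∀ a b : A, a ≠ 0 → b ≠ 0 → d (a * b) = d a + d b
  exists_sub : ∀ a b : A, a ≠ 0 → b ≠ 0 → d a = d b → ∃ c : k, a - c • b = 0 ∨ d (a - c • b) < d a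
  exists_eq : ∃ N, ∀ n, N ≤ n → ∃ b : A, b ≠ 0 ∧ d b = n

namespace IsDegree

variable {k A : Type*} [Field k] [CommRing A] [Algebra k A] {d : A → ℕ}

/-- Induction on the degree. -/
theorem induction {P : A → Prop} (h0 : P 0)
    (h : ∀ a, a ≠ 0 → (∀ b, b = 0 ∨ d b < d a → P b) → P a) (a : A) : P a := by
  by_cases ha : a = 0
  · rwa [ha]
  induction hn : d a using Nat.strong_induction_on generalizing a with
  | _ n ih =>
    refine h a ha fun b hb => ?_
    by_cases hb0 : b = 0
    · rwa [hb0]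
    · exact ih _ (hn ▸ hb.resolve_left hb0) b hb0 rfl

/-- A spanning family with at most one nonzero member in each degree. -/
theorem exists_family (hd : IsDegree k d) : ∃ β : ℕ → A, (∀ n, β n ≠ 0 → d (β n) = n) ∧
    (∀ a, a ≠ 0 → β (d a) ≠ 0) ∧ ∀ n, ∀ a, (a = 0 ∨ d a < n) →
      a ∈ Submodule.span k (β '' Set.Iio n) := by
  classical
  let β : ℕ → A := fun n => if h : ∃ b : A, b ≠ 0 ∧ d b = n then h.choose else 0
  have h1 : ∀ a, a ≠ 0 → β (d a) ≠ 0 ∧ d (β (d a)) = d a := fun a ha => by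
    have h : ∃ b : A, b ≠ 0 ∧ d b = d a := ⟨a, ha, rfl⟩
    simp only [β, dif_pos h]
    exact h.choose_spec
  refine ⟨β, fun n hn => ?_, fun a ha => (h1 a ha).1, fun n a => ?_⟩
  · by_cases h : ∃ b : A, b ≠ 0 ∧ d b = n
    · obtain ⟨b, hb, rfl⟩ := h
      exact (h1 b hb).2
    · simp only [β, dif_neg h] at hn
      exact absurd rfl hn
  · induction a using IsDegree.induction (d := d) with
    | h0 => exact fun _ => zero_mem _
    | h a ha ih =>
      intro hn
      have hn := hn.resolve_left ha
      obtain ⟨c, hc⟩ := hd.exists_sub a (β (d a)) ha (h1 a ha).1 (h1 a ha).2.symm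
      have := ih _ hc (hc.imp_right fun h => h.trans hn)
      rw [← sub_add_cancel a (c • β (d a))]
      exact add_mem this (Submodule.smul_mem _ _ (Submodule.subset_span ⟨d a, hn, rfl⟩))

theorem finiteType [IsDomain A] (hd : IsDegree k d) : Algebra.FiniteType k A := by
  obtain ⟨β, -, -, hβs⟩ := hd.exists_family
  obtain ⟨N, hN⟩ := hd.exists_eq
  refine ⟨⟨((Set.finite_Iio (2 * N + 2)).image β).toFinset, ?_⟩⟩
  rw [Set.Finite.coe_toFinset, eq_top_iff]
  rintro a -
  set S := Algebra.adjoin k (β '' Set.Iio (2 * N + 2))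
  obtain ⟨b, hb0, hb⟩ := hN (N + 1) (Nat.le_succ N)
  have hspan : ∀ n a, n ≤ 2 * N + 2 → (a = 0 ∨ d a < n) → a ∈ S := fun n a hn ha =>
    Algebra.span_le_adjoin k _ (Submodule.span_mono (Set.image_mono (Set.Iio_subset_Iio hn))
      (hβs n a ha))
  induction a using IsDegree.induction (d := d) with
  | h0 => exact zero_mem _
  | h a ha ih =>
    rcases lt_or_ge (d a) (2 * N + 2) with h | h
    · exact hspan _ a le_rfl (Or.inr h)
    · -- an element of large degree is proportional to a multiple of `b` up to lower terms
      obtain ⟨x, hx0, hx⟩ := hN (d a - (N + 1)) (by omega)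
      have hbx : d (b * x) = d a := by rw [hd.map_mul b x hb0 hx0, hb, hx]; omega
      obtain ⟨c, hc⟩ := hd.exists_sub a (b * x) ha (mul_ne_zero hb0 hx0) hbx.symm
      rw [← sub_add_cancel a (c • (b * x))]
      exact add_mem (ih _ hc) (Subalgebra.smul_mem _ (mul_mem (hspan (N + 2) b (by omega)
        (Or.inr (by omega))) (ih x (Or.inr (by omega)))) _)

/-- Residue rings are finite, since every class has a representative of bounded degree. -/
theorem finite_quotient [IsDomain A] [Finite k] (hd : IsDegree k d) {I : Ideal A} (hI : I ≠ ⊥) :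
    Finite (A ⧸ I) := by
  obtain ⟨β, -, -, hβs⟩ := hd.exists_family
  obtain ⟨N, hN⟩ := hd.exists_eq
  obtain ⟨b, hbI, hb0⟩ := Submodule.exists_mem_ne_zero_of_ne_bot hI
  let W := Submodule.span k (β '' Set.Iio (N + d b))
  have : Module.Finite k W := .span_of_finite k ((Set.finite_Iio _).image β)
  have : Finite W := Module.finite_of_finite k
  refine Finite.of_surjective (fun w : W => Ideal.Quotient.mk I w) fun x => ?_
  obtain ⟨a, rfl⟩ := Ideal.Quotient.mk_surjective x
  induction a using IsDegree.induction (d := d) with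
  | h0 => exact ⟨0, rfl⟩
  | h a ha ih =>
    rcases lt_or_ge (d a) (N + d b) with h | h
    · exact ⟨⟨a, hβs _ a (Or.inr h)⟩, rfl⟩
    · obtain ⟨x, hx0, hx⟩ := hN (d a - d b) (by omega)
      have hbx : d (b * x) = d a := by rw [hd.map_mul b x hb0 hx0, hx]; omega
      obtain ⟨c, hc⟩ := hd.exists_sub a (b * x) ha (mul_ne_zero hb0 hx0) hbx.symm
      obtain ⟨w, hw⟩ := ih _ hc
      refine ⟨w, hw.trans ?_⟩
      rw [Ideal.Quotient.eq, sub_sub_cancel_left, neg_mem_iff, ← mul_smul_comm]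
      exact I.mul_mem_right _ hbI

theorem dimensionLEOne [IsDomain A] [Finite k] (hd : IsDegree k d) : Ring.DimensionLEOne A :=
  ⟨fun {P} hP hP' => by
    have := hd.finite_quotient hP
    exact Ideal.Quotient.maximal_of_isField P (Finite.isField_of_domain _)⟩

/-- In an integrally closed ring with a degree function, an element `t` of a prime `P` which is not
in `P ^ 2` generates `P` locally at `P`. -/
theorem exists_mul_mem_span [IsDomain A] [Finite k] [IsIntegrallyClosed A] (hd : IsDegree k d)
    {P : Ideal A} [P.IsPrime] {t : A} (ht : t ∈ P) (ht2 : t ∉ P ^ 2) :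
    ∃ a, a ∉ P ∧ ∀ b ∈ P, t ∣ a * b := by
  have := hd.finiteType
  have : IsNoetherianRing A := Algebra.FiniteType.isNoetherianRing k A
  have := hd.dimensionLEOne
  have : IsDedekindDomain A := { }
  obtain ⟨J, hJ⟩ := Ideal.dvd_span_singleton.mpr ht
  have hJP : ¬ J ≤ P := by
    intro h
    refine ht2 ?_
    have h1 : t ∈ P * J := by rw [← hJ]; exact Ideal.mem_span_singleton_self t
    rw [pow_two]
    exact Ideal.mul_mono_right h h1
  obtain ⟨a, haJ, haP⟩ := Set.not_subset.mp hJP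
  refine ⟨a, haP, fun b hb => ?_⟩
  rw [← Ideal.mem_span_singleton, hJ, mul_comm]
  exact Ideal.mul_mem_mul haJ hb

end IsDegree

/-! ### The ring of functions regular away from a rational point -/

section Curve

variable {Fq : Type v} {F : Type w} [Field Fq] [Finite Fq] [Field F] [Algebra Fq F]

theorem Valuation.map_algebraMap_of_finite {Γ : Type*} [LinearOrderedCommGroupWithZero Γ]
    (v : Valuation F Γ) {c : Fq} (hc : c ≠ 0) : v (algebraMap Fq F c) = 1 := by
  have := Fintype.ofFinite Fq
  have h1 : v (algebraMap Fq F c) ^ (Fintype.card Fq - 1) = 1 := by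
    rw [← map_pow, ← map_pow, FiniteField.pow_card_sub_one_eq_one c hc, map_one, map_one]
  refine (pow_eq_one_iff_of_nonneg zero_le ?_).mp h1
  have := Fintype.one_lt_card (α := Fq)
  omega

theorem ValuationSubring.algebraMap_mem_of_finite (V : ValuationSubring F) (c : Fq) :
    algebraMap Fq F c ∈ V := by
  by_cases hc : c = 0
  · rw [hc, map_zero]
    exact V.zero_mem
  · rw [← V.valuation_le_one_iff, V.valuation.map_algebraMap_of_finite hc]

theorem ValuationSubring.mem_of_isIntegral (V : ValuationSubring F) {S : Type*} [CommRing S]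
    [Algebra S F] (hS : ∀ s : S, algebraMap S F s ∈ V) {x : F} (hx : IsIntegral S x) : x ∈ V := by
  let f : S →+* V := (algebraMap S F).codRestrict V.toSubring hS
  have h1 : IsIntegral V x := by
    obtain ⟨P, hP, hPx⟩ := hx
    refine ⟨P.map f, hP.map f, ?_⟩
    rw [Polynomial.eval₂_map]
    exact hPx
  obtain ⟨y, rfl⟩ := (IsIntegrallyClosed.isIntegral_iff (R := V)).mp h1
  exact y.2

variable {vinf : Valuation F (WithZero (Multiplicative ℤ))}

theorem mem_regularRing {x : F} :
    x ∈ regularRing vinf ↔ ∀ V : ValuationSubring F, V ≠ vinf.valuationSubring → x ∈ V := by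
  simp only [regularRing, Subring.mem_iInf]
  rfl

/-- The constants are regular everywhere. -/
noncomputable instance regularRing.algebra : Algebra Fq (regularRing vinf) :=
  ((algebraMap Fq F).codRestrict (regularRing vinf) fun c =>
    mem_regularRing.mpr fun V _ => V.algebraMap_mem_of_finite c).toAlgebra

theorem regularRing.coe_smul (c : Fq) (a : regularRing vinf) :
    ((c • a : regularRing vinf) : F) = algebraMap Fq F c * a := by
  rw [Algebra.smul_def]
  rfl

theorem mem_regularRing_of_isIntegral {S : Type*} [CommRing S] [Algebra S F]
    (hS : ∀ s : S, algebraMap S F s ∈ regularRing vinf) {x : F} (hx : IsIntegral S x) :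
    x ∈ regularRing vinf :=
  mem_regularRing.mpr fun V hV => V.mem_of_isIntegral (fun s => mem_regularRing.mp (hS s) V hV) hx

theorem transcendental_of_one_lt {x : F} (hx : 1 < vinf x) : Transcendental Fq x := by
  intro h
  have h1 := vinf.valuationSubring.mem_of_isIntegral
    (fun c => vinf.valuationSubring.algebraMap_mem_of_finite c) h.isIntegral
  exact not_lt.mpr (vinf.mem_valuationSubring_iff x |>.mp h1) hx

/-- Every element of `F` is a quotient of regular functions; the denominator can be taken in the ring
generated by any nonconstant function. -/
theorem exists_mul_mem_regularRing (hF : IsFunctionFieldOver Fq F) {t : regularRing vinf}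
    (ht : 1 < vinf t) (y : F) : ∃ g : regularRing vinf, g ≠ 0 ∧ (g : F) * y ∈ regularRing vinf := by
  obtain ⟨x, -, hfin⟩ := hF
  have h1 : Algebra.IsAlgebraic (Algebra.adjoin Fq {x}) F :=
    IntermediateField.isAlgebraic_adjoin_iff_top.mp inferInstance
  have h2 : Algebra.trdeg Fq F ≤ 1 := by
    have := Algebra.IsAlgebraic.trdeg_le_cardinalMk Fq ({x} : Set F)
    rwa [Cardinal.mk_singleton] at this
  have h3 : AlgebraicIndependent Fq (fun _ : Unit => (t : F)) :=
    algebraicIndependent_unique_type_iff.mpr (transcendental_of_one_lt ht)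
  have h4 := (h3.isTranscendenceBasis_of_lift_trdeg_le_of_finite (by simpa using h2)).isAlgebraic
  have h5 : Set.range (fun _ : Unit => (t : F)) = {(t : F)} := Set.range_const
  rw [h5] at h4
  obtain ⟨g, hg0, hg⟩ := (h4.isAlgebraic y).exists_integral_multiple
  have hle : ∀ s : Algebra.adjoin Fq {(t : F)}, (s : F) ∈ regularRing vinf := by
    rintro ⟨s, hs⟩
    induction hs using Algebra.adjoin_induction with
    | mem x hx => exact (Set.mem_singleton_iff.mp hx).symm ▸ t.2
    | algebraMap c => exact (algebraMap Fq (regularRing vinf) c).2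
    | add x y _ _ hx hy => exact add_mem hx hy
    | mul x y _ _ hx hy => exact mul_mem hx hy
  refine ⟨⟨g, hle g⟩, fun h => hg0 (Subtype.ext (show (g : F) = 0 from congrArg Subtype.val h)), ?_⟩
  exact mem_regularRing_of_isIntegral hle hg

theorem isFractionRing_regularRing (hF : IsFunctionFieldOver Fq F) {t : regularRing vinf}
    (ht : 1 < vinf t) : IsFractionRing (regularRing vinf) F := by
  refine IsFractionRing.of_field _ _ fun z => ?_
  obtain ⟨g, hg0, hg⟩ := exists_mul_mem_regularRing hF ht z
  refine ⟨⟨_, hg⟩, g, ?_⟩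
  have : (g : F) ≠ 0 := fun h => hg0 (Subtype.ext h)
  exact (mul_div_cancel_left₀ z this).symm

theorem isIntegrallyClosed_regularRing (hF : IsFunctionFieldOver Fq F) {t : regularRing vinf}
    (ht : 1 < vinf t) : IsIntegrallyClosed (regularRing vinf) := by
  have := isFractionRing_regularRing hF ht
  refine (isIntegrallyClosed_iff F).mpr fun {x} hx => ?_
  exact ⟨⟨x, mem_regularRing_of_isIntegral (fun s => s.2) hx⟩, rfl⟩

/-- A regular function without poles is constant, so that a nonzero nonunit has a pole. -/
theorem one_lt_of_not_isUnit (hvinf : IsDegreeOnePlace Fq vinf)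
    (hdeg : ∀ a : regularRing vinf, a ≠ 0 → 1 ≤ vinf a) {t : regularRing vinf} (ht0 : t ≠ 0)
    (ht : ¬ IsUnit t) : 1 < vinf t := by
  refine lt_of_le_of_ne (hdeg t ht0) fun h => ht ?_
  obtain ⟨c, hc⟩ := hvinf.2 t h.symm.le
  have h1 : t = algebraMap Fq (regularRing vinf) c := by
    by_contra h2
    exact not_lt.mpr (hdeg _ (sub_ne_zero.mpr h2)) hc
  rw [h1]
  refine (IsUnit.mk0 c ?_).map _
  rintro rfl
  exact ht0 (by rw [h1, map_zero])

/-- The pole order at the rational point `vinf` is a degree function. -/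
theorem isDegree_regularRing (hF : IsFunctionFieldOver Fq F) (hvinf : IsDegreeOnePlace Fq vinf)
    (hdeg : ∀ a : regularRing vinf, a ≠ 0 → 1 ≤ vinf a) {t : regularRing vinf} (ht : 1 < vinf t) :
    IsDegree Fq (fun a : regularRing vinf => (WithZero.log (vinf a)).toNat) := by
  have hv0 : ∀ a : regularRing vinf, a ≠ 0 → vinf a ≠ 0 := fun a ha =>
    (zero_lt_one.trans_le (hdeg a ha)).ne'
  have hlog : ∀ a : regularRing vinf, a ≠ 0 → 0 ≤ WithZero.log (vinf a) := fun a ha => by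
    rw [← WithZero.log_one, WithZero.log_le_log one_ne_zero (hv0 a ha)]
    exact hdeg a ha
  refine ⟨fun a b ha hb => ?_, fun a b ha hb hab => ?_, ?_⟩
  · rw [Subring.coe_mul, map_mul, WithZero.log_mul (hv0 a ha) (hv0 b hb),
      Int.toNat_add (hlog a ha) (hlog b hb)]
  · have h1 : vinf a = vinf b := by
      have h2 : WithZero.log (vinf a) = WithZero.log (vinf b) := by
        have := hlog a ha
        have := hlog b hb
        omega
      rw [← WithZero.exp_log (hv0 a ha), h2, WithZero.exp_log (hv0 b hb)]
    have hb0 : (b : F) ≠ 0 := fun h => hb (Subtype.ext h)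
    obtain ⟨c, hc⟩ := hvinf.2 ((a : F) / b) (by rw [map_div₀, h1, div_self (hv0 b hb)])
    refine ⟨c, or_iff_not_imp_left.mpr fun h0 => ?_⟩
    have h2 : vinf (a - c • b : regularRing vinf) < vinf a := by
      have h3 : ((a - c • b : regularRing vinf) : F) = ((a : F) / b - algebraMap Fq F c) * b := by
        rw [AddSubgroupClass.coe_sub, regularRing.coe_smul, sub_mul, div_mul_cancel₀ _ hb0]
      rw [h3, map_mul, h1]
      calc _ < 1 * vinf b := mul_lt_mul_of_pos_right hc (zero_lt_iff.mpr (hv0 b hb))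
        _ = _ := one_mul _
    have h4 := hlog _ h0
    have h5 := (WithZero.log_lt_log (hv0 _ h0) (hv0 a ha)).mpr h2
    omega
  · -- a function `y` with a simple pole gives regular functions whose degrees `m`, `m + 1` are coprime
    obtain ⟨y, hy⟩ := hvinf.1 (WithZero.exp 1)
    obtain ⟨g, hg0, hg⟩ := exists_mul_mem_regularRing hF ht y
    obtain ⟨m, hm⟩ := Int.eq_ofNat_of_zero_le (hlog g hg0)
    have hy0 : y ≠ 0 := by
      rintro rfl
      rw [map_zero] at hy
      exact WithZero.exp_ne_zero hy.symm
    have hlogy : WithZero.log (vinf ((g : F) * y)) = m + 1 := by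
      rw [map_mul, hy, WithZero.log_mul (hv0 g hg0) WithZero.exp_ne_zero, hm, WithZero.log_exp]
    refine ⟨m * m, fun n hn => ?_⟩
    obtain ⟨i, j, rfl⟩ : ∃ i j, n = i * m + j * (m + 1) := by
      rcases Nat.eq_zero_or_pos m with rfl | hm0
      · exact ⟨0, n, by ring⟩
      · have h1 : n % m ≤ n / m :=
          (Nat.mod_lt n hm0).le.trans ((Nat.le_div_iff_mul_le hm0).mpr hn)
        obtain ⟨i, hi⟩ := Nat.exists_eq_add_of_le h1
        refine ⟨i, n % m, ?_⟩
        conv_lhs => rw [← Nat.div_add_mod n m, hi]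
        ring
    have hgF : (g : F) ≠ 0 := fun h => hg0 (Subtype.ext h)
    refine ⟨g ^ i * ⟨_, hg⟩ ^ j, fun h => ?_, ?_⟩
    · have h2 : (g : F) ^ i * ((g : F) * y) ^ j = 0 := congrArg Subtype.val h
      exact mul_ne_zero (pow_ne_zero _ hgF) (pow_ne_zero _ (mul_ne_zero hgF hy0)) h2
    · have h3 : ((g ^ i * ⟨_, hg⟩ ^ j : regularRing vinf) : F) =
        (g : F) ^ i * ((g : F) * y) ^ j := rfl
      rw [h3, map_mul, map_pow, map_pow, WithZero.log_mul (pow_ne_zero _ (hv0 g hg0))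
        (pow_ne_zero _ ((map_ne_zero vinf).mpr (mul_ne_zero hgF hy0))), WithZero.log_pow,
        WithZero.log_pow, hlogy, hm]
      norm_cast

end Curve

section

open SkewSeries

/-! ### Drinfeld modules over a field -/

namespace SkewSeries

variable {p : ℕ} [hp : Fact p.Prime] {k : Type*} [Field k] [CharP k p]

/-- The ring of polynomials in `τ`. -/
abbrev polynomials (p : ℕ) [Fact p.Prime] (k : Type*) [Field k] [CharP k p] :
    Subring (SkewSeries p k) := restricted p (0 : k)

theorem mem_polynomials_iff {g : SkewSeries p k} :
    g ∈ polynomials p k ↔ ∃ I, ∀ i, I ≤ i → coeff i g = 0 := by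
  constructor
  · intro h
    obtain ⟨I, hI⟩ := h 1
    exact ⟨I, fun i hi => by simpa using hI i hi⟩
  · rintro ⟨I, hI⟩
    exact mem_restricted_of_eq_zero I hI

theorem exists_top_coeff {g : SkewSeries p k} (hg : g ∈ polynomials p k) (h0 : g ≠ 0) :
    ∃ n, coeff n g ≠ 0 ∧ ∀ i, n < i → coeff i g = 0 := by
  classical
  obtain ⟨I, hI⟩ := mem_polynomials_iff.mp hg
  obtain ⟨j, hj⟩ : ∃ j, coeff j g ≠ 0 := by
    by_contra! h
    exact h0 (ext h)
  have hle : ∀ i, coeff i g ≠ 0 → i ≤ I := fun i hi => by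
    by_contra h
    exact hi (hI i (not_le.mp h).le)
  refine ⟨Nat.findGreatest (fun i => coeff i g ≠ 0) I,
    Nat.findGreatest_spec (P := fun i => coeff i g ≠ 0) (hle j hj) hj, fun i hi => ?_⟩
  by_contra h
  exact Nat.findGreatest_is_greatest hi (hle i h) h

instance {S T B : Type*} [Semiring S] [Semiring T] [SMul S T] [AddCommGroup B] [Module S B]
    [Module T B] [IsScalarTower S T B] : IsScalarTower S T (SkewSeries p B) :=
  ⟨fun s t f => ext fun n => smul_assoc s t (coeff n f)⟩

end SkewSeries

/-- `ρ` describes a Drinfeld module of rank `r` over the field `k` with respect to the degree function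
`d` on `A`, where `p ^ f` is the order of the constant field. -/
structure IsDrinfeldModule {A : Type*} [CommRing A] {p : ℕ} [Fact p.Prime] {k : Type*} [Field k]
    [CharP k p] [Algebra A k] (ρ : A →+* SkewSeries p k) (d : A → ℕ) (f r : ℕ) : Prop where
  coeff_zero : ∀ a, coeff 0 (ρ a) = algebraMap A k a
  coeff_ne_zero : ∀ a, a ≠ 0 → coeff (f * (r * d a)) (ρ a) ≠ 0
  coeff_eq_zero : ∀ a, a ≠ 0 → ∀ i, f * (r * d a) < i → coeff i (ρ a) = 0

namespace IsDrinfeldModule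

variable {A : Type*} [CommRing A] [IsDomain A] {p : ℕ} [Fact p.Prime] {k : Type*} [Field k]
    [CharP k p] [Algebra A k] {ρ : A →+* SkewSeries p k} {d : A → ℕ} {f r : ℕ}
    {Fq : Type*} [Field Fq] [Algebra Fq A]

theorem mem_polynomials (h : IsDrinfeldModule ρ d f r) (a : A) : ρ a ∈ polynomials p k := by
  by_cases ha : a = 0
  · rw [ha, map_zero]
    exact zero_mem _
  · exact mem_polynomials_iff.mpr ⟨_, fun i hi => h.coeff_eq_zero a ha i hi⟩

/-- Constants act through scalars. -/
theorem map_algebraMap (h : IsDrinfeldModule ρ d f r) (hd : IsDegree Fq d) (c : Fq) :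
    ρ (algebraMap Fq A c) = const (algebraMap A k (algebraMap Fq A c)) := by
  rw [← h.coeff_zero]
  refine eq_const_of_coeff_eq_zero fun n hn => ?_
  by_cases hc : c = 0
  · rw [hc, map_zero, map_zero]
    rfl
  have h0 : algebraMap Fq A c ≠ 0 := (map_ne_zero_iff _ (algebraMap Fq A).injective).mpr hc
  have h0' : algebraMap Fq A c⁻¹ ≠ 0 :=
    (map_ne_zero_iff _ (algebraMap Fq A).injective).mpr (inv_ne_zero hc)
  have h1 := hd.map_mul 1 1 one_ne_zero one_ne_zero
  have h2 := hd.map_mul _ _ h0 h0'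
  rw [← map_mul, mul_inv_cancel₀ hc, map_one] at h2
  rw [mul_one] at h1
  refine h.coeff_eq_zero _ h0 n ?_
  have h3 : d (algebraMap Fq A c) = 0 := by omega
  rw [h3]
  simpa using Nat.pos_of_ne_zero hn

theorem coeff_mul_top (h : IsDrinfeldModule ρ d f r) {m : SkewSeries p k} {n : ℕ}
    (hm : ∀ i, n < i → coeff i m = 0) {a : A} (ha : a ≠ 0) :
    coeff (n + f * (r * d a)) (m * ρ a) = coeff n m * coeff (f * (r * d a)) (ρ a) ^ p ^ n :=
  coeff_mul_of_high hm (h.coeff_eq_zero a ha)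

/-- Multiples of a nonzero polynomial by elements of distinct degrees are linearly independent. -/
theorem eq_zero_of_sum_eq_zero (h : IsDrinfeldModule ρ d f r) (hf : 0 < f) (hr : 0 < r)
    {m : SkewSeries p k} (hm : m ∈ polynomials p k) (hm0 : m ≠ 0) (s : Finset ℕ) (β : ℕ → A)
    (hβ : ∀ n ∈ s, β n ≠ 0 ∧ d (β n) = n) (x : ℕ → k)
    (hx : ∑ n ∈ s, x n • (m * ρ (β n)) = 0) : ∀ n ∈ s, x n = 0 := by
  classical
  by_contra! hne
  obtain ⟨l, hl, hl'⟩ := exists_top_coeff hm hm0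
  have hs : (s.filter fun n => x n ≠ 0).Nonempty := by
    obtain ⟨n, hn, hn'⟩ := hne
    exact ⟨n, Finset.mem_filter.mpr ⟨hn, hn'⟩⟩
  set N := (s.filter fun n => x n ≠ 0).max' hs
  obtain ⟨hNs, hN0⟩ := Finset.mem_filter.mp (Finset.max'_mem _ hs)
  have h1 := congrArg (coeff (l + f * (r * N))) hx
  rw [SkewSeries.coeff_sum, Finset.sum_eq_single N] at h1
  · have h2 := h.coeff_mul_top hl' (hβ N hNs).1
    rw [(hβ N hNs).2] at h2
    rw [SkewSeries.coeff_smul, h2, SkewSeries.coeff_zero] at h1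
    have h3 := h.coeff_ne_zero _ (hβ N hNs).1
    rw [(hβ N hNs).2] at h3
    exact smul_ne_zero hN0 (mul_ne_zero hl (pow_ne_zero _ h3)) h1
  · intro n hn hnN
    rw [SkewSeries.coeff_smul]
    by_cases hxn : x n = 0
    · rw [hxn, zero_smul]
    · have h2 : n < N := lt_of_le_of_ne
        (Finset.le_max' _ _ (Finset.mem_filter.mpr ⟨hn, hxn⟩)) hnN
      rw [coeff_mul_eq_zero_of_high hl' (h.coeff_eq_zero _ (hβ n hn).1), smul_zero]
      rw [(hβ n hn).2]
      have := Nat.mul_lt_mul_of_pos_left (Nat.mul_lt_mul_of_pos_left h2 hr) hf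
      omega
  · exact fun hn => absurd hNs hn

/-- The polynomials that commute with the constants, on which `A` and `k` act compatibly with their
constant fields. -/
def commutant (Fq : Type*) [Field Fq] [Algebra Fq A] (ρ : A →+* SkewSeries p k) :
    Submodule k (SkewSeries p k) where
  carrier := {m | m ∈ polynomials p k ∧
    ∀ c : Fq, m * ρ (algebraMap Fq A c) = algebraMap A k (algebraMap Fq A c) • m}
  zero_mem' := ⟨zero_mem _, fun c => by rw [zero_mul, smul_zero]⟩
  add_mem' := fun {x y} hx hy =>
    ⟨add_mem hx.1 hy.1, fun c => by rw [add_mul, hx.2, hy.2, smul_add]⟩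
  smul_mem' := fun b x hx => ⟨smul_mem_restricted b hx.1, fun c => by
    rw [smul_mul, hx.2, smul_comm]⟩

/-- The elements of the commutant are polynomials in the Frobenius of the constant field. -/
theorem coeff_eq_zero_of_mem_commutant [Finite Fq] (hq : Nat.card Fq = p ^ f)
    (hρ : ∀ c : Fq, ρ (algebraMap Fq A c) = const (algebraMap A k (algebraMap Fq A c)))
    {m : SkewSeries p k} (hm : m ∈ commutant Fq ρ)
    {i : ℕ} (hi : ¬ f ∣ i) : coeff i m = 0 := by
  have := Fintype.ofFinite Fq
  by_contra h0
  let ι : Fq →+* k := (algebraMap A k).comp (algebraMap Fq A)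
  have h1 : ∀ c : Fq, c ^ p ^ i = c := by
    intro c
    have h2 := congrArg (coeff i) (hm.2 c)
    rw [hρ, coeff_mul_const, SkewSeries.coeff_smul, smul_eq_mul, mul_comm] at h2
    apply ι.injective
    rw [map_pow]
    exact mul_right_cancel₀ h0 h2
  have hqf : ∀ c : Fq, c ^ p ^ f = c := fun c => by
    rw [← hq, Nat.card_eq_fintype_card, FiniteField.pow_card]
  have hqa : ∀ (a : ℕ) (c : Fq), c ^ p ^ (f * a) = c := by
    intro a c
    induction a with
    | zero => rw [mul_zero, pow_zero, pow_one]
    | succ a ih => rw [Nat.mul_succ, pow_add, pow_mul, ih, hqf]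
  have hb : ∀ c : Fq, c ^ p ^ (i % f) = c := fun c => by
    have h2 := h1 c
    rwa [← Nat.div_add_mod i f, pow_add, pow_mul, hqa] at h2
  have hb0 : i % f ≠ 0 := fun h => hi (Nat.dvd_of_mod_eq_zero h)
  have hlt : i % f < f := Nat.mod_lt _ (Nat.pos_of_ne_zero (by
    rintro rfl
    have h2 := Fintype.one_lt_card (α := Fq)
    rw [← Nat.card_eq_fintype_card, hq] at h2
    exact lt_irrefl _ h2))
  have hp1 := (Fact.out : p.Prime).one_lt
  -- the constant field would consist of the roots of a polynomial of too small a degree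
  have h3 : (Polynomial.X ^ p ^ (i % f) - Polynomial.X : Polynomial Fq) ≠ 0 :=
    FiniteField.X_pow_card_pow_sub_X_ne_zero Fq hb0 hp1
  have h4 := Polynomial.card_roots' (Polynomial.X ^ p ^ (i % f) - Polynomial.X : Polynomial Fq)
  rw [FiniteField.X_pow_card_pow_sub_X_natDegree_eq Fq hb0 hp1] at h4
  classical
  have h5 : Finset.univ ⊆ (Polynomial.X ^ p ^ (i % f) - Polynomial.X : Polynomial Fq).roots.toFinset := by
    intro c _
    rw [Multiset.mem_toFinset, Polynomial.mem_roots h3]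
    simp [hb c]
  have h6 := (Finset.card_le_card h5).trans (Multiset.toFinset_card_le _)
  rw [Finset.card_univ, ← Nat.card_eq_fintype_card, hq] at h6
  exact not_lt.mpr (h6.trans h4) (Nat.pow_lt_pow_right hp1 hlt)

end IsDrinfeldModule

end

section

open SkewSeries TensorProduct

/-! ### The action of `k ⊗ A` on the commutant of the constants -/

namespace IsDrinfeldModule

variable {A : Type*} [CommRing A] [IsDomain A] {p : ℕ} [Fact p.Prime] {k : Type*} [Field k]
    [CharP k p] [Algebra A k] {ρ : A →+* SkewSeries p k} {d : A → ℕ} {f r : ℕ}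
    {Fq : Type*} [Field Fq] [Algebra Fq A] [Algebra Fq k] [IsScalarTower Fq A k]

/-- Right multiplication by `ρ a` on the commutant. -/
noncomputable def rightMul (Fq : Type*) [Field Fq] [Algebra Fq A] [Algebra Fq k]
    [IsScalarTower Fq A k] (h : IsDrinfeldModule ρ d f r) :
    A →ₐ[Fq] Module.End k (commutant Fq ρ) where
  toFun a :=
    { toFun := fun m => ⟨m.1 * ρ a, mul_mem m.2.1 (h.mem_polynomials a), fun c => by
        rw [mul_assoc, ← map_mul, mul_comm, map_mul, ← mul_assoc, m.2.2, smul_mul]⟩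
      map_add' := fun m n => Subtype.ext (add_mul _ _ _)
      map_smul' := fun x m => Subtype.ext (smul_mul x _ _) }
  map_one' := by
    ext m : 2
    change m.1 * ρ 1 = m.1
    rw [map_one, mul_one]
  map_mul' a b := by
    ext m : 2
    change m.1 * ρ (a * b) = (m.1 * ρ b) * ρ a
    rw [mul_comm, map_mul, mul_assoc]
  map_zero' := by
    ext m : 2
    change m.1 * ρ 0 = 0
    rw [map_zero, mul_zero]
  map_add' a b := by
    ext m : 2
    change m.1 * ρ (a + b) = m.1 * ρ a + m.1 * ρ b
    rw [map_add, mul_add]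
  commutes' c := by
    ext m : 2
    change m.1 * ρ (algebraMap Fq A c) = c • m.1
    rw [m.2.2, ← IsScalarTower.algebraMap_apply, algebraMap_smul]

/-- The action of `k ⊗ A` on the commutant: `k` acts from the left and `A` from the right. -/
noncomputable def action (Fq : Type*) [Field Fq] [Algebra Fq A] [Algebra Fq k]
    [IsScalarTower Fq A k] (h : IsDrinfeldModule ρ d f r) :
    k ⊗[Fq] A →ₐ[k] Module.End k (commutant Fq ρ) :=
  Algebra.TensorProduct.lift (Algebra.ofId k _) (h.rightMul Fq) fun _ _ => by
    ext m : 2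
    exact (smul_mul _ _ _).symm

/-- The augmentation of `k ⊗ A` given by the structure map of the `A`-algebra `k`. -/
noncomputable def augmentation (Fq A k : Type*) [Field Fq] [CommRing A] [Field k] [Algebra Fq A]
    [Algebra Fq k] [Algebra A k] [IsScalarTower Fq A k] : k ⊗[Fq] A →ₐ[k] k :=
  Algebra.TensorProduct.lift (AlgHom.id k k) (IsScalarTower.toAlgHom Fq A k)
    fun _ _ => Commute.all _ _

theorem augmentation_tmul (x : k) (a : A) :
    augmentation Fq A k (x ⊗ₜ a) = x * algebraMap A k a := by
  simp [augmentation]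

theorem action_tmul (h : IsDrinfeldModule ρ d f r) (x : k) (a : A) (m : commutant Fq ρ) :
    (h.action Fq (x ⊗ₜ a) m : SkewSeries p k) = x • (m.1 * ρ a) := by
  have h1 : h.action Fq (x ⊗ₜ a) = Algebra.ofId k _ x * h.rightMul Fq a :=
    Algebra.TensorProduct.lift_tmul _ _ _ _ _
  rw [h1]
  rfl

theorem coeff_zero_action (h : IsDrinfeldModule ρ d f r) (z : k ⊗[Fq] A) (m : commutant Fq ρ) :
    coeff 0 (h.action Fq z m).1 = augmentation Fq A k z * coeff 0 m.1 := by
  induction z using TensorProduct.induction_on with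
  | zero => rw [map_zero, map_zero, zero_mul]; rfl
  | tmul x a =>
    rw [action_tmul, augmentation_tmul, SkewSeries.coeff_smul, coeff_zero_mul, h.coeff_zero,
      smul_eq_mul]
    ring
  | add y z hy hz =>
    rw [map_add, map_add, add_mul, ← hy, ← hz]
    rfl

/-- If `A` acts on `m` through scalars modulo `k{τ} ρ_t`, then `k ⊗ A` acts through the
augmentation. -/
theorem exists_action_eq (h : IsDrinfeldModule ρ d f r) {t : A} {m : commutant Fq ρ}
    (hm : ∀ b : A, ∃ y ∈ polynomials p k, m.1 * ρ b = algebraMap A k b • m.1 + y * ρ t)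
    (z : k ⊗[Fq] A) : ∃ y ∈ polynomials p k,
      (h.action Fq z m).1 = augmentation Fq A k z • m.1 + y * ρ t := by
  induction z using TensorProduct.induction_on with
  | zero =>
    refine ⟨0, zero_mem _, ?_⟩
    rw [map_zero, map_zero, zero_smul, zero_mul, add_zero]
    rfl
  | tmul x a =>
    obtain ⟨y, hy, hya⟩ := hm a
    refine ⟨x • y, smul_mem_restricted x hy, ?_⟩
    rw [action_tmul, augmentation_tmul, hya, smul_add, smul_smul, smul_mul]
  | add z₁ z₂ h₁ h₂ =>
    obtain ⟨y₁, hy₁, e₁⟩ := h₁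
    obtain ⟨y₂, hy₂, e₂⟩ := h₂
    refine ⟨y₁ + y₂, add_mem hy₁ hy₂, ?_⟩
    rw [map_add, map_add, add_smul, add_mul]
    change (h.action Fq z₁ m).1 + (h.action Fq z₂ m).1 = _
    rw [e₁, e₂]
    abel

/-- The commutant is torsion free over `k ⊗ A`, since the elements of a basis of `A` with distinct degrees
raise the degree of a polynomial by distinct amounts. -/
theorem action_ne_zero (h : IsDrinfeldModule ρ d f r) (hd : IsDegree Fq d) (hf : 0 < f)
    (hr : 0 < r) {z : k ⊗[Fq] A} (hz : z ≠ 0) {m : commutant Fq ρ} (hm : m ≠ 0) :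
    h.action Fq z m ≠ 0 := by
  classical
  obtain ⟨β, hβ, -, hβs⟩ := hd.exists_family
  have h1 : Submodule.span Fq (Set.range β) = ⊤ := by
    rw [eq_top_iff]
    rintro a -
    exact Submodule.span_mono (Set.image_subset_range β _) (hβs (d a + 1) a (Or.inr (by omega)))
  have h2 : z ∈ Submodule.span k (Set.range fun n => (1 : k) ⊗ₜ[Fq] β n) := by
    have := Submodule.baseChange_span (R := Fq) k (Set.range β)
    rw [h1, Submodule.baseChange_top, ← Set.range_comp] at this
    exact this ▸ Submodule.mem_top
  obtain ⟨x, rfl⟩ := Finsupp.mem_span_range_iff_exists_finsupp.mp h2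
  intro h0
  apply hz
  have h3 := congrArg Subtype.val h0
  rw [Finsupp.sum, map_sum, LinearMap.sum_apply, AddSubmonoidClass.coe_finsetSum] at h3
  have h4 : ∀ n, ((h.action Fq (x n • (1 : k) ⊗ₜ[Fq] β n) m : commutant Fq ρ) : SkewSeries p k) =
      x n • (m.1 * ρ (β n)) := by
    intro n
    rw [TensorProduct.smul_tmul', action_tmul, smul_eq_mul, mul_one]
  rw [Finset.sum_congr rfl fun n _ => h4 n] at h3
  have h5 := h.eq_zero_of_sum_eq_zero hf hr m.2.1 (fun h => hm (Subtype.ext h))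
    (x.support.filter fun n => β n ≠ 0) β
    (fun n hn => ⟨(Finset.mem_filter.mp hn).2, hβ n (Finset.mem_filter.mp hn).2⟩) x (by
      rw [Finset.sum_filter]
      refine Eq.trans (Finset.sum_congr rfl fun n _ => ?_) h3
      split_ifs with hn
      · rfl
      · rw [not_not.mp hn, map_zero, mul_zero, smul_zero])
  refine Finset.sum_eq_zero fun n hn => ?_
  change x n • ((1 : k) ⊗ₜ[Fq] β n) = 0
  by_cases hn0 : β n = 0
  · rw [hn0, TensorProduct.tmul_zero, smul_zero]
  · rw [h5 n (Finset.mem_filter.mpr ⟨hn, hn0⟩), zero_smul]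

end IsDrinfeldModule

namespace IsDrinfeldModule

variable {A : Type*} [CommRing A] [IsDomain A] {p : ℕ} [Fact p.Prime] {k : Type*} [Field k]
    [CharP k p] [Algebra A k] {ρ : A →+* SkewSeries p k} {d : A → ℕ} {f r : ℕ}
    {Fq : Type*} [Field Fq] [Algebra Fq A] [Algebra Fq k] [IsScalarTower Fq A k]

/-- If `t` generates the kernel of `A → k` locally, then its image generates the kernel of the
augmentation locally: as the residue field of `A` is separable over the constants, the augmentation is
a reduced isolated point of the fibre of `k ⊗ A` over that kernel. -/
theorem exists_augmentation_eq_one (Fq : Type*) [Field Fq] [Algebra Fq A] [Algebra Fq k]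
    [IsScalarTower Fq A k] [Finite (A ⧸ RingHom.ker (algebraMap A k))] {t a : A}
    (ha : algebraMap A k a ≠ 0) (hat : ∀ b, algebraMap A k b = 0 → t ∣ a * b) :
    ∃ u : k ⊗[Fq] A, augmentation Fq A k u = 1 ∧
      ∀ z, augmentation Fq A k z = 0 → ∃ y, u * z = (1 ⊗ₜ t) * y := by
  let P := RingHom.ker (algebraMap A k)
  have hP : P.IsPrime := RingHom.ker_isPrime _
  have hPm : P.IsMaximal := Ideal.Quotient.maximal_of_isField P (Finite.isField_of_domain _)
  let _ : Field (A ⧸ P) := Ideal.Quotient.field P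
  have : Finite (A ⧸ P) := ‹_›
  have := Fintype.ofFinite (A ⧸ P)
  have hmk : ∀ b c : A, Ideal.Quotient.mk P b = Ideal.Quotient.mk P c ↔
      algebraMap A k (b - c) = 0 := fun b c => by rw [Ideal.Quotient.eq]; rfl
  -- a generator of the residue field
  obtain ⟨g, hg⟩ := IsCyclic.exists_generator (α := (A ⧸ P)ˣ)
  obtain ⟨θ, hθ⟩ := Ideal.Quotient.mk_surjective (g : A ⧸ P)
  have hgen : ∀ b, algebraMap A k b = 0 ∨ ∃ j : ℕ, algebraMap A k (b - θ ^ j) = 0 := by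
    intro b
    refine or_iff_not_imp_left.mpr fun hb => ?_
    have hb0 : Ideal.Quotient.mk P b ≠ 0 := fun h => hb (Ideal.Quotient.eq_zero_iff_mem.mp h)
    obtain ⟨j, hj : g ^ j = _⟩ := mem_powers_iff_mem_zpowers.mpr (hg (Units.mk0 _ hb0))
    refine ⟨j, (hmk _ _).mp ?_⟩
    rw [map_pow, hθ, ← Units.val_pow_eq_pow_val, hj, Units.val_mk0]
  set N := Fintype.card (A ⧸ P)
  have hN0 : (N : k) = 0 := by
    have h1 := (hmk (N : A) 0).mp (by rw [map_natCast, map_zero]; exact FiniteField.cast_card_eq_zero _)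
    simpa using h1
  have hθN : algebraMap A k (θ ^ N - θ) = 0 :=
    (hmk _ _).mp (by rw [map_pow]; exact FiniteField.pow_card _)
  set x : k ⊗[Fq] A := 1 ⊗ₜ θ
  set y : k ⊗[Fq] A := algebraMap A k θ ⊗ₜ 1
  set H : k ⊗[Fq] A := ∑ i ∈ Finset.range N, x ^ i * y ^ (N - 1 - i) - 1
  have hx : augmentation Fq A k x = algebraMap A k θ := by rw [augmentation_tmul, one_mul]
  have hy : augmentation Fq A k y = algebraMap A k θ := by
    rw [augmentation_tmul, map_one, mul_one]
  -- `X ^ N - X` is separable and vanishes on the residue field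
  have hH : augmentation Fq A k H = -1 := by
    rw [map_sub, map_sum, map_one, Finset.sum_congr rfl fun i hi => ?_, Finset.sum_const,
      Finset.card_range, nsmul_eq_mul, hN0, zero_mul, zero_sub]
    · exact algebraMap A k θ ^ (N - 1)
    · have := Finset.mem_range.mp hi
      rw [map_mul, map_pow, map_pow, hx, hy, ← pow_add]
      congr 1
      omega
  have hHxy : H * (x - y) = 1 ⊗ₜ (θ ^ N - θ) := by
    have h1 : y ^ N = y := by
      rw [Algebra.TensorProduct.tmul_pow, one_pow, ← map_pow]
      rw [map_sub, sub_eq_zero] at hθN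
      rw [hθN]
    rw [sub_mul, one_mul, geom_sum₂_mul, h1, TensorProduct.tmul_sub,
      Algebra.TensorProduct.tmul_pow, one_pow]
    ring
  set I : Ideal (k ⊗[Fq] A) := Ideal.span {1 ⊗ₜ t}
  have hI : ∀ b, algebraMap A k b = 0 → (1 ⊗ₜ a : k ⊗[Fq] A) * (1 ⊗ₜ b) ∈ I := by
    intro b hb
    obtain ⟨c, hc⟩ := hat b hb
    rw [Algebra.TensorProduct.tmul_mul_tmul, hc]
    refine Ideal.mem_span_singleton.mpr ⟨1 ⊗ₜ c, ?_⟩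
    rw [Algebra.TensorProduct.tmul_mul_tmul, one_mul]
  set u₀ := (1 ⊗ₜ a : k ⊗[Fq] A) * H
  have h1 : ∀ b : A, u₀ * (1 ⊗ₜ b - algebraMap A k b ⊗ₜ 1) ∈ I := by
    have h2 : ∀ b, algebraMap A k b = 0 → u₀ * (1 ⊗ₜ b) ∈ I := fun b hb => by
      rw [mul_right_comm]
      exact I.mul_mem_right _ (hI b hb)
    intro b
    rcases hgen b with hb | ⟨j, hj⟩
    · rw [hb, TensorProduct.zero_tmul, sub_zero]
      exact h2 b hb
    · have h3 : (1 ⊗ₜ b - algebraMap A k b ⊗ₜ 1 : k ⊗[Fq] A) =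
          1 ⊗ₜ (b - θ ^ j) + (x ^ j - y ^ j) := by
        rw [map_sub, sub_eq_zero] at hj
        rw [hj, TensorProduct.tmul_sub, Algebra.TensorProduct.tmul_pow,
          Algebra.TensorProduct.tmul_pow, one_pow, one_pow, map_pow]
        ring
      obtain ⟨w, hw⟩ := sub_dvd_pow_sub_pow x y j
      have h4 : u₀ * ((x - y) * w) = (1 ⊗ₜ a : k ⊗[Fq] A) * (1 ⊗ₜ (θ ^ N - θ)) * w := by
        rw [← hHxy]
        ring
      rw [h3, mul_add, hw, h4]
      exact I.add_mem (h2 _ hj) (I.mul_mem_right _ (hI _ hθN))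
  have h2 : ∀ z, u₀ * (z - augmentation Fq A k z ⊗ₜ 1) ∈ I := by
    intro z
    induction z using TensorProduct.induction_on with
    | zero => simp
    | tmul c b =>
      have h3 : u₀ * (c ⊗ₜ b - augmentation Fq A k (c ⊗ₜ b) ⊗ₜ 1) =
          (c ⊗ₜ 1) * (u₀ * (1 ⊗ₜ b - algebraMap A k b ⊗ₜ 1)) := by
        rw [augmentation_tmul, mul_left_comm, mul_sub (c ⊗ₜ 1 : k ⊗[Fq] A),
          Algebra.TensorProduct.tmul_mul_tmul, Algebra.TensorProduct.tmul_mul_tmul, mul_one,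
          one_mul, one_mul]
      rw [h3]
      exact I.mul_mem_left _ (h1 b)
    | add z₁ z₂ e₁ e₂ =>
      have h3 := I.add_mem e₁ e₂
      rw [← mul_add] at h3
      rw [map_add, TensorProduct.add_tmul]
      convert h3 using 2
      ring
  refine ⟨(-(algebraMap A k a)⁻¹) ⊗ₜ 1 * u₀, ?_, fun z hz => ?_⟩
  · rw [map_mul, map_mul, augmentation_tmul, augmentation_tmul, hH, map_one]
    field_simp
  · have h3 := I.mul_mem_left ((-(algebraMap A k a)⁻¹) ⊗ₜ 1) (h2 z)
    rw [hz, TensorProduct.zero_tmul, sub_zero, ← mul_assoc] at h3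
    exact Ideal.mem_span_singleton.mp h3

/-- Modulo `k{τ} ρ_t`, a polynomial on which `A` acts through scalars can be averaged over the constant
field to make it lie in the commutant. -/
theorem exists_mem_commutant [Finite Fq] (h : IsDrinfeldModule ρ d f r) {t : A}
    {m : SkewSeries p k} (hm0 : m ∈ polynomials p k)
    (hm : ∀ b : A, ∃ y ∈ polynomials p k, m * ρ b = algebraMap A k b • m + y * ρ t) :
    ∃ m' ∈ commutant Fq ρ, ∃ y ∈ polynomials p k, m' = m + y * ρ t := by
  classical
  have := Fintype.ofFinite Fq
  choose y hy hyb using hm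
  let ι : Fq →+* k := (algebraMap A k).comp (algebraMap Fq A)
  have hι : ∀ c : Fqˣ, ι c ≠ 0 := fun c => (map_ne_zero ι).mpr c.ne_zero
  let m' := -∑ c : Fqˣ, (ι c)⁻¹ • (m * ρ (algebraMap Fq A c))
  let Y := -∑ c : Fqˣ, (ι c)⁻¹ • y (algebraMap Fq A c)
  refine ⟨m', ⟨neg_mem (sum_mem fun c _ => smul_mem_restricted _
    (mul_mem hm0 (h.mem_polynomials _))), fun b => ?_⟩, Y,
    neg_mem (sum_mem fun c _ => smul_mem_restricted _ (hy _)), ?_⟩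
  · by_cases hb : b = 0
    · rw [hb, map_zero, map_zero, mul_zero, map_zero, zero_smul]
    let b' : Fqˣ := Units.mk0 b hb
    change m' * _ = ι b • m'
    rw [neg_mul, smul_neg, neg_inj, Finset.sum_mul, Finset.smul_sum]
    refine Fintype.sum_equiv (Equiv.mulRight b') _ _ fun c => ?_
    have h1 : ι b * (ι (c * b))⁻¹ = (ι c)⁻¹ := by
      rw [map_mul, mul_inv, mul_left_comm, mul_inv_cancel₀ ((map_ne_zero ι).mpr hb), mul_one]
    rw [smul_mul, smul_smul, mul_assoc, ← map_mul, ← map_mul, Equiv.coe_mulRight, Units.val_mul,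
      Units.val_mk0, h1]
  · have hcard : (Fintype.card Fqˣ : k) = -1 := by
      rw [Fintype.card_units, Nat.cast_sub Fintype.card_pos, Nat.cast_one]
      have := congrArg ι (FiniteField.cast_card_eq_zero Fq)
      rw [map_natCast, map_zero] at this
      rw [this, zero_sub]
    have h1 : ∀ c : Fqˣ, (ι c)⁻¹ • (m * ρ (algebraMap Fq A c)) =
        m + (ι c)⁻¹ • y (algebraMap Fq A c) * ρ t := by
      intro c
      rw [hyb, smul_add, smul_mul]
      change (ι c)⁻¹ • (ι c • m) + _ = _
      rw [smul_smul, inv_mul_cancel₀ (hι c), one_smul]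
    change -∑ c : Fqˣ, (ι c)⁻¹ • (m * ρ (algebraMap Fq A c)) = _
    rw [Finset.sum_congr rfl fun c _ => h1 c, Finset.sum_add_distrib, Finset.sum_const,
      Finset.card_univ, ← Nat.cast_smul_eq_nsmul k, hcard, neg_add, neg_smul, one_smul, neg_neg,
      ← Finset.sum_mul, neg_mul]

/-- Any `r + 1` elements of the commutant are linearly dependent over `k ⊗ A`: in large degrees the
commutant grows `r` times as fast as `k ⊗ A`. -/
theorem exists_relation [Finite Fq] (h : IsDrinfeldModule ρ d f r) (hd : IsDegree Fq d)
    (hf : 0 < f) (hr : 0 < r) (hq : Nat.card Fq = p ^ f) (e : Fin (r + 1) → commutant Fq ρ) :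
    ∃ z : Fin (r + 1) → k ⊗[Fq] A, z ≠ 0 ∧ ∑ i, h.action Fq (z i) (e i) = 0 := by
  classical
  obtain ⟨β, hβ, hβ0, -⟩ := hd.exists_family
  obtain ⟨N, hN⟩ := hd.exists_eq
  have hβN : ∀ n, N ≤ n → β n ≠ 0 ∧ d (β n) = n := by
    intro n hn
    obtain ⟨b, hb, hb'⟩ := hN n hn
    have := hβ0 b hb
    rw [hb'] at this
    exact ⟨this, hβ n this⟩
  -- a common bound for the degrees of the `e i`
  obtain ⟨c, hc⟩ : ∃ c, ∀ i, ∀ n, f * c < n → coeff n (e i).1 = 0 := by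
    have h1 : ∀ i, ∃ I, ∀ n, I ≤ n → coeff n (e i).1 = 0 := fun i =>
      mem_polynomials_iff.mp (e i).2.1
    choose I hI using h1
    refine ⟨∑ i, I i, fun i n hn => hI i n ?_⟩
    have h2 : I i ≤ ∑ i, I i := Finset.single_le_sum (fun _ _ => Nat.zero_le _) (Finset.mem_univ i)
    nlinarith
  -- the multiples of the `e i` by elements of the degrees `N, …, N + L - 1` span a space of dimension at
  -- most `T`, which is less than their number `(r + 1) L`
  let L := c + r * N + 2
  let T := c + r * (N + L) + 1
  let G : (Fin (r + 1) × Fin L → k) →ₗ[k] commutant Fq ρ :=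
    ∑ i, ∑ j, (LinearMap.proj (i, j)).smulRight (h.rightMul Fq (β (N + j)) (e i))
  have hG : ∀ x, G x = ∑ i, ∑ j, x (i, j) • h.rightMul Fq (β (N + j)) (e i) := fun x => by
    simp only [G, LinearMap.sum_apply]
    rfl
  let co : commutant Fq ρ →ₗ[k] (Fin T → k) :=
    { toFun := fun m s => coeff (f * s) m.1
      map_add' := fun m n => rfl
      map_smul' := fun x m => rfl }
  have hrank : Module.finrank k (Fin T → k) < Module.finrank k (Fin (r + 1) × Fin L → k) := by
    rw [Module.finrank_fin_fun, Module.finrank_fintype_fun_eq_card, Fintype.card_prod,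
      Fintype.card_fin, Fintype.card_fin]
    simp only [T, L]
    nlinarith
  obtain ⟨x, hx, hx0⟩ := Submodule.exists_mem_ne_zero_of_ne_bot
    ((co.comp G).ker_ne_bot_of_finrank_lt hrank)
  have hGx : G x = 0 := by
    apply Subtype.ext
    refine SkewSeries.ext fun n => ?_
    by_cases hn : f ∣ n
    · obtain ⟨s, rfl⟩ := hn
      rcases lt_or_ge s T with hs | hs
      · exact congrFun (LinearMap.mem_ker.mp hx) ⟨s, hs⟩
      · rw [hG, AddSubmonoidClass.coe_finsetSum, SkewSeries.coeff_sum]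
        refine Finset.sum_eq_zero fun i _ => ?_
        rw [AddSubmonoidClass.coe_finsetSum, SkewSeries.coeff_sum]
        refine Finset.sum_eq_zero fun j _ => ?_
        change coeff (f * s) (x (i, j) • ((e i).1 * ρ (β (N + j)))) = 0
        have h1 := hβN (N + j) (Nat.le_add_right _ _)
        rw [SkewSeries.coeff_smul, coeff_mul_eq_zero_of_high (hc i) (h.coeff_eq_zero _ h1.1),
          smul_zero]
        rw [h1.2, ← mul_add]
        refine Nat.mul_lt_mul_of_pos_left ?_ hf
        have h2 : r * (N + j) ≤ r * (N + L) := Nat.mul_le_mul_left _ (by omega)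
        simp only [T] at hs
        omega
    · exact coeff_eq_zero_of_mem_commutant hq (h.map_algebraMap hd) (G x).2 hn
  refine ⟨fun i => ∑ j, x (i, j) ⊗ₜ β (N + j), fun hz => hx0 ?_, ?_⟩
  · have h1 : (1 : SkewSeries p k) ∈ commutant Fq ρ := ⟨one_mem _, fun c => by
      rw [one_mul, h.map_algebraMap hd, ← const_mul, mul_one]⟩
    funext ij
    obtain ⟨i, j⟩ := ij
    have h2 := congrArg (fun z => (h.action Fq z ⟨1, h1⟩).1) (congrFun hz i)
    simp only [map_sum, LinearMap.sum_apply, AddSubmonoidClass.coe_finsetSum, action_tmul] at h2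
    let y : ℕ → k := fun n => if hn : n - N < L then x (i, ⟨n - N, hn⟩) else 0
    have h3 := h.eq_zero_of_sum_eq_zero hf hr (m := 1) (one_mem _) one_ne_zero
      (Finset.univ.image fun j : Fin L => N + j) β (fun n hn => by
        obtain ⟨j, -, rfl⟩ := Finset.mem_image.mp hn
        exact hβN _ (Nat.le_add_right _ _)) y (by
        rw [Finset.sum_image (fun a _ b _ hab => Fin.ext (Nat.add_left_cancel hab))]
        refine Eq.trans (Finset.sum_congr rfl fun j _ => ?_) h2
        simp [y])
    have h4 := h3 (N + j) (Finset.mem_image.mpr ⟨j, Finset.mem_univ _, rfl⟩)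
    simpa [y] using h4
  · rw [← hGx, hG]
    refine Finset.sum_congr rfl fun i _ => ?_
    rw [map_sum, LinearMap.sum_apply]
    refine Finset.sum_congr rfl fun j _ => Subtype.ext ?_
    rw [action_tmul]
    rfl

end IsDrinfeldModule

/-! ### The dimension bound over the residue field -/

namespace IsDrinfeldModule

variable {A : Type*} [CommRing A] [IsDomain A] {p : ℕ} [Fact p.Prime] {k : Type*} [Field k]
    [CharP k p] [Algebra A k] {ρ : A →+* SkewSeries p k} {d : A → ℕ} {f r : ℕ}
    {Fq : Type*} [Field Fq] [Algebra Fq A] [Algebra Fq k] [IsScalarTower Fq A k]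

/-- The dimension bound for elements of the commutant: see `exists_sum_smul_eq`. -/
theorem exists_sum_smul_eq_of_mem_commutant [Finite Fq] (h : IsDrinfeldModule ρ d f r)
    (hd : IsDegree Fq d) (hf : 0 < f) (hr : 0 < r) (hq : Nat.card Fq = p ^ f) {t : A} (ht0 : t ≠ 0)
    (ht : algebraMap A k t = 0) {u : k ⊗[Fq] A} (hu1 : augmentation Fq A k u = 1)
    (hu : ∀ z, augmentation Fq A k z = 0 → ∃ y, u * z = (1 ⊗ₜ t) * y)
    (m : Fin r → commutant Fq ρ) (hm0 : ∀ i, coeff 0 (m i).1 = 0)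
    (hm : ∀ i, ∀ b : A, ∃ y ∈ polynomials p k,
      (m i).1 * ρ b = algebraMap A k b • (m i).1 + y * ρ t) :
    ∃ x : Fin r → k, x ≠ 0 ∧ ∃ y ∈ polynomials p k, ∑ i, x i • (m i).1 = y * ρ t := by
  by_contra! hind
  replace hind : ∀ x : Fin r → k, (∃ y ∈ polynomials p k, ∑ i, x i • (m i).1 = y * ρ t) → x = 0 :=
    fun x ⟨y, hy, hxy⟩ => by
      by_contra hx
      exact hind x hx y hy hxy
  have h1 : (1 : SkewSeries p k) ∈ commutant Fq ρ := ⟨one_mem _, fun c => by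
    rw [one_mul, h.map_algebraMap hd, ← const_mul, mul_one]⟩
  let one : commutant Fq ρ := ⟨1, h1⟩
  have hone : one ≠ 0 := fun h0 => one_ne_zero (congrArg Subtype.val h0)
  let e : Fin (r + 1) → commutant Fq ρ := Fin.cons one m
  let ε := augmentation Fq A k
  have htsmul : ∀ x : commutant Fq ρ, (h.action Fq (1 ⊗ₜ t) x).1 = x.1 * ρ t := fun x => by
    rw [action_tmul, one_smul]
  -- the relations between `1` and the `m i`
  let Z : Submodule (k ⊗[Fq] A) (Fin (r + 1) → k ⊗[Fq] A) :=
    { carrier := {z | ∑ i, h.action Fq (z i) (e i) = 0}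
      zero_mem' := Finset.sum_eq_zero fun i _ => by
        rw [Pi.zero_apply, map_zero, LinearMap.zero_apply]
      add_mem' := fun {x y} hx hy => by
        have h2 : ∀ i, h.action Fq ((x + y) i) (e i) =
            h.action Fq (x i) (e i) + h.action Fq (y i) (e i) := fun i => by
          rw [Pi.add_apply, map_add, LinearMap.add_apply]
        change ∑ i, h.action Fq ((x + y) i) (e i) = 0
        rw [Finset.sum_congr rfl fun i _ => h2 i, Finset.sum_add_distrib, hx, hy, add_zero]
      smul_mem' := fun c x hx => by
        have h2 : ∀ i, h.action Fq ((c • x) i) (e i) = h.action Fq c (h.action Fq (x i) (e i)) :=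
          fun i => by rw [Pi.smul_apply, smul_eq_mul, map_mul]; rfl
        change ∑ i, h.action Fq ((c • x) i) (e i) = 0
        rw [Finset.sum_congr rfl fun i _ => h2 i, ← map_sum, hx, map_zero] }
  have hZ : ∀ z, z ∈ Z ↔ ∑ i, h.action Fq (z i) (e i) = 0 := fun z => Iff.rfl
  -- the coefficients of a relation have augmentation zero
  have hZ0 : ∀ z ∈ Z, ∀ i, ε (z i) = 0 := by
    intro z hz
    have h2 := (hZ z).mp hz
    have hz0 : ε (z 0) = 0 := by
      have h3 := congrArg Subtype.val h2
      rw [AddSubmonoidClass.coe_finsetSum] at h3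
      replace h3 := congrArg (coeff 0) h3
      rw [SkewSeries.coeff_sum, Fin.sum_univ_succ, Finset.sum_eq_zero (s := Finset.univ)
        (fun i _ => by
          rw [coeff_zero_action]
          change _ * coeff 0 (m i).1 = 0
          rw [hm0, mul_zero]), add_zero, coeff_zero_action] at h3
      change ε (z 0) * 1 = 0 at h3
      rwa [mul_one] at h3
    obtain ⟨y, hy⟩ := hu _ hz0
    choose w hw hwe using fun i : Fin r => h.exists_action_eq (hm i) (u * z i.succ)
    have h3 := hind (fun i => ε (z i.succ)) ⟨-((h.action Fq y one).1 + ∑ i, w i),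
      neg_mem (add_mem (h.action Fq y one).2.1 (sum_mem fun i _ => hw i)), by
      have h4 : h.action Fq u (∑ i, h.action Fq (z i) (e i)) = 0 := by rw [h2, map_zero]
      rw [map_sum, Fin.sum_univ_succ] at h4
      have h5 : h.action Fq u (h.action Fq (z 0) (e 0)) =
          h.action Fq (1 ⊗ₜ t) (h.action Fq y one) := by
        change (h.action Fq u * h.action Fq (z 0)) one =
          (h.action Fq (1 ⊗ₜ t) * h.action Fq y) one
        rw [← map_mul, ← map_mul, hy]
      have h6 : ∀ i : Fin r, (h.action Fq u (h.action Fq (z i.succ) (e i.succ))).1 =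
          ε (z i.succ) • (m i).1 + w i * ρ t := by
        intro i
        have h7 := hwe i
        rw [map_mul, map_mul, hu1, one_mul] at h7
        exact h7
      have h8 := congrArg Subtype.val h4
      rw [h5, Submodule.coe_add, AddSubmonoidClass.coe_finsetSum,
        Finset.sum_congr rfl fun i _ => h6 i, htsmul, Finset.sum_add_distrib] at h8
      change _ = (0 : SkewSeries p k) at h8
      rw [neg_mul, add_mul, Finset.sum_mul, eq_neg_iff_add_eq_zero, ← h8]
      abel⟩
    intro i
    refine Fin.cases hz0 (fun i => ?_) i
    exact congrFun h3 i
  -- hence the module of relations is divisible by the augmentation ideal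
  let P : Ideal (k ⊗[Fq] A) := RingHom.ker ε
  have hle : Z ≤ P • Z := by
    intro z hz
    choose y hy using fun i => hu (z i) (hZ0 z hz i)
    have hyZ : y ∈ Z := by
      have h2 : h.action Fq (1 ⊗ₜ t) (∑ i, h.action Fq (y i) (e i)) = 0 := by
        have h3 : ∀ i, h.action Fq (1 ⊗ₜ t) (h.action Fq (y i) (e i)) =
            h.action Fq u (h.action Fq (z i) (e i)) := by
          intro i
          change (h.action Fq (1 ⊗ₜ t) * h.action Fq (y i)) (e i) =
            (h.action Fq u * h.action Fq (z i)) (e i)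
          rw [← map_mul, ← map_mul, hy]
        rw [map_sum, Finset.sum_congr rfl fun i _ => h3 i, ← map_sum, (hZ z).mp hz, map_zero]
      have h3 := congrArg Subtype.val h2
      rw [htsmul] at h3
      apply Subtype.ext
      refine (mul_eq_zero.mp h3).resolve_right fun h4 => ?_
      have h5 := h.coeff_ne_zero t ht0
      rw [h4] at h5
      exact h5 rfl
    have h2 : z = (1 - u) • z + ((1 : k) ⊗ₜ[Fq] t) • y := by
      funext i
      rw [Pi.add_apply, Pi.smul_apply, Pi.smul_apply, smul_eq_mul, smul_eq_mul, ← hy]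
      ring
    rw [h2]
    refine add_mem (Submodule.smul_mem_smul ?_ hz) (Submodule.smul_mem_smul ?_ hyZ)
    · change ε (1 - u) = 0
      rw [map_sub, map_one, hu1, sub_self]
    · change ε (1 ⊗ₜ t) = 0
      rw [augmentation_tmul, ht, mul_zero]
  have := hd.finiteType
  have : IsNoetherianRing (k ⊗[Fq] A) := Algebra.FiniteType.isNoetherianRing k _
  obtain ⟨w, hw, hwZ⟩ := Submodule.exists_sub_one_mem_and_smul_eq_zero_of_fg_of_le_smul P Z
    (IsNoetherian.noetherian Z) hle
  have hw0 : w ≠ 0 := by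
    rintro rfl
    have h2 : ε (0 - 1) = 0 := hw
    rw [map_sub, map_zero, map_one, zero_sub, neg_eq_zero] at h2
    exact one_ne_zero h2
  obtain ⟨z, hz, hze⟩ := h.exists_relation hd hf hr hq e
  refine hz (funext fun i => ?_)
  by_contra hzi
  have h2 : w * z i = 0 := congrFun (hwZ z hze) i
  refine h.action_ne_zero hd hf hr hw0 (h.action_ne_zero hd hf hr hzi hone) ?_
  change (h.action Fq w * h.action Fq (z i)) one = 0
  rw [← map_mul, h2, map_zero, LinearMap.zero_apply]

/-- Modulo `k{τ} ρ_t`, the polynomials without constant term on which `A` acts through scalars form a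
space of dimension less than `r`. -/
theorem exists_sum_smul_eq [Finite Fq] (h : IsDrinfeldModule ρ d f r)
    (hd : IsDegree Fq d) (hf : 0 < f) (hr : 0 < r) (hq : Nat.card Fq = p ^ f) {t : A} (ht0 : t ≠ 0)
    (ht : algebraMap A k t = 0) {u : k ⊗[Fq] A} (hu1 : augmentation Fq A k u = 1)
    (hu : ∀ z, augmentation Fq A k z = 0 → ∃ y, u * z = (1 ⊗ₜ t) * y)
    (m : Fin r → SkewSeries p k) (hmp : ∀ i, m i ∈ polynomials p k) (hm0 : ∀ i, coeff 0 (m i) = 0)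
    (hm : ∀ i, ∀ b : A, ∃ y ∈ polynomials p k,
      m i * ρ b = algebraMap A k b • m i + y * ρ t) :
    ∃ x : Fin r → k, x ≠ 0 ∧ ∃ y ∈ polynomials p k, ∑ i, x i • m i = y * ρ t := by
  choose m' hm' Y hY hmY using fun i => h.exists_mem_commutant (Fq := Fq) (hmp i) (hm i)
  obtain ⟨x, hx, y, hy, hxy⟩ := h.exists_sum_smul_eq_of_mem_commutant hd hf hr hq ht0 ht hu1 hu
    (fun i => ⟨m' i, hm' i⟩) (fun i => by
      change coeff 0 (m' i) = 0
      rw [hmY, SkewSeries.coeff_add, coeff_zero_mul, h.coeff_zero, ht, mul_zero, hm0, add_zero])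
    (fun i b => by
      obtain ⟨y, hy, hyb⟩ := hm i b
      refine ⟨y + Y i * ρ b - algebraMap A k b • Y i,
        sub_mem (add_mem hy (mul_mem (hY i) (h.mem_polynomials b))) (smul_mem_restricted _ (hY i)), ?_⟩
      change m' i * ρ b = algebraMap A k b • m' i + _
      have hcomm : ρ t * ρ b = ρ b * ρ t := by rw [← map_mul, mul_comm, map_mul]
      rw [hmY, add_mul, hyb, mul_assoc, hcomm, smul_add, sub_mul, add_mul, smul_mul, mul_assoc]
      abel)
  refine ⟨x, hx, y - ∑ i, x i • Y i, sub_mem hy (sum_mem fun i _ => smul_mem_restricted _ (hY i)), ?_⟩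
  rw [sub_mul, ← hxy, Finset.sum_mul, ← Finset.sum_sub_distrib]
  refine Finset.sum_congr rfl fun i _ => ?_
  change _ = x i • m' i - _
  rw [hmY, smul_add, smul_mul, add_sub_cancel_right]

end IsDrinfeldModule

end

section

open SkewSeries FrobBase

/-! ### Existence of characters of order `r` -/

namespace SkewSeries

variable {p : ℕ} [hp : Fact p.Prime] {R : Type u} [CommRing R] [CharP R p]

/-- The map `y ↦ y f - c y`, which measures how far `y` is from intertwining `f` with the scalar
`c`. -/
noncomputable def defect (f : SkewSeries p R) (c : R) : SkewSeries p R →ₗ[R] SkewSeries p R where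
  toFun y := y * f - c • y
  map_add' x y := by rw [add_mul, smul_add]; abel
  map_smul' a x := by rw [smul_mul, smul_comm c, RingHom.id_apply, smul_sub]

theorem defect_apply (f : SkewSeries p R) (c : R) (y : SkewSeries p R) :
    defect f c y = y * f - c • y := rfl

theorem defect_mem {π : R} {f y : SkewSeries p R} (c : R) (hf : f ∈ restricted p π)
    (hy : y ∈ restricted p π) : defect f c y ∈ restricted p π :=
  sub_mem (mul_mem hy hf) (smul_mem_restricted c hy)

theorem defect_comm {f g : SkewSeries p R} (h : f * g = g * f) (b c : R) (y : SkewSeries p R) :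
    defect f b (defect g c y) = defect g c (defect f b y) := by
  simp only [defect_apply, sub_mul, smul_sub, smul_mul, mul_assoc, h, smul_comm b c]
  abel

variable [IsDomain R] [IsDiscreteValuationRing R] {π : R}

/-- A sequence of restricted series that converges `π`-adically has a restricted limit. -/
theorem exists_restricted_limit (hπ : Irreducible π) [IsAdicComplete (IsLocalRing.maximalIdeal R) R]
    {Y : ℕ → SkewSeries p R} (hY : ∀ n, Y n ∈ restricted p π)
    (hYs : ∀ n, ∃ z, Y (n + 1) - Y n = π ^ n • z) :
    ∃ y ∈ restricted p π, ∀ n, ∃ z, y - Y n = π ^ n • z := by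
  have h1 : ∀ i, ∃ y, ∀ n, π ^ n ∣ y - coeff i (Y n) := fun i =>
    hπ.exists_limit (fun n => coeff i (Y n)) fun n => by
      obtain ⟨z, hz⟩ := hYs n
      exact ⟨coeff i z, by rw [← SkewSeries.coeff_sub, hz]; rfl⟩
  choose y hy using h1
  have h2 : ∀ n, ∃ z, mk y - Y n = π ^ n • z := fun n =>
    exists_eq_smul_of_dvd fun i => hy i n
  refine ⟨mk y, mem_restricted_of_approx fun n => ?_, h2⟩
  obtain ⟨z, hz⟩ := h2 n
  exact ⟨Y n, hY n, z, by rw [← hz, add_sub_cancel]⟩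

/-- If any `r` elements of `N` are dependent modulo the image of `T` and `π`, then any `r` elements of
`N` are dependent modulo the image of `T`: fewer than `r` elements generate `N` modulo the image of
`T`, by successive approximation. -/
theorem exists_relation_of_approx (hπ : Irreducible π) [IsAdicComplete (IsLocalRing.maximalIdeal R) R]
    {N : Submodule R (SkewSeries p R)} {T : SkewSeries p R →ₗ[R] SkewSeries p R} {r : ℕ}
    (h : ∀ x : Fin r → SkewSeries p R, (∀ i, x i ∈ N) → ∃ c : Fin r → R, (∃ i, ¬ π ∣ c i) ∧
      ∃ y ∈ restricted p π, ∃ n ∈ N, ∑ i, c i • x i = T y + π • n)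
    (x : Fin r → SkewSeries p R) (hx : ∀ i, x i ∈ N) :
    ∃ c : Fin r → R, c ≠ 0 ∧ ∃ y ∈ restricted p π, ∑ i, c i • x i = T y := by
  classical
  -- a maximal family of elements that are independent modulo the image of `T` and `π`
  let P : ℕ → Prop := fun s => ∃ g : Fin s → SkewSeries p R, (∀ i, g i ∈ N) ∧
    ∀ c : Fin s → R, (∃ y ∈ restricted p π, ∃ n ∈ N, ∑ i, c i • g i = T y + π • n) → ∀ i, π ∣ c i
  have hr : ∃ s, ¬ P s := by
    refine ⟨r, ?_⟩
    rintro ⟨g, hg, hg'⟩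
    obtain ⟨c, ⟨i, hi⟩, hc⟩ := h g hg
    exact hi (hg' c hc i)
  obtain ⟨s, hs⟩ : ∃ s, Nat.find hr = s + 1 := by
    refine Nat.exists_eq_succ_of_ne_zero fun h0 => ?_
    have h1 := Nat.find_spec hr
    rw [h0] at h1
    exact h1 ⟨fun i => i.elim0, fun i => i.elim0, fun _ _ i => i.elim0⟩
  have hsr : s < r := by
    have : Nat.find hr ≤ r := Nat.find_min' hr (by
      rintro ⟨g, hg, hg'⟩
      obtain ⟨c, ⟨i, hi⟩, hc⟩ := h g hg
      exact hi (hg' c hc i))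
    omega
  obtain ⟨g, hg, hgi⟩ : P s := not_not.mp (Nat.find_min hr (by omega))
  have hmax : ¬ P (s + 1) := hs ▸ Nat.find_spec hr
  have hspan : ∀ n : N, ∃ (c : Fin s → R) (y : SkewSeries p R) (n' : N), y ∈ restricted p π ∧
      (n : SkewSeries p R) = ∑ i, c i • g i + T y + π • (n' : SkewSeries p R) := by
    intro n
    have h1 : ∃ c : Fin (s + 1) → R, (∃ y ∈ restricted p π, ∃ n' ∈ N, c 0 • (n : SkewSeries p R) +
        ∑ i, c (Fin.succ i) • g i = T y + π • n') ∧ ∃ i, ¬ π ∣ c i := by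
      by_contra! h1
      refine hmax ⟨Fin.cons n.1 g, fun i => Fin.cases n.2 hg i, fun c hc => h1 c ?_⟩
      simpa [Fin.sum_univ_succ] using hc
    obtain ⟨c, ⟨y, hy, n', hn', e⟩, i, hi⟩ := h1
    rcases hπ.isUnit_or_dvd (c 0) with hu | ⟨c', hc'⟩
    · obtain ⟨u, hu⟩ := hu.exists_left_inv
      refine ⟨fun i => -(u * c i.succ), u • y, ⟨u • n', N.smul_mem _ hn'⟩,
        smul_mem_restricted _ hy, ?_⟩
      have h2 : (n : SkewSeries p R) = u • (c 0 • (n : SkewSeries p R)) := by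
        rw [smul_smul, hu, one_smul]
      rw [h2, eq_sub_of_add_eq e, LinearMap.map_smul, smul_sub, smul_add, smul_comm u π,
        Finset.smul_sum]
      simp only [neg_smul, Finset.sum_neg_distrib, smul_smul]
      abel
    · exfalso
      have h2 := hgi (fun i => c i.succ) ⟨y, hy, n' - c' • n.1, N.sub_mem hn' (N.smul_mem _ n.2), by
        rw [eq_sub_of_add_eq' e, hc', smul_sub, smul_smul]
        abel⟩
      refine hi (Fin.cases ⟨c', hc'⟩ (fun j => ?_) i)
      exact h2 j
  -- successive approximation
  have hgen : ∀ n ∈ N, ∃ c : Fin s → R, ∃ y ∈ restricted p π, n = ∑ i, c i • g i + T y := by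
    intro n hn
    choose c y ν hy hν using hspan
    let a : ℕ → N := fun j => ν^[j] ⟨n, hn⟩
    have ha : ∀ j, a (j + 1) = ν (a j) := fun j => Function.iterate_succ_apply' _ _ _
    let C : Fin s → ℕ → R := fun i j => ∑ l ∈ Finset.range j, π ^ l * c (a l) i
    let Y : ℕ → SkewSeries p R := fun j => ∑ l ∈ Finset.range j, π ^ l • y (a l)
    have hinv : ∀ j, n = ∑ i, C i j • g i + T (Y j) + π ^ j • (a j : SkewSeries p R) := by
      intro j
      induction j with
      | zero => simp [C, Y, a]
      | succ j ih =>
        have h1 : ∀ i, C i (j + 1) • g i = C i j • g i + π ^ j • (c (a j) i • g i) := fun i => by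
          simp only [C, Finset.sum_range_succ, add_smul, smul_smul]
        have h2 : T (Y (j + 1)) = T (Y j) + π ^ j • T (y (a j)) := by
          simp only [Y, Finset.sum_range_succ, map_add, LinearMap.map_smul]
        have h3 : π ^ (j + 1) • (a (j + 1) : SkewSeries p R) =
            π ^ j • (π • (ν (a j) : SkewSeries p R)) := by rw [ha, smul_smul, pow_succ]
        rw [h2, h3, Finset.sum_congr rfl fun i _ => h1 i, Finset.sum_add_distrib, ← Finset.smul_sum]
        conv_lhs => rw [ih, hν (a j)]
        simp only [smul_add]
        abel
    have hlim := fun i => hπ.exists_limit (C i) fun j => ⟨c (a j) i, by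
      simp only [C, Finset.sum_range_succ, add_sub_cancel_left]⟩
    choose c' hc' using hlim
    obtain ⟨y', hy', hyl⟩ := exists_restricted_limit hπ (Y := Y)
      (fun j => sum_mem fun l _ => smul_mem_restricted _ (hy _))
      (fun j => ⟨y (a j), by simp only [Y, Finset.sum_range_succ, add_sub_cancel_left]⟩)
    refine ⟨c', y', hy', sub_eq_zero.mp (SkewSeries.ext fun i => ?_)⟩
    refine hπ.eq_zero_of_forall_pow_dvd fun j => ?_
    obtain ⟨z, hz⟩ := hyl j
    choose b hb using fun i => hc' i j
    have h1 : n - (∑ i, c' i • g i + T y') = π ^ j • ((a j : SkewSeries p R) - ∑ i, b i • g i - T z) := by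
      have h2 : ∀ i, c' i • g i = C i j • g i + π ^ j • (b i • g i) := fun i => by
        rw [smul_smul, ← hb, ← add_smul, add_sub_cancel]
      have h3 : T y' = T (Y j) + π ^ j • T z := by
        rw [← LinearMap.map_smul, ← hz, ← map_add, add_sub_cancel]
      rw [h3, Finset.sum_congr rfl fun i _ => h2 i, Finset.sum_add_distrib, ← Finset.smul_sum]
      conv_lhs => rw [hinv j]
      simp only [smul_sub]
      abel
    rw [h1]
    exact Dvd.intro _ rfl
  choose c y hy hxc using fun i => hgen (x i) (hx i)
  -- `r` vectors of length `s < r` are dependent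
  obtain ⟨v, hv, hv0⟩ : ∃ v : Fin r → R, (∀ i, ∑ j, v j * c j i = 0) ∧ v ≠ 0 := by
    by_contra! hv
    have h1 := card_le_of_injective R (Matrix.vecMulLinear (Matrix.of c))
      ((injective_iff_map_eq_zero _).mpr fun v hv' => hv v fun i => congrFun hv' i)
    rw [Fintype.card_fin, Fintype.card_fin] at h1
    omega
  refine ⟨v, hv0, ∑ j, v j • y j, sum_mem fun j _ => smul_mem_restricted _ (hy j), ?_⟩
  rw [map_sum, Finset.sum_congr rfl fun j _ => by rw [hxc j]]
  simp only [smul_add, Finset.sum_add_distrib, Finset.smul_sum, smul_smul, LinearMap.map_smul]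
  rw [Finset.sum_comm, add_eq_right]
  refine Finset.sum_eq_zero fun i _ => ?_
  rw [← Finset.sum_smul, hv, zero_smul]

end SkewSeries

namespace AdmissibleModule

variable {A : Type w} [CommRing A] {R : Type u} [CommRing R] [Algebra A R] {D : FrobBase R}
  {E : AdmissibleModule A D} [CharP R D.p] [IsDomain R] [IsDiscreteValuationRing R]
  {ρ : A →+* SkewSeries D.p R}

variable (D ρ) in
/-- The restricted series without constant term which are `A`-linear up to the image of
`y ↦ y ρ_t - π y`: the values at `t` of the cocycles that describe
extensions of `E` by the additive group. -/
def cocycles (t : A) : Submodule R (SkewSeries D.p R) where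
  carrier := {x | x ∈ restricted D.p D.π ∧ coeff 0 x = 0 ∧
    ∀ b : A, ∃ z ∈ restricted D.p D.π,
      defect (ρ b) (algebraMap A R b) x = defect (ρ t) D.π z}
  zero_mem' := ⟨zero_mem _, rfl, fun b => ⟨0, zero_mem _, by rw [map_zero, map_zero]⟩⟩
  add_mem' := by
    rintro x y ⟨hx, hx0, hxb⟩ ⟨hy, hy0, hyb⟩
    refine ⟨add_mem hx hy, by rw [SkewSeries.coeff_add, hx0, hy0, add_zero], fun b => ?_⟩
    obtain ⟨z, hz, e⟩ := hxb b
    obtain ⟨z', hz', e'⟩ := hyb b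
    exact ⟨z + z', add_mem hz hz', by rw [map_add, map_add, e, e']⟩
  smul_mem' := by
    rintro c x ⟨hx, hx0, hxb⟩
    refine ⟨smul_mem_restricted c hx, by rw [SkewSeries.coeff_smul, hx0, smul_zero], fun b => ?_⟩
    obtain ⟨z, hz, e⟩ := hxb b
    exact ⟨c • z, smul_mem_restricted c hz, by rw [LinearMap.map_smul, LinearMap.map_smul, e]⟩

variable [CharP (IsLocalRing.ResidueField R) D.p]

/-- Divisibility by `π` can be cancelled from coboundaries. -/
theorem exists_eq_smul_of_defect (hπ : Irreducible D.π) {f z w : SkewSeries D.p R}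
    (hf : reduce f ≠ 0) (hz : z ∈ restricted D.p D.π) (h : defect f D.π z = D.π • w) :
    ∃ z' ∈ restricted D.p D.π, z = D.π • z' := by
  obtain ⟨z', rfl⟩ := exists_eq_smul_of_mul hπ hf (x := z) (z := w + z) (by
    rw [smul_add, ← h, defect_apply, sub_add_cancel])
  exact ⟨z', mem_restricted_of_smul hπ.ne_zero 1 (by rw [pow_one]) hz, rfl⟩

/-- A dependence modulo `π` among the reductions of cocycles lifts to a dependence of the cocycles
modulo coboundaries and `π`. -/
theorem IsGivenBy.exists_cocycle_relation (hρ : E.IsGivenBy ρ) (hπ : Irreducible D.π) {t : A}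
    (ht : algebraMap A R t = D.π) (ht0 : reduce (ρ t) ≠ 0) {r : ℕ}
    (hdep : ∀ m : Fin r → SkewSeries D.p (IsLocalRing.ResidueField R),
      (∀ i, m i ∈ polynomials D.p (IsLocalRing.ResidueField R)) → (∀ i, coeff 0 (m i) = 0) →
      (∀ i, ∀ b : A, ∃ y ∈ polynomials D.p (IsLocalRing.ResidueField R),
        m i * reduce (ρ b) = IsLocalRing.residue R (algebraMap A R b) • m i + y * reduce (ρ t)) →
      ∃ x : Fin r → IsLocalRing.ResidueField R, x ≠ 0 ∧
        ∃ y ∈ polynomials D.p (IsLocalRing.ResidueField R), ∑ i, x i • m i = y * reduce (ρ t))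
    (x : Fin r → SkewSeries D.p R) (hx : ∀ i, x i ∈ cocycles D ρ t) :
    ∃ c : Fin r → R, (∃ i, ¬ D.π ∣ c i) ∧ ∃ y ∈ restricted D.p D.π, ∃ n ∈ cocycles D ρ t,
      ∑ i, c i • x i = defect (ρ t) D.π y + D.π • n := by
  have hπ0 : IsLocalRing.residue R D.π = 0 := (residue_eq_zero_iff_dvd hπ).mpr dvd_rfl
  have hred : ∀ f ∈ restricted D.p D.π, reduce f ∈ polynomials D.p (IsLocalRing.ResidueField R) :=
    fun f hf => mem_polynomials_iff.mpr (exists_reduce_eq_zero hπ hf)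
  obtain ⟨c', hc', y', hy', hcy⟩ := hdep (fun i => reduce (x i)) (fun i => hred _ (hx i).1)
    (fun i => by rw [SkewSeries.coeff_map, (hx i).2.1, _root_.map_zero]) (fun i b => by
      obtain ⟨z, hz, hzb⟩ := (hx i).2.2 b
      refine ⟨reduce z, hred z hz, ?_⟩
      have h1 := congrArg reduce hzb
      rw [defect_apply, defect_apply, map_sub, map_sub, SkewSeries.map_smul, SkewSeries.map_smul,
        hπ0, zero_smul, sub_zero, _root_.map_mul, _root_.map_mul] at h1
      rw [← h1, add_sub_cancel])
  choose c hc using fun i => IsLocalRing.residue_surjective (c' i)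
  obtain ⟨I, hI⟩ := mem_polynomials_iff.mp hy'
  obtain ⟨y, hy, rfl⟩ := exists_reduce_eq (π := D.π) hI
  have h1 : reduce (∑ i, c i • x i - defect (ρ t) D.π y) = 0 := by
    rw [map_sub, map_sum, defect_apply, map_sub, _root_.map_mul, ← hcy, SkewSeries.map_smul, hπ0, zero_smul,
      sub_zero, sub_eq_zero]
    exact Finset.sum_congr rfl fun i _ => by rw [SkewSeries.map_smul, hc]
  obtain ⟨n, hn⟩ := (reduce_eq_zero_iff hπ).mp h1
  have hsum : ∑ i, c i • x i ∈ cocycles D ρ t :=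
    sum_mem fun i _ => Submodule.smul_mem _ _ (hx i)
  have hD0 : coeff 0 (defect (ρ t) D.π y) = 0 := by
    rw [defect_apply, SkewSeries.coeff_sub, coeff_zero_mul, hρ.coeff_zero, ht,
      SkewSeries.coeff_smul, smul_eq_mul, mul_comm, sub_self]
  refine ⟨c, ?_, y, hy, n, ⟨?_, ?_, fun b => ?_⟩, by rw [← hn, add_sub_cancel]⟩
  · by_contra! h
    refine hc' (funext fun i => ?_)
    rw [← hc, Pi.zero_apply]
    exact (residue_eq_zero_iff_dvd hπ).mpr (h i)
  · exact mem_restricted_of_smul hπ.ne_zero 1 (by rw [pow_one])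
      (hn ▸ sub_mem hsum.1 (defect_mem _ (hρ.mem t) hy))
  · have h2 := congrArg (coeff 0) hn
    rw [SkewSeries.coeff_sub, hsum.2.1, hD0, sub_zero, SkewSeries.coeff_smul, smul_eq_mul] at h2
    exact (mul_eq_zero.mp h2.symm).resolve_left hπ.ne_zero
  · obtain ⟨z, hz, hzb⟩ := hsum.2.2 b
    have hcomm : ρ b * ρ t = ρ t * ρ b := by rw [← _root_.map_mul, mul_comm, _root_.map_mul]
    have h2 : defect (ρ t) D.π (z - defect (ρ b) (algebraMap A R b) y) =
        D.π • defect (ρ b) (algebraMap A R b) n := by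
      rw [map_sub, ← hzb, ← defect_comm hcomm, ← map_sub, hn, LinearMap.map_smul]
    obtain ⟨z', hz', hzz⟩ := exists_eq_smul_of_defect hπ ht0
      (sub_mem hz (defect_mem _ (hρ.mem b) hy)) h2
    refine ⟨z', hz', smul_left_injective hπ.ne_zero ?_⟩
    rw [← h2, hzz, LinearMap.map_smul]

end AdmissibleModule

namespace AdmissibleModule

variable {A : Type w} [CommRing A] {R : Type u} [CommRing R] [Algebra A R] {D : FrobBase R}
  {E : AdmissibleModule A D} [CharP R D.p] [IsDomain R] [IsDiscreteValuationRing R]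
  {ρ : A →+* SkewSeries D.p R}
  {K : Type u} [Field K] [Algebra R K] [IsFractionRing R K] [CharP K D.p]

theorem toFrac_defect (f : SkewSeries D.p R) (c : R) (y : SkewSeries D.p R) :
    toFrac K (defect f c y) = defect (toFrac K f) (algebraMap R K c) (toFrac K y) := by
  rw [defect_apply, defect_apply, map_sub, _root_.map_mul, SkewSeries.map_smul]

/-- `φ ^ m` lifts the power `q̂ ^ m` of Frobenius. -/
theorem dvd_pow_φ_sub (m : ℕ) (x : R) : D.π ∣ (D.φ ^ m) x - x ^ D.p ^ (D.e * m) := by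
  induction m with
  | zero => simp
  | succ m ih =>
    obtain ⟨y, hy⟩ := ih
    have h1 : (D.φ ^ m) x = x ^ D.p ^ (D.e * m) + D.π * y := by rw [← hy]; ring
    obtain ⟨z, hz⟩ := D.φ_frob (x ^ D.p ^ (D.e * m))
    have h2 : (D.φ ^ (m + 1)) x = D.φ ((D.φ ^ m) x) := by rw [pow_succ']; rfl
    rw [h2, h1, _root_.map_add, hz, _root_.map_mul, D.φ_π, ← pow_mul, ← pow_add,
      Nat.mul_succ]
    exact ⟨z + D.φ y, by ring⟩

/-- The Frobenius `τ ^ (e m)` intertwines a series with its twist by `φ ^ m` modulo `π`. -/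
theorem exists_tau_mul_eq (m : ℕ) (f : SkewSeries D.p R) : ∃ w, tau (D.e * m) * f =
    SkewSeries.map (D.φ ^ m) f * tau (D.e * m) + D.π • w := by
  have h1 : ∀ i, D.π ∣ coeff i (tau (D.e * m) * f - SkewSeries.map (D.φ ^ m) f * tau (D.e * m)) := by
    intro i
    rw [SkewSeries.coeff_sub, coeff_tau_mul, coeff_mul_tau]
    split_ifs
    · rw [SkewSeries.coeff_map, ← dvd_neg, neg_sub]
      exact dvd_pow_φ_sub m _
    · rw [sub_zero]
      exact dvd_zero _
  obtain ⟨w, hw⟩ := exists_eq_smul_of_dvd h1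
  exact ⟨w, by rw [← hw, add_sub_cancel]⟩

/-- For `m > 0`, the logarithm of the twist by `φ ^ m`, precomposed with Frobenius, is `A`-linear up to
restricted series. -/
theorem IsGivenBy.exists_toFrac_eq_defect (hρ : E.IsGivenBy ρ) (hπ : Irreducible D.π) {t : A}
    (ht : algebraMap A R t = D.π) (hφ : ∀ a : A, D.φ (algebraMap A R a) = algebraMap A R a)
    {m : ℕ} (hm : m ≠ 0) (b : A) : ∃ x ∈ restricted D.p D.π, coeff 0 x = 0 ∧
      toFrac K x = defect (toFrac K (ρ b)) (algebraMap R K (algebraMap A R b))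
        (twistLog D ρ K t m * toFrac K (tau (D.e * m) : SkewSeries D.p R)) := by
  obtain ⟨s, hs, hs1, hs0, -⟩ := exists_conj_logSeries (K := K) hπ (SkewSeries.map (D.φ ^ m) (ρ t))
    (by rw [hρ.coeff_zero_map hφ, ht])
  obtain ⟨w, hw⟩ := exists_tau_mul_eq (D := D) m (ρ b)
  have hem : D.e * m ≠ 0 := mul_ne_zero D.e_pos.ne' hm
  have hπw : D.π • w = tau (D.e * m) * ρ b - SkewSeries.map (D.φ ^ m) (ρ b) * tau (D.e * m) := by
    rw [hw, add_sub_cancel_left]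
  have hw0 : coeff 0 w = 0 := by
    have h1 := congrArg (coeff 0) hπw
    rw [SkewSeries.coeff_smul, SkewSeries.coeff_sub, coeff_zero_mul, coeff_zero_mul, coeff_tau,
      if_neg hem.symm, zero_mul, mul_zero, sub_zero, smul_eq_mul] at h1
    exact (mul_eq_zero.mp h1).resolve_left hπ.ne_zero
  have hwr : w ∈ restricted D.p D.π := mem_restricted_of_smul hπ.ne_zero 1 (by rw [pow_one]) (by
    have hφm : (D.φ ^ m) D.π = D.π := by rw [← ht, pow_φ_algebraMap hφ]
    rw [hπw]
    exact sub_mem (mul_mem (tau_mem_restricted _) (hρ.mem b))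
      (mul_mem (map_mem_restricted hφm (hρ.mem b)) (tau_mem_restricted _)))
  refine ⟨D.π • (s * w), smul_mem_restricted _ (mul_mem hs hwr), ?_, ?_⟩
  · rw [SkewSeries.coeff_smul, coeff_zero_mul, hw0, mul_zero, smul_zero]
  · rw [← twistLog] at hs1
    rw [defect_apply, mul_assoc, ← _root_.map_mul, hw, map_add, _root_.map_mul, mul_add, ← mul_assoc,
      hρ.twistLog_mul hπ ht hφ, smul_mul, add_sub_cancel_left, SkewSeries.map_smul,
      _root_.map_mul, ← smul_mul, hs1, mul_assoc, ← _root_.map_mul, const_mul]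

variable [CharP (IsLocalRing.ResidueField R) D.p]

/-- The `r` cocycles attached to the logarithms of the twists of `E` are dependent modulo coboundaries,
and a dependence is the same as a character of order `r`. -/
theorem IsGivenBy.X_ne_bot (hρ : E.IsGivenBy ρ) (hπ : Irreducible D.π)
    [IsAdicComplete (IsLocalRing.maximalIdeal R) R] {t : A}
    (ht : algebraMap A R t = D.π) (hφ : ∀ a : A, D.φ (algebraMap A R a) = algebraMap A R a)
    (ht0 : reduce (ρ t) ≠ 0) {r : ℕ}
    (hdep : ∀ m : Fin r → SkewSeries D.p (IsLocalRing.ResidueField R),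
      (∀ i, m i ∈ polynomials D.p (IsLocalRing.ResidueField R)) → (∀ i, coeff 0 (m i) = 0) →
      (∀ i, ∀ b : A, ∃ y ∈ polynomials D.p (IsLocalRing.ResidueField R),
        m i * reduce (ρ b) = IsLocalRing.residue R (algebraMap A R b) • m i + y * reduce (ρ t)) →
      ∃ x : Fin r → IsLocalRing.ResidueField R, x ≠ 0 ∧
        ∃ y ∈ polynomials D.p (IsLocalRing.ResidueField R), ∑ i, x i • m i = y * reduce (ρ t)) :
    E.X r ≠ ⊥ := by
  let K := FractionRing R
  have : CharP K D.p := charP_of_algebra R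
  have hπK := algebraMap_π_ne_zero (K := K) hπ
  have hL := hρ.twistLog_mul (K := K) hπ ht hφ
  have hs := fun m => exists_conj_logSeries (K := K) hπ (SkewSeries.map (D.φ ^ m) (ρ t))
    (by rw [hρ.coeff_zero_map hφ, ht])
  choose s hsr hs1 hs0 hsc using hs
  have hs1 : ∀ m, algebraMap R K D.π • toFrac K (s m) =
    twistLog D ρ K t m * toFrac K (const D.π) := hs1
  have hε := fun (j : Fin r) (b : A) =>
    hρ.exists_toFrac_eq_defect (K := K) hπ ht hφ (Nat.succ_ne_zero (j : ℕ)) b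
  choose ε hεr hε0 hεd using hε
  have hL0 : ∀ m, coeff 0 (twistLog D ρ K t m) = 1 := fun m => coeff_zero_logSeries _
  set L := twistLog D ρ K t with hLdef
  have hcoc : ∀ j, ε j t ∈ cocycles D ρ t := fun j => by
    refine ⟨hεr j t, hε0 j t, fun b => ⟨ε j b, hεr j b, ?_⟩⟩
    have hcomm : toFrac K (ρ b) * toFrac K (ρ t) = toFrac K (ρ t) * toFrac K (ρ b) := by
      rw [← _root_.map_mul, ← _root_.map_mul, ← _root_.map_mul, ← _root_.map_mul, mul_comm]
    apply toFrac_injective (K := K)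
    rw [toFrac_defect, toFrac_defect, hεd, hεd, ht, defect_comm hcomm]
  obtain ⟨v, hv, y, hy, hvy⟩ := exists_relation_of_approx hπ
    (hρ.exists_cocycle_relation hπ ht ht0 hdep) (fun j => ε j t) hcoc
  -- the combination of logarithms which differs from the restricted series `y` by a multiple of `L 0`
  let z := toFrac K y - ∑ j, algebraMap R K (v j) •
    (L (j + 1) * toFrac K (tau (D.e * (j + 1)) : SkewSeries D.p R))
  have hz : z = coeff 0 z • L 0 := by
    refine eq_smul_logSeries hπ (ρ t) (by rw [hρ.coeff_zero, ht]) (sub_eq_zero.mp ?_)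
    rw [← defect_apply, map_sub, map_sum]
    have h1 := congrArg (toFrac K) hvy
    rw [map_sum, toFrac_defect] at h1
    rw [← h1, sub_eq_zero]
    refine Finset.sum_congr rfl fun j _ => ?_
    rw [SkewSeries.map_smul, hεd, LinearMap.map_smul, ht]
  -- the character will be `∑ c m • L m ∘ w m`, with coordinates `g j`
  let v' : ℕ → R := fun m => if h : m < r then v ⟨m, h⟩ else 0
  let c : ℕ → K := fun m => if m = 0 then coeff 0 z else algebraMap R K (v' (m - 1))
  have hc0 : c 0 = coeff 0 z := rfl
  have hcs : ∀ m, c (m + 1) = algebraMap R K (v' m) := fun m => rfl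
  let g : ℕ → SkewSeries D.p R := fun j => if j = 0 then y else
    ∑ l ∈ Finset.range (r + 1 - j), v' (j - 1 + l) •
      (D.π • (s (j + l) * (const (D.π ^ (j - 1)) * tau (D.e * l))))
  have hg0 : g 0 = y := rfl
  have hgs : ∀ j, g (j + 1) = ∑ l ∈ Finset.range (r + 1 - (j + 1)), v' (j + l) •
      (D.π • (s (j + 1 + l) * (const (D.π ^ j) * tau (D.e * l)))) := fun j => rfl
  have hgr : ∀ j ≤ r, g j ∈ restricted D.p D.π := by
    rintro (_ | j) -
    · exact hy
    · rw [hgs]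
      exact sum_mem fun l _ => smul_mem_restricted _ (smul_mem_restricted _ (mul_mem (hsr _)
        (mul_mem (const_mem_restricted _) (tau_mem_restricted _))))
  have hgc : ∀ j ≤ r, toFrac K (g j) = ∑ l ∈ Finset.range (r + 1 - j),
      c (j + l) • (L (j + l) * toFrac K (const (D.π ^ j) * tau (D.e * l))) := by
    rintro (_ | j) -
    · rw [Nat.sub_zero, Finset.sum_range_succ', hg0, ← Fin.sum_univ_eq_sum_range
        (fun l => c (0 + (l + 1)) • (L (0 + (l + 1)) *
          toFrac K (const (D.π ^ 0) * tau (D.e * (l + 1)))))]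
      simp only [zero_add, pow_zero, _root_.map_one, one_mul, mul_zero, tau_zero, mul_one]
      rw [hc0, ← hz, ← sub_eq_iff_eq_add']
      refine congrArg _ (Finset.sum_congr rfl fun j _ => ?_)
      rw [hcs]
      simp only [v', dif_pos j.2]
    · rw [hgs, map_sum]
      refine Finset.sum_congr rfl fun l _ => ?_
      rw [SkewSeries.map_smul, SkewSeries.map_smul, _root_.map_mul, ← smul_mul, hs1,
        show j + 1 + l = j + l + 1 by ring, hcs, mul_assoc, ← _root_.map_mul, ← mul_assoc,
        ← _root_.map_mul, ← pow_succ']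
  obtain ⟨Θ, hΘ, hΘe⟩ := hρ.exists_mem_X hπ.ne_zero hL r c g hgr hgc
  rw [Submodule.ne_bot_iff]
  refine ⟨Θ, hΘ, fun h0 => hv (funext fun j => ?_)⟩
  have h1 : g (j + 1) = 0 := eq_zero_of_sum_eval_eq_zero hπ (n := r) (g := g)
    (fun B x => by rw [← hΘe, h0]; rfl) j.2 (hgr _ j.2)
  -- the constant term of the `j`-th coordinate is `π ^ j` times the `j`-th coefficient
  have h2 := congrArg (coeff 0) (hgc (j + 1) j.2)
  rw [h1, _root_.map_zero, SkewSeries.coeff_zero, SkewSeries.coeff_sum, Finset.sum_eq_single 0] at h2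
  · rw [SkewSeries.coeff_smul, coeff_zero_mul, add_zero, hL0, one_mul, SkewSeries.coeff_map, mul_zero,
      tau_zero, mul_one, coeff_zero_const, smul_eq_mul, map_pow, hcs] at h2
    have h3 := (mul_eq_zero.mp h2.symm).resolve_right (pow_ne_zero _ hπK)
    rw [map_eq_zero_iff _ (IsFractionRing.injective R K)] at h3
    simpa [v'] using h3
  · intro l _ hl
    rw [SkewSeries.coeff_smul, coeff_zero_mul, SkewSeries.coeff_map, coeff_zero_mul, coeff_tau,
      if_neg (mul_ne_zero D.e_pos.ne' hl).symm, mul_zero, _root_.map_zero, mul_zero, smul_zero]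
  · intro h
    exact absurd (Finset.mem_range.mpr (by omega)) h

end AdmissibleModule

end

open SkewSeries FrobBase TensorProduct

/-! ### Splitting orders of Drinfeld modules -/

theorem theoremX1
    -- the curve, given by its function field `F` over the finite field `Fq`, and the point `∞`
    {Fq : Type v} {F : Type w} [Field Fq] [Finite Fq] [Field F] [Algebra Fq F]
    (hF : IsFunctionFieldOver Fq F)
    (vinf : Valuation F (WithZero (Multiplicative ℤ))) (hvinf : IsDegreeOnePlace Fq vinf)
    -- the maximal ideal `𝔭` of `A` and the element `t`
    (𝔭 : Ideal (regularRing vinf)) (h𝔭 : 𝔭.IsMaximal)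
    (t : regularRing vinf) (ht : t ∈ 𝔭) (ht2 : t ∉ 𝔭 ^ 2)
    -- the complete discrete valuation ring `R` with maximal ideal `π R` and Frobenius lift `φ`
    {R : Type u} [CommRing R] [IsDomain R] [IsDiscreteValuationRing R]
    [Algebra (regularRing vinf) R] (D : FrobBase R)
    (hπ : D.π = algebraMap (regularRing vinf) R t)
    (hR : IsLocalRing.maximalIdeal R = Ideal.span {D.π})
    [IsAdicComplete (IsLocalRing.maximalIdeal R) R]
    (hq : D.qhat = Nat.card (regularRing vinf ⧸ 𝔭))
    (hφ : ∀ a : regularRing vinf,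
      D.φ (algebraMap (regularRing vinf) R a) = algebraMap (regularRing vinf) R a)
    -- the Drinfeld module `E` of rank `r`
    (r : ℕ) (E : AdmissibleModule (regularRing vinf) D) (hE : E.IsDrinfeld (infNorm Fq vinf) r) :
    E.X r ≠ ⊥ ∧
    (Nonempty (E.X 1 ≃ₗ[R] R) ∨ E.X 1 = ⊥) ∧
    (E.HasFrobeniusLift → Nonempty (E.X 1 ≃ₗ[R] R)) ∧
    (3 ≤ Nat.card Fq → (Nonempty (E.X 1 ≃ₗ[R] R) ↔ E.HasFrobeniusLift)) ∧
    (∃! m : ℕ, E.SplitsAt m) ∧ (∀ m : ℕ, E.SplitsAt m → 1 ≤ m ∧ m ≤ r) := by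
  have hirr : Irreducible D.π := (IsDiscreteValuationRing.irreducible_iff_uniformizer D.π).mpr hR
  have := D.charP
  have : Fact D.p.Prime := ⟨D.p_prime⟩
  let k := IsLocalRing.ResidueField R
  have : CharP k D.p := charP_of_algebra R
  have hresπ : IsLocalRing.residue R D.π = 0 := (residue_eq_zero_iff_dvd hirr).mpr dvd_rfl
  obtain ⟨ρ, hρ⟩ := E.exists_isGivenBy hirr
  -- the degrees of the reductions
  have htop : ∀ a : regularRing vinf, a ≠ 0 → ∃ n, coeff n (reduce (ρ a)) ≠ 0 ∧
      (∀ i, n < i → coeff i (reduce (ρ a)) = 0) ∧ (D.p : ℚ) ^ n = infNorm Fq vinf a ^ r :=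
    fun a ha => AdmissibleModule.KernelHasDegree.exists_top_coeff E hirr hρ (hE a ha)
  have ht0 : t ≠ 0 := by
    rintro rfl
    exact hirr.ne_zero (hπ.trans (map_zero _))
  have htu : ¬ IsUnit t := fun h => hirr.not_isUnit (hπ ▸ h.map (algebraMap (regularRing vinf) R))
  have htr : reduce (ρ t) ≠ 0 := by
    obtain ⟨n, hn, -⟩ := htop t ht0
    intro h
    exact hn (by rw [h]; rfl)
  -- the characteristic of `Fq` is that of `R`
  have hFq : CharP Fq D.p := by
    have hinj := ((algebraMap (regularRing vinf) R).comp (algebraMap Fq (regularRing vinf))).injective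
    exact (RingHom.charP_iff _ hinj D.p).mpr inferInstance
  have := Fintype.ofFinite Fq
  obtain ⟨f, -, hf⟩ := FiniteField.card Fq D.p
  have hcard : Nat.card Fq = D.p ^ (f : ℕ) := by rw [Nat.card_eq_fintype_card, hf]
  have hf0 : 0 < (f : ℕ) := f.pos
  have hp1 : (1 : ℚ) < D.p := by exact_mod_cast D.p_prime.one_lt
  have hnorm : ∀ (a : regularRing vinf) (n : ℕ), (D.p : ℚ) ^ n = infNorm Fq vinf a ^ r →
      (n : ℤ) = f * WithZero.log (vinf a) * r := by
    intro a n h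
    rw [infNorm, hcard, Nat.cast_pow, ← zpow_natCast, ← zpow_natCast, ← zpow_natCast, ← zpow_mul,
      ← zpow_mul] at h
    rw [mul_assoc]
    exact zpow_right_injective₀ (zero_lt_one.trans hp1) hp1.ne' h
  -- the constant term of the reduction at `t` vanishes, so that the rank is positive
  have hr0 : 0 < r := by
    obtain ⟨n, hn, -, h⟩ := htop t ht0
    rw [Nat.pos_iff_ne_zero]
    rintro rfl
    have hn0 := hnorm t n h
    rw [Nat.cast_zero, mul_zero, Nat.cast_eq_zero] at hn0
    rw [hn0, SkewSeries.coeff_map, hρ.coeff_zero, ← hπ, hresπ] at hn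
    exact hn rfl
  have hdeg : ∀ a : regularRing vinf, a ≠ 0 → 1 ≤ vinf a := by
    intro a ha
    obtain ⟨n, -, -, h⟩ := htop a ha
    have hn := hnorm a n h
    have hva : vinf a ≠ 0 := (map_ne_zero vinf).mpr fun h => ha (Subtype.ext h)
    rw [← WithZero.log_le_log one_ne_zero hva, WithZero.log_one]
    have hfr : (0 : ℤ) < f * r := by positivity
    by_contra! hlt
    nlinarith
  have htv := one_lt_of_not_isUnit hvinf hdeg ht0 htu
  have hd := isDegree_regularRing hF hvinf hdeg htv
  have : IsIntegrallyClosed (regularRing vinf) := isIntegrallyClosed_regularRing hF htv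
  -- the reduction of `E`
  let _ : Algebra Fq k := ((algebraMap (regularRing vinf) k).comp (algebraMap Fq (regularRing vinf))).toAlgebra
  have : IsScalarTower Fq (regularRing vinf) k := .of_algebraMap_eq fun _ => rfl
  have hDr : IsDrinfeldModule ((reduce (R := R) (p := D.p)).comp ρ)
      (fun a : regularRing vinf => (WithZero.log (vinf a)).toNat) f r := by
    have hdn : ∀ (a : regularRing vinf) (n : ℕ), a ≠ 0 →
        (D.p : ℚ) ^ n = infNorm Fq vinf a ^ r → n = f * (r * (WithZero.log (vinf a)).toNat) := by
      intro a n ha h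
      have hva : vinf a ≠ 0 := (map_ne_zero vinf).mpr fun h => ha (Subtype.ext h)
      have hlog : 0 ≤ WithZero.log (vinf a) := by
        rw [← WithZero.log_one, WithZero.log_le_log one_ne_zero hva]
        exact hdeg a ha
      zify
      rw [hnorm a n h, Int.toNat_of_nonneg hlog]
      ring
    refine ⟨fun a => ?_, fun a ha => ?_, fun a ha => ?_⟩
    · change coeff 0 (reduce (ρ a)) = _
      rw [SkewSeries.coeff_map, hρ.coeff_zero]
      rfl
    · obtain ⟨n, hn, -, h⟩ := htop a ha
      rw [← hdn a n ha h]
      exact hn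
    · obtain ⟨n, -, hn, h⟩ := htop a ha
      rw [← hdn a n ha h]
      exact hn
  have hresA : ∀ a, algebraMap (regularRing vinf) k a =
      IsLocalRing.residue R (algebraMap (regularRing vinf) R a) := fun a => rfl
  have htk : algebraMap (regularRing vinf) k t = 0 := by rw [hresA, ← hπ, hresπ]
  -- `t` generates the kernel of `A → R / π` locally
  let 𝔮 := RingHom.ker (algebraMap (regularRing vinf) k)
  have h𝔮 : 𝔮.IsPrime := RingHom.ker_isPrime _
  have h𝔮t : t ∈ 𝔮 := htk
  have h𝔮t2 : t ∉ 𝔮 ^ 2 := by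
    intro h
    have h1 := Ideal.mem_map_of_mem (algebraMap (regularRing vinf) R) h
    have h2 : 𝔮.map (algebraMap (regularRing vinf) R) ≤ Ideal.span {D.π} :=
      Ideal.map_le_iff_le_comap.mpr fun a ha =>
        Ideal.mem_span_singleton.mpr ((residue_eq_zero_iff_dvd hirr).mp ha)
    rw [Ideal.map_pow] at h1
    have h3 := Ideal.pow_right_mono h2 2 h1
    rw [Ideal.span_singleton_pow, Ideal.mem_span_singleton, ← hπ] at h3
    exact hirr.not_isUnit (isUnit_of_dvd_one
      ((mul_dvd_mul_iff_left hirr.ne_zero).mp (by rwa [mul_one, ← sq])))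
  have : Finite (regularRing vinf ⧸ RingHom.ker (algebraMap (regularRing vinf) k)) :=
    hd.finite_quotient (Submodule.ne_bot_iff _ |>.mpr ⟨t, h𝔮t, ht0⟩)
  obtain ⟨a, ha, hat⟩ := hd.exists_mul_mem_span h𝔮t h𝔮t2
  obtain ⟨u, hu1, hu⟩ := IsDrinfeldModule.exists_augmentation_eq_one (k := k) Fq ha hat
  -- the characters
  have hXr : E.X r ≠ ⊥ := hρ.X_ne_bot hirr hπ.symm hφ htr fun m hmp hm0 hm =>
    hDr.exists_sum_smul_eq hd hf0 hr0 hcard ht0 htk hu1 hu m hmp hm0 hm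
  have hX1 := hρ.nonempty_equiv_or_X_one_eq_bot hirr hπ.symm htr
  have hX1' : Nonempty (E.X 1 ≃ₗ[R] R) ↔ E.X 1 ≠ ⊥ := by
    refine ⟨?_, hX1.resolve_right⟩
    rintro ⟨g⟩ h
    have : Subsingleton (E.X 1) := (Submodule.subsingleton_iff_eq_bot).mpr h
    exact one_ne_zero (g.symm.injective (Subsingleton.elim (g.symm 1) (g.symm 0)))
  have hlift : E.HasFrobeniusLift → Nonempty (E.X 1 ≃ₗ[R] R) := fun h =>
    hX1'.mpr (hρ.X_one_ne_bot hirr hπ.symm hφ h)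
  have hX0 := hρ.X_zero_eq_bot hirr hπ.symm htr
  refine ⟨hXr, hX1, hlift, fun hq3 => ⟨fun h => ?_, hlift⟩, ?_, fun m hm => ⟨?_, ?_⟩⟩
  · refine hρ.hasFrobeniusLift_of_X_one_ne_bot hirr hπ.symm hφ htr ?_ (hX1'.mp h)
    by_cases hp3 : 3 ≤ D.p
    · exact .inl hp3
    -- in characteristic two, a constant `c` with `c ^ 2 ≠ c` does the job
    have hp2 : D.p = 2 := le_antisymm (by omega) D.p_prime.two_le
    obtain ⟨c, hc0, hc1⟩ : ∃ c : Fq, c ≠ 0 ∧ c ≠ 1 := by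
      classical
      by_contra! hc
      have h1 : (Finset.univ : Finset Fq) ⊆ {0, 1} := fun c _ => by
        by_cases h : c = 0
        · simp [h]
        · simp [hc c h]
      have h2 := (Finset.card_le_card h1).trans Finset.card_le_two
      rw [Finset.card_univ, ← Nat.card_eq_fintype_card] at h2
      omega
    refine .inr ⟨algebraMap Fq _ c, ?_, ?_⟩
    · rw [← map_pow, ← map_sub]
      refine (IsUnit.map _ (IsUnit.mk0 _ ?_)).map _
      rw [hp2, sq, ← mul_one_sub]
      exact mul_ne_zero hc0 (sub_ne_zero.mpr hc1.symm)
    · have h1 := congrArg (coeff 1) (hDr.map_algebraMap hd c)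
      rw [coeff_const, if_neg one_ne_zero] at h1
      exact (residue_eq_zero_iff_dvd hirr).mp h1
  · classical
    have hex : ∃ m, E.X m ≠ ⊥ := ⟨r, hXr⟩
    refine ⟨Nat.find hex, ⟨Nat.find_spec hex, fun i hi => not_not.mp (Nat.find_min hex hi)⟩, ?_⟩
    rintro m ⟨hm, hm'⟩
    exact ((Nat.find_eq_iff hex).mpr ⟨hm, fun i hi => not_not.mpr (hm' i hi)⟩).symm
  · rw [Nat.one_le_iff_ne_zero]
    rintro rfl
    exact hm.1 hX0
  · by_contra! h
    exact hXr (hm.2 r h)
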